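/- Let $k$ be a field with algebraic closure $\bar k$, and let $E/k$ be an elliptic curve. For $L \in \{k, \bar k\}$ let $\mathrm{End}_L(E)$ denote the $\mathbb{Q}$-algebra of endomorphisms of $E$ defined over $L$, that is, $\mathbb{Q} \otimes_{\mathbb{Z}} R_L$, where $R_L$ is the ring of endomorphisms of $E$ defined over $L$. An involution of the first kind on a ring $A$ is an additive map $\sigma : A \to A$ with $\sigma(xy) = \sigma(y)\sigma(x)$ and $\sigma(\sigma(x)) = x$ for all $x, y \in A$ which is the identity on the center of $A$; it is nontrivial if $\sigma \neq \mathrm{id}$. The curve $E$ is called of spinorial type if $\mathrm{End}_k(E)$ admits a nontrivial involution of the first kind. Consider the following assertions: 1. $E$ is of spinorial type. 2. $\mathrm{End}_k(E) = \mathrm{End}_{\bar k}(E)$ (that is, the natural map $\mathrm{End}_k(E) \to \mathrm{End}_{\bar k}(E)$ is bijective), and this is a quaternion algebra over $\mathbb{Q}$. 3. $E$ is supersingular (that is, $k$ has positive characteristic $p$ and $E(\bar k)$ has no point of order $p$). 4. The characteristic of $k$ is a prime $p > 0$. Then $(1) \Leftrightarrow (2) \Rightarrow (3) \Rightarrow (4)$.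 -/

import Mathlib

namespace EllipticEnd

open MvPolynomial WeierstrassCurve
open scoped WeierstrassCurve.Projective Quaternion TensorProduct

/-! ### Polynomial addition laws

The lemmas of the next two sections serve only to prove that the sum of two regular endomorphisms
of the group of points is regular. -/

section Laws
variable {R : Type*} [CommRing R] (W : WeierstrassCurve.Projective R)

/-- The value of the cubic form at `D` -/
def cub (D : Fin 3 → R) : R :=
  D 1 ^ 2 * D 2 + W.a₁ * D 0 * D 1 * D 2 + W.a₃ * D 1 * D 2 ^ 2
    - (D 0 ^ 3 + W.a₂ * D 0 ^ 2 * D 2 + W.a₄ * D 0 * D 2 ^ 2 + W.a₆ * D 2 ^ 3)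

/-- The derivative at `D` of the cubic form, in the direction `P` -/
def pol (D P : Fin 3 → R) : R :=
  (W.a₁ * D 1 * D 2 - 3 * D 0 ^ 2 - 2 * W.a₂ * D 0 * D 2 - W.a₄ * D 2 ^ 2) * P 0
  + (2 * D 1 * D 2 + W.a₁ * D 0 * D 2 + W.a₃ * D 2 ^ 2) * P 1
  + (D 1 ^ 2 + W.a₁ * D 0 * D 1 + 2 * W.a₃ * D 1 * D 2 - W.a₂ * D 0 ^ 2
      - 2 * W.a₄ * D 0 * D 2 - 3 * W.a₆ * D 2 ^ 2) * P 2

/-- If `P` and `Q = P + s • D` are on the curve, the third point of it on the line through `P` with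
direction `D`. -/
def third (P D : Fin 3 → R) (s : R) : Fin 3 → R :=
  cub W D • P - (pol W D P + cub W D * s) • D

/-- Mathlib's representative of `-(P + Q)` for `P ≠ Q`. -/
def nad (P Q : Fin 3 → R) : Fin 3 → R := ![W.addX P Q, W.negAddY P Q, W.addZ P Q]
/-- Mathlib's representative of `-(P + P)`. -/
noncomputable def ndb (P : Fin 3 → R) : Fin 3 → R := ![W.dblX P, W.negDblY P, W.dblZ P]

lemma nad_third {P D : Fin 3 → R} {s : R} (hP : W.Equation P) (hQ : W.Equation (P + s • D)) :
    nad W P (P + s • D) = s ^ 3 • third W P D s := by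
  rw [Projective.equation_iff] at hP hQ
  simp only [Pi.add_apply, Pi.smul_apply, smul_eq_mul] at hQ
  ext i
  fin_cases i
  · simp [nad, third, cub, pol, Projective.addX]
    linear_combination (-P 0 + 2 * (P 0 + s * D 0)) * hP + (-2 * P 0 + (P 0 + s * D 0)) * hQ
  · simp [nad, third, cub, pol, Projective.negAddY]
    linear_combination (-P 1 + 2 * (P 1 + s * D 1)) * hP + (-2 * P 1 + (P 1 + s * D 1)) * hQ
  · simp [nad, third, cub, pol, Projective.addZ]
    linear_combination (-P 2 + 2 * (P 2 + s * D 2)) * hP + (-2 * P 2 + (P 2 + s * D 2)) * hQ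

lemma third_change {P D : Fin 3 → R} {a b : R} (hP : W.Equation P) (hD : pol W P D = 0) :
    third W P (a • D + b • P) 0 = a ^ 3 • third W P D 0 := by
  rw [Projective.equation_iff] at hP
  ext i
  simp [third, cub, pol] at hD ⊢
  linear_combination (a * b ^ 2 * P i - 2 * a * b * (a * D i + b * P i)) * hD
    + (b ^ 3 * P i - 3 * b ^ 2 * (a * D i + b * P i)) * hP

/-- The direction of the line through `P` and `Q`, or of the tangent line, if `P 2 = Q 2`. -/
def dirA (P Q : Fin 3 → R) : Fin 3 → R :=
  ![P 2 * (P 1 + Q 1) + W.a₁ * P 2 * Q 0 + W.a₃ * P 2 ^ 2,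
    P 0 ^ 2 + P 0 * Q 0 + Q 0 ^ 2 + W.a₂ * P 2 * (P 0 + Q 0) + W.a₄ * P 2 ^ 2 - W.a₁ * P 2 * P 1,
    0]

/-- The direction of the line through `P` and `Q`, or of the tangent line, if `P 1 = Q 1`. -/
def dirO (P Q : Fin 3 → R) : Fin 3 → R :=
  ![P 1 ^ 2 + W.a₁ * P 1 * Q 0 + W.a₃ * P 1 * (P 2 + Q 2) - W.a₂ * Q 0 ^ 2
      - W.a₄ * Q 0 * (P 2 + Q 2) - W.a₆ * (P 2 ^ 2 + P 2 * Q 2 + Q 2 ^ 2),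
    0,
    P 0 ^ 2 + P 0 * Q 0 + Q 0 ^ 2 + W.a₂ * P 2 * (P 0 + Q 0) + W.a₄ * P 2 ^ 2 - W.a₁ * P 1 * P 2]

/-- `third W P D s` for `D 2 = 0` and `t = D 0 * s`. -/
def lineA (P D : Fin 3 → R) (t : R) : Fin 3 → R :=
  (-D 0 ^ 3) • P - (pol W D P - D 0 ^ 2 * t) • D

/-- `D 0 • third W P D s` for `t = D 0 * s`. -/
def lineO (P D : Fin 3 → R) (t : R) : Fin 3 → R :=
  (D 0 * cub W D) • P - (D 0 * pol W D P + cub W D * t) • D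

lemma lineA_eq {P D : Fin 3 → R} {s t : R} (h2 : D 2 = 0) (h : D 0 * s = t) :
    lineA W P D t = third W P D s := by
  subst h
  ext i
  simp [lineA, third, cub, h2]
  ring

lemma lineO_eq {P D : Fin 3 → R} {s t : R} (h : D 0 * s = t) :
    lineO W P D t = D 0 • third W P D s := by
  subst h
  ext i
  simp [lineO, third]
  ring

lemma dirA_rel {P Q : Fin 3 → R} (hP : W.Equation P) (hQ : W.Equation Q) (h : Q 2 = P 2) :
    (Q 1 - P 1) * dirA W P Q 0 = (Q 0 - P 0) * dirA W P Q 1 := by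
  rw [Projective.equation_iff] at hP hQ
  rw [h] at hQ
  simp [dirA]
  linear_combination hQ - hP

lemma dirO_rel {P Q : Fin 3 → R} (hP : W.Equation P) (hQ : W.Equation Q) (h : Q 1 = P 1) :
    (Q 2 - P 2) * dirO W P Q 0 = (Q 0 - P 0) * dirO W P Q 2 := by
  rw [Projective.equation_iff] at hP hQ
  rw [h] at hQ
  simp [dirO]
  linear_combination hQ - hP

lemma third_dirA_self {P : Fin 3 → R} (hP : W.Equation P) :
    third W P (dirA W P P) 0 = (-P 2 ^ 3) • ndb W P := by
  have hX := Projective.dblX_eq' hP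
  have hY := Projective.negDblY_eq' hP
  rw [Projective.eval_polynomialX, Projective.negY] at hX hY
  ext i
  fin_cases i
  · simp [third, cub, pol, dirA, ndb]
    linear_combination (P 2 ^ 2) * hX
  · simp [third, cub, pol, dirA, ndb]
    linear_combination (P 2) * hY
  · simp [third, cub, pol, dirA, ndb, Projective.dblZ, Projective.negY]
    ring

lemma pol_dirA_self (P : Fin 3 → R) : pol W P (dirA W P P) = 0 := by
  simp [pol, dirA]
  ring

lemma dirO_dirA {P : Fin 3 → R} (hP : W.Equation P) :
    P 2 • dirO W P P = (-P 1) • dirA W P P + (P 0 ^ 2 + P 0 * P 0 + P 0 ^ 2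
      + W.a₂ * P 2 * (P 0 + P 0) + W.a₄ * P 2 ^ 2 - W.a₁ * P 1 * P 2) • P := by
  rw [Projective.equation_iff] at hP
  ext i
  fin_cases i
  · simp [dirO, dirA]
    linear_combination (3) * hP
  · simp [dirO, dirA]
    ring
  · simp [dirO, dirA]
    ring

/-- Three polynomial addition laws, valid wherever they do not vanish. -/
noncomputable def law (j : Fin 3) (P Q : Fin 3 → R) : Fin 3 → R :=
  ![W.addXYZ P Q,
    (P 2 * Q 2) • W.neg (lineA W (Q 2 • P) (dirA W (Q 2 • P) (P 2 • Q)) (P 2 * Q 0 - Q 2 * P 0)),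
    (P 1 * Q 1 * dirO W (Q 1 • P) (P 1 • Q) 0) •
      W.neg (lineO W (Q 1 • P) (dirO W (Q 1 • P) (P 1 • Q)) (P 1 * Q 0 - Q 1 * P 0))] j

lemma dirA_smul (P Q : Fin 3 → R) (c : R) : dirA W (c • P) (c • Q) = c ^ 2 • dirA W P Q := by
  ext i
  fin_cases i <;> simp [dirA] <;> ring

lemma dirO_smul (P Q : Fin 3 → R) (c : R) : dirO W (c • P) (c • Q) = c ^ 2 • dirO W P Q := by
  ext i
  fin_cases i <;> simp [dirO] <;> ring

lemma lineA_smul (P D : Fin 3 → R) (c t : R) :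
    lineA W (c • P) (c ^ 2 • D) (c * t) = c ^ 7 • lineA W P D t := by
  ext i
  simp [lineA, pol]
  ring

lemma lineO_smul (P D : Fin 3 → R) (c t : R) :
    lineO W (c • P) (c ^ 2 • D) (c * t) = c ^ 9 • lineO W P D t := by
  ext i
  simp [lineO, pol, cub]
  ring

lemma law_smul (j : Fin 3) (P Q : Fin 3 → R) (u v : R) :
    law W j (u • P) (v • Q) = ((u * v) ^ (![2, 8, 12] j : ℕ)) • law W j P Q := by
  have hP (i : Fin 3) : (v • Q) i • u • P = (u * v) • Q i • P := by
    simp only [Pi.smul_apply, smul_eq_mul, smul_smul]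
    congr 1; ring
  have hQ (i : Fin 3) : (u • P) i • v • Q = (u * v) • P i • Q := by
    simp only [Pi.smul_apply, smul_eq_mul, smul_smul]
    congr 1; ring
  have ht (i : Fin 3) : (u • P) i * (v • Q) 0 - (v • Q) i * (u • P) 0 =
      (u * v) * (P i * Q 0 - Q i * P 0) := by
    simp only [Pi.smul_apply, smul_eq_mul]
    ring
  fin_cases j
  · exact Projective.addXYZ_smul P Q u v
  · simp only [law, Fin.mk_one, Matrix.cons_val_one, Matrix.cons_val_zero, hP, hQ, ht, dirA_smul,
      lineA_smul, Projective.neg_smul]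
    rw [smul_smul, smul_smul]
    congr 1
    simp only [Pi.smul_apply, smul_eq_mul]
    ring
  · simp only [law, Fin.reduceFinMk, Matrix.cons_val, hP, hQ, ht, dirO_smul,
      lineO_smul, Projective.neg_smul]
    rw [smul_smul, smul_smul]
    congr 1
    simp only [Pi.smul_apply, smul_eq_mul]
    ring

lemma law_map {S : Type*} [CommRing S] (f : R →+* S) (j : Fin 3) (P Q : Fin 3 → R) :
    law (W.map f) j (f ∘ P) (f ∘ Q) = f ∘ law W j P Q := by
  fin_cases j
  · exact Projective.map_addXYZ f P Q
  · ext i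
    fin_cases i <;> simp [law, Projective.neg, Projective.negY, lineA, dirA, pol, map_ofNat f]
  · ext i
    fin_cases i <;> simp [law, Projective.neg, Projective.negY, lineO, dirO, pol, cub, map_ofNat f]

end Laws

section Field
variable {F : Type*} [Field F] {W : WeierstrassCurve.Projective F}

lemma third_smul (P D : Fin 3 → F) (c : F) : third W P (c • D) 0 = c ^ 3 • third W P D 0 := by
  ext i
  simp [third, cub, pol]
  ring

lemma third_dirO_self {P : Fin 3 → F} (hP : W.Equation P) :
    third W P (dirO W P P) 0 = P 1 ^ 3 • ndb W P := by
  by_cases hz : P 2 = 0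
  · have hx := Projective.X_eq_zero_of_Z_eq_zero hP hz
    ext i
    fin_cases i <;> simp [third, cub, pol, dirO, ndb, Projective.dblX, Projective.negDblY,
      Projective.dblZ, hx, hz]
    ring
  · have h := third_smul (W := W) P (dirO W P P) (P 2)
    rw [dirO_dirA W hP, third_change W hP (pol_dirA_self W P), third_dirA_self W hP, smul_smul] at h
    have h3 : P 2 ^ 3 ≠ 0 := pow_ne_zero 3 hz
    rw [← inv_smul_smul₀ h3 (third W P (dirO W P P) 0), ← h, smul_smul]
    congr 1
    field_simp

lemma neg_nad (P Q : Fin 3 → F) : W.neg (nad W P Q) = W.addXYZ P Q := rfl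
lemma neg_ndb (P : Fin 3 → F) : W.neg (ndb W P) = W.dblXYZ P := rfl

lemma eq_of_equiv {P Q : Fin 3 → F} (i : Fin 3) (hi : Q i = P i) (h0 : P i ≠ 0) (h : P ≈ Q) :
    P = Q := by
  obtain ⟨u, rfl⟩ := h
  have : (u : F) = 1 := by
    have h1 : (u : F) * Q i = Q i := hi.symm
    have h2 : Q i ≠ 0 := fun h => h0 (by simp [h])
    exact mul_right_cancel₀ h2 (by rw [h1, one_mul])
  simp [Units.smul_def, this]

lemma add_eq_of_line {P D : Fin 3 → F} {s : F} (i : Fin 3) (h0 : P i ≠ 0)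
    (hP : W.Equation P) (hQ : W.Equation (P + s • D)) (hi : (P + s • D) i = P i)
    (hne : P ≠ P + s • D) :
    (⟦W.add P (P + s • D)⟧ : Projective.PointClass F) = ⟦W.neg (third W P D s)⟧ := by
  have hs : s ≠ 0 := by rintro rfl; simp at hne
  rw [Projective.add_of_not_equiv (fun h => hne (eq_of_equiv i hi h0 h)), ← neg_nad,
    nad_third W hP hQ, Projective.neg_smul, Projective.smul_eq _ (pow_ne_zero 3 hs).isUnit]

lemma add_eq_lineA {P Q : Fin 3 → F} (hP : W.Equation P) (hQ : W.Equation Q) (h : Q 2 = P 2)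
    (h0 : P 2 ≠ 0) (hne : lineA W P (dirA W P Q) (Q 0 - P 0) ≠ 0) :
    (⟦W.add P Q⟧ : Projective.PointClass F) =
      ⟦W.neg (lineA W P (dirA W P Q) (Q 0 - P 0))⟧ := by
  by_cases hPQ : P = Q
  · subst hPQ
    rw [lineA_eq W (s := 0) rfl (by simp), third_dirA_self W hP, Projective.add_self, ← neg_ndb,
      Projective.neg_smul, Projective.smul_eq _ (neg_ne_zero.2 (pow_ne_zero 3 h0)).isUnit]
  · have hrel := dirA_rel W hP hQ h
    obtain ⟨s, hs0, hs1⟩ : ∃ s, dirA W P Q 0 * s = Q 0 - P 0 ∧ dirA W P Q 1 * s = Q 1 - P 1 := by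
      by_cases hd : dirA W P Q 0 = 0
      · have hn : dirA W P Q 1 ≠ 0 := by
          intro hn
          apply hne
          have : dirA W P Q = 0 := by ext i; fin_cases i <;> simp_all [dirA]
          simp [lineA, this]
        refine ⟨(Q 1 - P 1) / dirA W P Q 1, ?_, by field_simp⟩
        rw [hd] at hrel ⊢
        have := hrel.symm
        simp only [mul_zero, mul_eq_zero, hn, or_false] at this
        rw [this, zero_mul]
      · refine ⟨(Q 0 - P 0) / dirA W P Q 0, by field_simp, ?_⟩
        field_simp
        linear_combination -hrel
    have hQe : Q = P + s • dirA W P Q := by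
      ext i
      fin_cases i
      · simp; linear_combination -hs0
      · simp; linear_combination -hs1
      · simp [dirA, h]
    rw [lineA_eq W (s := s) rfl hs0]
    generalize dirA W P Q = D at *
    subst hQe
    exact add_eq_of_line 2 h0 hP hQ h hPQ

lemma add_eq_lineO {P Q : Fin 3 → F} (hP : W.Equation P) (hQ : W.Equation Q) (h : Q 1 = P 1)
    (h0 : P 1 ≠ 0) (hne : lineO W P (dirO W P Q) (Q 0 - P 0) ≠ 0)
    (hd : dirO W P Q 0 ≠ 0) :
    (⟦W.add P Q⟧ : Projective.PointClass F) =
      ⟦W.neg (lineO W P (dirO W P Q) (Q 0 - P 0))⟧ := by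
  by_cases hPQ : P = Q
  · subst hPQ
    rw [lineO_eq W (s := 0) (by simp), third_dirO_self hP, Projective.add_self, ← neg_ndb,
      Projective.neg_smul, Projective.smul_eq _ hd.isUnit,
      Projective.neg_smul, Projective.smul_eq _ (pow_ne_zero 3 h0).isUnit]
  · have hrel := dirO_rel W hP hQ h
    obtain ⟨s, hs0, hs1⟩ : ∃ s, dirO W P Q 0 * s = Q 0 - P 0 ∧ dirO W P Q 2 * s = Q 2 - P 2 := by
      refine ⟨(Q 0 - P 0) / dirO W P Q 0, by field_simp, ?_⟩
      field_simp
      linear_combination -hrel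
    have hQe : Q = P + s • dirO W P Q := by
      ext i
      fin_cases i
      · simp; linear_combination -hs0
      · simp [dirO, h]
      · simp; linear_combination -hs1
    rw [lineO_eq W hs0, Projective.neg_smul, Projective.smul_eq _ hd.isUnit]
    generalize dirO W P Q = D at *
    subst hQe
    exact add_eq_of_line 1 h0 hP hQ h hPQ

lemma ne_zero_of_nonsingular {P : Fin 3 → F} (hP : W.Nonsingular P) : P ≠ 0 := by
  rintro rfl
  rw [Projective.nonsingular_iff] at hP
  simp at hP

lemma law_correct (j : Fin 3) {P Q : Fin 3 → F} (hP : W.Nonsingular P) (hQ : W.Nonsingular Q)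
    (h : law W j P Q ≠ 0) :
    (⟦W.add P Q⟧ : Projective.PointClass F) = ⟦law W j P Q⟧ := by
  fin_cases j
  · change W.addXYZ P Q ≠ 0 at h
    change _ = ⟦W.addXYZ P Q⟧
    rw [Projective.add_of_not_equiv]
    rintro ⟨u, rfl⟩
    apply h
    have := Projective.addXYZ_smul (W' := W) Q Q u 1
    rw [one_smul, Projective.addXYZ_self] at this
    change W.addXYZ ((u : F) • Q) Q = 0
    rw [this]
    ext i; fin_cases i <;> simp
  · simp only [law, Fin.mk_one, Matrix.cons_val_one, Matrix.cons_val_zero, ne_eq, smul_eq_zero,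
      not_or] at h ⊢
    obtain ⟨⟨hp, hq⟩, h⟩ := (by simpa using h.1 : P 2 ≠ 0 ∧ Q 2 ≠ 0), h.2
    rw [Projective.smul_eq _ (mul_ne_zero hp hq).isUnit]
    have e := add_eq_lineA (W := W) (P := Q 2 • P) (Q := P 2 • Q)
      ((Projective.equation_smul _ hq.isUnit).2 hP.1) ((Projective.equation_smul _ hp.isUnit).2 hQ.1)
      (by simp [mul_comm]) (by simp [hp, hq])
      (fun h' => h (by
        simp only [Pi.smul_apply, smul_eq_mul] at h'
        rw [h']; ext i; fin_cases i <;> simp [Projective.neg, Projective.negY]))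
    simp only [Pi.smul_apply, smul_eq_mul] at e
    rw [← e]
    exact (Quotient.sound (Projective.add_smul_equiv P Q hq.isUnit hp.isUnit)).symm
  · simp only [law, Fin.reduceFinMk, Matrix.cons_val, ne_eq, smul_eq_zero, not_or] at h ⊢
    obtain ⟨⟨⟨hp, hq⟩, hd⟩, h⟩ := (by simpa using h.1 : (P 1 ≠ 0 ∧ Q 1 ≠ 0) ∧ dirO W (Q 1 • P) (P 1 • Q) 0 ≠ 0), h.2
    rw [Projective.smul_eq _ (mul_ne_zero (mul_ne_zero hp hq) hd).isUnit]
    have e := add_eq_lineO (W := W) (P := Q 1 • P) (Q := P 1 • Q)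
      ((Projective.equation_smul _ hq.isUnit).2 hP.1) ((Projective.equation_smul _ hp.isUnit).2 hQ.1)
      (by simp [mul_comm]) (by simp [hp, hq])
      (fun h' => h (by
        simp only [Pi.smul_apply, smul_eq_mul] at h'
        rw [h']; ext i; fin_cases i <;> simp [Projective.neg, Projective.negY])) hd
    simp only [Pi.smul_apply, smul_eq_mul] at e
    rw [← e]
    exact (Quotient.sound (Projective.add_smul_equiv P Q hq.isUnit hp.isUnit)).symm

lemma law_exists {P Q : Fin 3 → F} (hP : W.Nonsingular P) (hQ : W.Nonsingular Q) :
    ∃ j, law W j P Q ≠ 0 := by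
  by_cases hPQ : P ≈ Q
  swap
  · refine ⟨0, ?_⟩
    have := ne_zero_of_nonsingular (Projective.nonsingular_add hP hQ)
    rwa [Projective.add_of_not_equiv hPQ] at this
  obtain ⟨u, rfl⟩ := hPQ
  suffices ∃ j, law W j Q Q ≠ 0 by
    obtain ⟨j, hj⟩ := this
    refine ⟨j, ?_⟩
    have := law_smul W j Q Q u 1
    rw [one_smul] at this
    change law W j ((u : F) • Q) Q ≠ 0
    rw [this]
    exact smul_ne_zero (by simp) hj
  have hdb (c : F) (hc : c ≠ 0) : W.neg (ndb W (c • Q)) ≠ 0 := by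
    have := ne_zero_of_nonsingular (Projective.nonsingular_add
      ((Projective.nonsingular_smul Q hc.isUnit).2 hQ)
      ((Projective.nonsingular_smul Q hc.isUnit).2 hQ))
    rwa [Projective.add_self] at this
  by_cases hz : Q 2 = 0
  · have hx := Projective.X_eq_zero_of_Z_eq_zero hQ.1 hz
    have hy := Projective.Y_ne_zero_of_Z_eq_zero hQ hz
    have hd : dirO W (Q 1 • Q) (Q 1 • Q) 0 ≠ 0 := by simp [dirO, hx, hz, hy]
    refine ⟨2, ?_⟩
    have e := (Projective.equation_smul Q hy.isUnit).2 hQ.1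
    simp only [law, Matrix.cons_val, sub_self]
    rw [lineO_eq W (s := 0) (by simp), third_dirO_self e, Projective.neg_smul, Projective.neg_smul]
    refine smul_ne_zero (mul_ne_zero (mul_ne_zero hy hy) hd)
      (smul_ne_zero hd (smul_ne_zero (by simp [hy]) (hdb _ hy)))
  · refine ⟨1, ?_⟩
    have e := (Projective.equation_smul Q (Ne.isUnit hz)).2 hQ.1
    simp only [law, Matrix.cons_val_one, Matrix.cons_val_zero, sub_self]
    rw [lineA_eq W (s := 0) rfl (by simp), third_dirA_self W e, Projective.neg_smul]
    exact smul_ne_zero (mul_ne_zero hz hz) (smul_ne_zero (by simp [hz]) (hdb _ hz))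
end Field

/-! ### Morphisms defined over a subfield -/

section Regular
variable {L Ω : Type*} [Field L] [Field Ω] [Algebra L Ω]

/-- The vector `(F₀(q), F₁(q), F₂(q))`. -/
noncomputable def evalVec (F : Fin 3 → MvPolynomial (Fin 3) L) (q : Fin 3 → Ω) : Fin 3 → Ω :=
  fun i => aeval q (F i)

/-- A map from the projective plane curve `W` over `Ω` to itself, given on `Ω`-points, is a morphism
defined over the subfield `L`: locally at each point `P` it is `[F₀ : F₁ : F₂]` for forms `F₀, F₁, F₂`
of the same degree with coefficients in `L` which do not all vanish at `P`. -/
def IsRegularOver (L : Type*) [Field L] [Algebra L Ω] {W : WeierstrassCurve.Projective Ω}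
    (φ : W.Point → W.Point) : Prop :=
  ∀ P : W.Point, ∃ (n : ℕ) (F : Fin 3 → MvPolynomial (Fin 3) L),
    (∀ i, (F i).IsHomogeneous n) ∧
    (∀ p : Fin 3 → Ω, P.point = ⟦p⟧ → evalVec F p ≠ 0) ∧
    ∀ (Q : W.Point) (q : Fin 3 → Ω), Q.point = ⟦q⟧ → evalVec F q ≠ 0 →
      (φ Q).point = ⟦evalVec F q⟧

lemma aeval_smul_of_isHomogeneous {p : MvPolynomial (Fin 3) L} {n : ℕ} (hp : p.IsHomogeneous n)
    (t : Ω) (q : Fin 3 → Ω) : aeval (t • q) p = t ^ n * aeval q p := by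
  simp only [aeval_def, eval₂_eq, Finset.mul_sum]
  refine Finset.sum_congr rfl fun d hd => ?_
  have hd' : d.degree = n := by
    by_contra h
    exact (mem_support_iff.1 hd) (hp.coeff_eq_zero h)
  have : (∏ i ∈ d.support, t ^ d i) = t ^ n := by
    rw [Finset.prod_pow_eq_pow_sum, ← hd', Finsupp.degree]
    rfl
  simp only [Pi.smul_apply, smul_eq_mul, mul_pow, Finset.prod_mul_distrib, this]
  ring

lemma isHomogeneous_of_aeval_smul [Infinite Ω] {p : MvPolynomial (Fin 3) L} {n : ℕ}
    (h : ∀ (t : Ω) (q : Fin 3 → Ω), aeval (t • q) p = t ^ n * aeval q p) :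
    p.IsHomogeneous n := by
  have key : ∀ d, d ≠ n → homogeneousComponent d p = 0 := by
    intro d hd
    apply map_injective (algebraMap L Ω) (algebraMap L Ω).injective
    apply MvPolynomial.funext
    intro q
    have hpoly : (∑ i ∈ Finset.range (p.totalDegree + 1),
        Polynomial.C (aeval q (homogeneousComponent i p)) * Polynomial.X ^ i)
        = Polynomial.C (aeval q p) * Polynomial.X ^ n := by
      apply Polynomial.funext
      intro t
      have ht := h t q
      conv_lhs at ht => rw [← sum_homogeneousComponent p]
      simp only [map_sum, aeval_smul_of_isHomogeneous (homogeneousComponent_isHomogeneous _ p)] at ht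
      simp only [Polynomial.eval_finsetSum, Polynomial.eval_mul, Polynomial.eval_C,
        Polynomial.eval_pow, Polynomial.eval_X]
      rw [mul_comm (aeval q p), ← ht]
      exact Finset.sum_congr rfl fun i _ => mul_comm _ _
    have hc := congrArg (fun f => Polynomial.coeff f d) hpoly
    simp only [Polynomial.finsetSum_coeff, Polynomial.coeff_C_mul_X_pow, hd, if_false] at hc
    rw [Finset.sum_ite_eq] at hc
    rw [eval_map, map_zero, map_zero, ← aeval_def]
    split_ifs at hc with hmem
    · exact hc
    · rw [homogeneousComponent_eq_zero d p (by rw [Finset.mem_range] at hmem; omega), map_zero]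
  have : p = homogeneousComponent n p := by
    conv_lhs => rw [← sum_homogeneousComponent p]
    by_cases hn : n ∈ Finset.range (p.totalDegree + 1)
    · exact Finset.sum_eq_single_of_mem n hn fun d _ hd => key d hd
    · rw [homogeneousComponent_eq_zero n p (by rw [Finset.mem_range] at hn; omega)]
      exact Finset.sum_eq_zero fun d hd => key d (by rintro rfl; exact hn hd)
  rw [this]
  exact homogeneousComponent_isHomogeneous n p

lemma evalVec_smul {F : Fin 3 → MvPolynomial (Fin 3) L} {n : ℕ} (hF : ∀ i, (F i).IsHomogeneous n)
    (t : Ω) (q : Fin 3 → Ω) : evalVec F (t • q) = t ^ n • evalVec F q :=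
  _root_.funext fun i => aeval_smul_of_isHomogeneous (hF i) t q

/-- Nonvanishing may be tested on one representative. -/
lemma evalVec_ne_zero {F : Fin 3 → MvPolynomial (Fin 3) L} {n : ℕ}
    (hF : ∀ i, (F i).IsHomogeneous n) {p q : Fin 3 → Ω}
    (h : (⟦p⟧ : Projective.PointClass Ω) = ⟦q⟧) (hq : evalVec F p ≠ 0) : evalVec F q ≠ 0 := by
  obtain ⟨u, rfl⟩ := Quotient.exact h
  intro h0
  apply hq
  change evalVec F ((u : Ω) • q) = 0
  rw [evalVec_smul hF, h0, smul_zero]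

lemma nonsingular_of_point {W : WeierstrassCurve.Projective Ω} {P : W.Point} {p : Fin 3 → Ω}
    (h : P.point = ⟦p⟧) : W.Nonsingular p := by
  have := P.nonsingular
  rwa [h, Projective.nonsingularLift_iff] at this

lemma isRegularOver_zero {W : WeierstrassCurve.Projective Ω} :
    IsRegularOver L (fun _ : W.Point => (0 : W.Point)) := by
  have e (q : Fin 3 → Ω) : evalVec (![0, 1, 0] : Fin 3 → MvPolynomial (Fin 3) L) q = ![0, 1, 0] := by
    ext i; fin_cases i <;> simp [evalVec]
  refine fun P => ⟨0, ![0, 1, 0], ?_, fun p _ => ?_, fun Q q _ _ => ?_⟩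
  · intro i
    fin_cases i
    · exact isHomogeneous_zero _ _ _
    · exact isHomogeneous_one _ _
    · exact isHomogeneous_zero _ _ _
  · rw [e]
    exact fun h => one_ne_zero (congrFun h 1)
  · rw [e]; rfl

lemma isRegularOver_id {W : WeierstrassCurve.Projective Ω} :
    IsRegularOver L (fun P : W.Point => P) := by
  have e (q : Fin 3 → Ω) : evalVec (X : Fin 3 → MvPolynomial (Fin 3) L) q = q := by
    ext i; simp [evalVec]
  refine fun P => ⟨1, X, fun i => isHomogeneous_X _ i, fun p hp => ?_, fun Q q hq _ => ?_⟩
  · rw [e]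
    exact ne_zero_of_nonsingular (nonsingular_of_point hp)
  · rw [e, hq]

lemma isRegularOver_comp {W : WeierstrassCurve.Projective Ω} {φ ψ : W.Point → W.Point}
    (hφ : IsRegularOver L φ) (hψ : IsRegularOver L ψ) : IsRegularOver L (fun P => φ (ψ P)) := by
  intro P
  obtain ⟨n, F, hF, hFP, hFQ⟩ := hψ P
  obtain ⟨m, G, hG, hGP, hGQ⟩ := hφ (ψ P)
  have e (q : Fin 3 → Ω) : evalVec (fun i => aeval F (G i)) q = evalVec G (evalVec F q) := by
    ext i
    simp only [evalVec]
    rw [← AlgHom.comp_apply]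
    congr 1
    ext j
    simp [evalVec]
  refine ⟨n * m, fun i => aeval F (G i), fun i => (hG i).aeval F hF, fun p hp => ?_,
    fun Q q hq h => ?_⟩
  · rw [e]
    exact hGP _ (hFQ P p hp (hFP p hp))
  · rw [e] at h ⊢
    by_cases h0 : evalVec F q = 0
    · obtain ⟨r, hr⟩ := Quotient.exists_rep (ψ Q).point
      have e0 : evalVec G (evalVec F q) = (0 : Ω) ^ m • evalVec G r := by
        rw [h0, ← evalVec_smul hG, zero_smul]
      rw [e0] at h ⊢
      have hm : (0 : Ω) ^ m ≠ 0 := fun h' => h (by rw [h', zero_smul])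
      rw [Projective.smul_eq _ hm.isUnit]
      exact hGQ _ r hr.symm fun h' => h (by rw [h', smul_zero])
    · exact hGQ _ _ (hFQ Q q hq h0) h

lemma isRegularOver_neg {V : WeierstrassCurve.Projective L} {W : WeierstrassCurve.Projective Ω}
    (hV : V.map (algebraMap L Ω) = W) {φ : W.Point → W.Point}
    (hφ : IsRegularOver L φ) : IsRegularOver L (fun P => -φ P) := by
  intro P
  obtain ⟨n, F, hF, hFP, hFQ⟩ := hφ P
  have e (q : Fin 3 → Ω) :
      evalVec ((V.map (C : L →+* MvPolynomial (Fin 3) L)).neg F) q = W.neg (evalVec F q) := by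
    have := Projective.map_neg (W' := V.map (C : L →+* MvPolynomial (Fin 3) L))
      ((aeval q : MvPolynomial (Fin 3) L →ₐ[L] Ω) : MvPolynomial (Fin 3) L →+* Ω) F
    rw [Projective.map, Projective.map, WeierstrassCurve.map_map,
      show ((aeval q : MvPolynomial (Fin 3) L →ₐ[L] Ω) : MvPolynomial (Fin 3) L →+* Ω).comp C
        = algebraMap L Ω from RingHom.ext fun x => by simp] at this
    rw [← hV]
    exact this.symm
  have hne {v : Fin 3 → Ω} : W.neg v ≠ 0 → v ≠ 0 := by
    rintro h rfl
    exact h (by ext i; fin_cases i <;> simp [Projective.neg, Projective.negY])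
  refine ⟨n, (V.map (C : L →+* MvPolynomial (Fin 3) L)).neg F, fun i => ?_, fun p hp => ?_,
    fun Q q hq h => ?_⟩
  · fin_cases i
    · exact hF 0
    · exact (((hF 1).neg.sub ((hF 0).C_mul V.a₁)).sub ((hF 2).C_mul V.a₃))
    · exact hF 2
  · rw [e]
    exact ne_zero_of_nonsingular
      (Projective.nonsingular_neg (nonsingular_of_point (hFQ P p hp (hFP p hp))))
  · rw [e] at h ⊢
    rw [Projective.Point.neg_point, hFQ Q q hq (hne h), Projective.negMap_eq]

lemma isRegularOver_add [Infinite Ω] {V : WeierstrassCurve.Projective L}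
    {W : WeierstrassCurve.Projective Ω} (hV : V.map (algebraMap L Ω) = W) {φ ψ : W.Point → W.Point}
    (hφ : IsRegularOver L φ) (hψ : IsRegularOver L ψ) :
    IsRegularOver L (fun P => φ P + ψ P) := by
  intro P
  obtain ⟨n, F, hF, hFP, hFQ⟩ := hφ P
  obtain ⟨m, G, hG, hGP, hGQ⟩ := hψ P
  obtain ⟨p, hp⟩ := Quotient.exists_rep P.point
  obtain ⟨j, hj⟩ := law_exists (nonsingular_of_point (hFQ P p hp.symm (hFP p hp.symm)))
    (nonsingular_of_point (hGQ P p hp.symm (hGP p hp.symm)))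
  have e (q : Fin 3 → Ω) : evalVec (law (V.map (C : L →+* MvPolynomial (Fin 3) L)) j F G) q =
      law W j (evalVec F q) (evalVec G q) := by
    have := law_map (V.map (C : L →+* MvPolynomial (Fin 3) L))
      ((aeval q : MvPolynomial (Fin 3) L →ₐ[L] Ω) : MvPolynomial (Fin 3) L →+* Ω) j F G
    rw [Projective.map, Projective.map, WeierstrassCurve.map_map,
      show ((aeval q : MvPolynomial (Fin 3) L →ₐ[L] Ω) : MvPolynomial (Fin 3) L →+* Ω).comp C
        = algebraMap L Ω from RingHom.ext fun x => by simp] at this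
    rw [← hV]
    exact this.symm
  have hom : ∀ i, (law (V.map (C : L →+* MvPolynomial (Fin 3) L)) j F G i).IsHomogeneous
      ((n + m) * (![2, 8, 12] j : ℕ)) := by
    intro i
    apply isHomogeneous_of_aeval_smul (Ω := Ω)
    intro t q
    have := congrFun (e (t • q)) i
    rw [evalVec_smul hF, evalVec_smul hG, law_smul, ← e, ← pow_add, ← pow_mul] at this
    exact this
  refine ⟨_, _, hom, fun q hq => ?_, fun Q q hq h => ?_⟩
  · exact evalVec_ne_zero hom (hp.trans hq) (by rwa [e])
  · rw [e] at h ⊢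
    have h2 : (![2, 8, 12] j : ℕ) ≠ 0 := by fin_cases j <;> simp
    have hf : evalVec F q ≠ 0 := by
      intro h0
      have := law_smul W j 0 (evalVec G q) 0 1
      rw [smul_zero, one_smul, zero_mul, zero_pow h2, zero_smul] at this
      exact h (by rw [h0, this])
    have hg : evalVec G q ≠ 0 := by
      intro h0
      have := law_smul W j (evalVec F q) 0 1 0
      rw [smul_zero, one_smul, mul_zero, zero_pow h2, zero_smul] at this
      exact h (by rw [h0, this])
    have e1 := hFQ Q q hq hf
    have e2 := hGQ Q q hq hg
    rw [Projective.Point.add_point, e1, e2, Projective.addMap_eq]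
    exact law_correct j (nonsingular_of_point e1) (nonsingular_of_point e2) h

lemma isRegularOver_extend {L' : Type*} [Field L'] [Algebra L' Ω] [Algebra L L']
    [IsScalarTower L L' Ω] {W : WeierstrassCurve.Projective Ω} {φ : W.Point → W.Point}
    (hφ : IsRegularOver L φ) : IsRegularOver L' φ := by
  intro P
  obtain ⟨n, F, hF, hFP, hFQ⟩ := hφ P
  have e (q : Fin 3 → Ω) : evalVec (fun i => map (algebraMap L L') (F i)) q = evalVec F q :=
    _root_.funext fun i => aeval_map_algebraMap L' q (F i)
  refine ⟨n, fun i => map (algebraMap L L') (F i), fun i => (hF i).map _, ?_, ?_⟩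
  · simpa only [e] using hFP
  · simpa only [e] using hFQ

end Regular
/-! ### Endomorphism rings and endomorphism algebras -/

section Endomorphisms
universe u
variable {k : Type u} [Field k]

/-- The group `E(k̄)` of points of `E` over the algebraic closure of `k`. -/
abbrev GeomPoint (W : WeierstrassCurve k) : Type u :=
  (W.baseChange (AlgebraicClosure k)).toProjective.Point

/-- The ring `End_L(E)` of endomorphisms of `E` defined over a field `L` between `k` and `k̄`:
the endomorphisms of the algebraic group `E`, that is, the endomorphisms of the group `E(k̄)` which
are morphisms of curves, defined over `L`. -/
noncomputable def endRing (W : WeierstrassCurve k) (L : Type u) [Field L] [Algebra k L]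
    [Algebra L (AlgebraicClosure k)] [IsScalarTower k L (AlgebraicClosure k)] :
    Subring (AddMonoid.End (GeomPoint W)) where
  carrier := {φ | IsRegularOver L (φ : GeomPoint W → GeomPoint W)}
  mul_mem' {a b} ha hb := isRegularOver_comp (φ := a) (ψ := b) ha hb
  one_mem' := isRegularOver_id
  add_mem' {a b} ha hb := by
    refine isRegularOver_add (V := W.baseChange L) ?_ ha hb
    exact W.map_baseChange (Algebra.ofId L (AlgebraicClosure k))
  zero_mem' := isRegularOver_zero
  neg_mem' {a} ha := by
    refine isRegularOver_neg (V := W.baseChange L) ?_ ha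
    exact W.map_baseChange (Algebra.ofId L (AlgebraicClosure k))

lemma endRing_le (W : WeierstrassCurve k) : endRing W k ≤ endRing W (AlgebraicClosure k) :=
  fun _ h => isRegularOver_extend h

/-- The `ℚ`-algebra of endomorphisms of `E` defined over `L`, that is, `ℚ ⊗ End_L(E)`. -/
abbrev EndAlg (W : WeierstrassCurve k) (L : Type u) [Field L] [Algebra k L]
    [Algebra L (AlgebraicClosure k)] [IsScalarTower k L (AlgebraicClosure k)] : Type u :=
  ℚ ⊗[ℤ] endRing W L

/-- The canonical map from the endomorphism algebra over `k` to the one over `k̄`. -/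
noncomputable def endAlgMap (W : WeierstrassCurve k) :
    EndAlg W k →ₐ[ℚ] EndAlg W (AlgebraicClosure k) :=
  Algebra.TensorProduct.map (AlgHom.id ℚ ℚ) (Subring.inclusion (endRing_le W)).toIntAlgHom

/-- An involution of the first kind on a ring `A`. -/
structure IsInvolutionOfFirstKind {A : Type*} [Ring A] (σ : A → A) : Prop where
  map_add : ∀ x y, σ (x + y) = σ x + σ y
  map_mul : ∀ x y, σ (x * y) = σ y * σ x
  involutive : ∀ x, σ (σ x) = x
  map_center : ∀ x ∈ Subring.center A, σ x = x

/-- `B` is a quaternion algebra over `ℚ`: it has a basis `1, i, j, ij` with `i² = a`, `j² = b`,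
`ij = -ji` for some nonzero rational numbers `a` and `b`. -/
def IsQuaternionAlgebra (B : Type*) [Ring B] [Algebra ℚ B] : Prop :=
  ∃ a b : ℚ, a ≠ 0 ∧ b ≠ 0 ∧ Nonempty (B ≃ₐ[ℚ] ℍ[ℚ, a, b])

/-- `E` is of spinorial type: its endomorphism algebra over `k` has a nontrivial involution of the
first kind. -/
def IsSpinorial (W : WeierstrassCurve k) : Prop :=
  ∃ σ : EndAlg W k → EndAlg W k, IsInvolutionOfFirstKind σ ∧ σ ≠ id

/-- `E` is supersingular: multiplication by the characteristic of `k` is injective on `E(k̄)`. For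
characteristic `p > 0` this says `E[p](k̄) = 0`. In characteristic zero it fails, since then it
would say that `E(k̄)` is trivial. -/
def IsSupersingular (W : WeierstrassCurve k) : Prop :=
  ∀ P : GeomPoint W, ringChar k • P = 0 → P = 0

end Endomorphisms

end EllipticEnd

namespace EllipticEnd
open scoped Quaternion TensorProduct

/-! ### Quadratic algebras over `ℚ` -/

section QuadraticAlgebra
variable {A : Type*} [Ring A] [Algebra ℚ A]

/-- Completing the square. -/
lemma exists_sub_smul_sq {x : A} {s t : ℚ} (h : x * x = s • x + t • (1 : A)) :
    (x - (s / 2) • 1) * (x - (s / 2) • 1) = (t + s ^ 2 / 4) • (1 : A) := by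
  have : (x - (s / 2) • (1 : A)) * (x - (s / 2) • 1) = x * x - s • x + (s ^ 2 / 4) • (1 : A) := by
    simp only [sub_mul, mul_sub, smul_mul_assoc, mul_smul_comm, one_mul, mul_one]
    module
  rw [this, h]
  module

variable [NoZeroDivisors A] [Nontrivial A]

lemma exists_anticommuting (hq : ∀ x : A, ∃ s t : ℚ, x * x = s • x + t • (1 : A)) {x y : A}
    (hxy : x * y ≠ y * x) :
    ∃ (i j : A) (a b : ℚ), a ≠ 0 ∧ b ≠ 0 ∧ i * i = a • (1 : A) ∧ j * j = b • (1 : A) ∧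
      i * j = -(j * i) := by
  obtain ⟨s, t, hx⟩ := hq x
  have hi := exists_sub_smul_sq hx
  set i := x - (s / 2) • (1 : A) with hi_def
  set a := t + s ^ 2 / 4
  have hiy : i * y - y * i ≠ 0 := by
    intro h
    apply hxy
    rw [sub_eq_zero] at h
    simpa [hi_def, sub_mul, mul_sub] using h
  set j := i * y - y * i with hj_def
  have hi0 : i ≠ 0 := by rintro h; simp [hj_def, h] at hiy
  have hij : i * j = -(j * i) := by
    have e : i * i * y = y * (i * i) := by rw [hi]; simp
    simp only [hj_def, mul_sub, sub_mul]
    rw [← mul_assoc, e, mul_assoc, mul_assoc]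
    abel
  obtain ⟨u, b, hj⟩ := hq j
  have hu : u = 0 := by
    have e : i * (j * j) = (j * j) * i := by
      rw [← mul_assoc, hij, neg_mul, mul_assoc, hij, mul_neg, neg_neg, mul_assoc]
    rw [hj, mul_add, add_mul, mul_smul_comm, mul_smul_comm, smul_mul_assoc, smul_mul_assoc, mul_one,
      one_mul, add_left_inj, hij, smul_neg, neg_eq_iff_add_eq_zero, ← two_smul ℚ, smul_smul,
      smul_eq_zero] at e
    rcases e with e | e
    · simpa using e
    · exact absurd e (mul_ne_zero hiy hi0)
  rw [hu, zero_smul, zero_add] at hj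
  refine ⟨i, j, a, b, ?_, ?_, hi, hj, hij⟩
  · rintro h
    rw [h, zero_smul] at hi
    exact mul_ne_zero hi0 hi0 hi
  · rintro rfl
    rw [zero_smul] at hj
    exact mul_ne_zero hiy hiy hj

/-- An element of a quadratic domain which commutes with two anticommuting elements is a scalar. -/
lemma exists_eq_smul_one_of_commute (hq : ∀ x : A, ∃ s t : ℚ, x * x = s • x + t • (1 : A))
    {i j z : A} {a b : ℚ} (ha : a ≠ 0) (hb : b ≠ 0) (hi : i * i = a • (1 : A))
    (hj : j * j = b • (1 : A)) (hij : i * j = -(j * i)) (hzi : z * i = i * z) (hzj : z * j = j * z) :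
    ∃ c : ℚ, z = c • (1 : A) := by
  obtain ⟨s, t, hz⟩ := hq z
  obtain ⟨u, v, hw⟩ := hq (z + i)
  have hi0 : i ≠ 0 := by rintro rfl; simp [ha, eq_comm (a := (0 : A))] at hi
  have hj0 : j ≠ 0 := by rintro rfl; simp [hb, eq_comm (a := (0 : A))] at hj
  have e1 : (2 : ℚ) • (z * i) = (u - s) • z + u • i + (v - t - a) • (1 : A) := by
    have : (z + i) * (z + i) = z * z + (2 : ℚ) • (z * i) + i * i := by
      rw [mul_add, add_mul, add_mul, ← hzi, two_smul]; abel
    rw [this, hz, hi] at hw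
    linear_combination (norm := module) hw
  have e2 : (2 : ℚ) • (z * i) = -((u - s) • z) + u • i - (v - t - a) • (1 : A) := by
    have h := congrArg (fun w => j * w) e1
    have hji : j * i = -(i * j) := by rw [hij, neg_neg]
    simp only [mul_add, mul_smul_comm, mul_one] at h
    rw [← mul_assoc, ← hzj, mul_assoc, hji, mul_neg, ← mul_assoc] at h
    have h2 : ((2 : ℚ) • (z * i)) * j = (-((u - s) • z) + u • i - (v - t - a) • (1 : A)) * j := by
      simp only [smul_mul_assoc, add_mul, sub_mul, neg_mul, one_mul]
      linear_combination (norm := module) -h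
    exact mul_right_cancel₀ hj0 h2
  have e3 : ((2 : ℚ) • z - u • (1 : A)) * i = 0 := by
    have : (2 : ℚ) • ((2 : ℚ) • (z * i)) = (2 : ℚ) • (u • i) := by
      rw [two_smul ℚ ((2 : ℚ) • (z * i))]
      nth_rewrite 1 [e1]
      rw [e2, two_smul ℚ (u • i)]
      abel
    have := smul_right_injective A (two_ne_zero (α := ℚ)) this
    rw [sub_mul, smul_mul_assoc, smul_mul_assoc, one_mul, this, sub_self]
  refine ⟨u / 2, ?_⟩
  have e4 := sub_eq_zero.1 ((mul_eq_zero.1 e3).resolve_right hi0)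
  rw [div_eq_inv_mul, mul_smul, ← e4, smul_smul]
  simp

/-- A noncommutative domain over `ℚ` all of whose elements are quadratic is a quaternion algebra. -/
theorem isQuaternionAlgebra_of_quadratic (hq : ∀ x : A, ∃ s t : ℚ, x * x = s • x + t • (1 : A))
    (hc : ∃ x y : A, x * y ≠ y * x) : IsQuaternionAlgebra A := by
  obtain ⟨x, y, hxy⟩ := hc
  obtain ⟨i, j, a, b, ha, hb, hi, hj, hij⟩ := exists_anticommuting hq hxy
  have hi0 : i ≠ 0 := by rintro rfl; simp [ha, eq_comm (a := (0 : A))] at hi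
  have hj0 : j ≠ 0 := by rintro rfl; simp [hb, eq_comm (a := (0 : A))] at hj
  have hji : j * i = -(i * j) := by rw [hij, neg_neg]
  let B : QuaternionAlgebra.Basis A a 0 b :=
    { i := i, j := j, k := i * j, i_mul_i := by rw [hi, zero_smul, add_zero], j_mul_j := hj,
      i_mul_j := rfl, j_mul_i := by rw [hji, zero_smul, zero_sub] }
  have split_i : ∀ (α β : ℚ), α • (1 : A) + β • i = 0 → α = 0 ∧ β = 0 := by
    intro α β h
    have h1 : (α • (1 : A) - β • i) * j = 0 := by
      have := congrArg (fun w => j * w) h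
      simp only [mul_add, mul_smul_comm, mul_one, hji, mul_zero] at this
      simp only [sub_mul, smul_mul_assoc, one_mul]
      rw [← this]; module
    have h2 := (mul_eq_zero.1 h1).resolve_right hj0
    have h3 : (2 * α) • (1 : A) = 0 := by
      calc (2 * α) • (1 : A) = (α • (1 : A) + β • i) + (α • (1 : A) - β • i) := by module
        _ = 0 := by rw [h, h2, add_zero]
    have hα : α = 0 := by simpa using h3
    subst hα
    simpa [hi0] using h
  have hinj : Function.Injective (B.liftHom) := by
    rw [injective_iff_map_eq_zero]
    rintro ⟨p, q, r, s⟩ h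
    replace h : p • (1 : A) + q • i + r • j + s • (i * j) = 0 := by
      rw [← h]
      simp [QuaternionAlgebra.Basis.liftHom, QuaternionAlgebra.Basis.lift, B,
        Algebra.algebraMap_eq_smul_one]
    have h' : (p • (1 : A) + q • i - r • j - s • (i * j)) * i = 0 := by
      have := congrArg (fun w => i * w) h
      simp only [mul_add, mul_smul_comm, mul_one, mul_zero] at this
      simp only [sub_mul, add_mul, smul_mul_assoc, one_mul]
      rw [mul_assoc i j i, hji, mul_neg, ← this]; module
    have h'' := (mul_eq_zero.1 h').resolve_right hi0
    obtain ⟨rfl, rfl⟩ := split_i p q (by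
      have : (2 : ℚ) • (p • (1 : A) + q • i) = 0 := by
        calc (2 : ℚ) • (p • (1 : A) + q • i) = (p • (1 : A) + q • i + r • j + s • (i * j))
            + (p • (1 : A) + q • i - r • j - s • (i * j)) := by module
          _ = 0 := by rw [h, h'', add_zero]
      exact (smul_eq_zero.1 this).resolve_left two_ne_zero)
    obtain ⟨rfl, rfl⟩ := split_i r s (by
      have : (r • (1 : A) + s • i) * j = 0 := by
        rw [← h]; simp only [add_mul, smul_mul_assoc, one_mul]; module
      exact (mul_eq_zero.1 this).resolve_right hj0)
    rfl
  -- an element is a sum of products of `1, i, j, ij` with elements commuting with `i` and `j`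
  have key : ∀ (u v : A) (c : ℚ), c ≠ 0 → u * u = c • (1 : A) → ∀ z : A,
      ∃ z₁ z₂ : A, z = z₁ + z₂ ∧ z₁ * u = u * z₁ ∧ z₂ * u = -(u * z₂) ∧
        (v * u = -(u * v) → z * v = v * z → z₁ * v = v * z₁ ∧ z₂ * v = v * z₂) := by
    intro u v c hc hu z
    have hr : u * (u * z * u) = c • (z * u) := by
      rw [← mul_assoc, ← mul_assoc, hu, smul_mul_assoc, smul_mul_assoc, one_mul]
    have hl : (u * z * u) * u = c • (u * z) := by
      rw [mul_assoc, hu, mul_smul_comm, mul_one]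
    refine ⟨(1 / 2 : ℚ) • (z + c⁻¹ • (u * z * u)), (1 / 2 : ℚ) • (z - c⁻¹ • (u * z * u)),
      by module, ?_, ?_, ?_⟩
    · simp only [smul_mul_assoc, mul_smul_comm, add_mul, mul_add, hr, hl, smul_smul,
        inv_mul_cancel₀ hc, one_smul]
      rw [add_comm]
    · simp only [smul_mul_assoc, mul_smul_comm, sub_mul, mul_sub, hr, hl, smul_smul,
        inv_mul_cancel₀ hc, one_smul]
      module
    · intro hvu hzv
      have e : (u * z * u) * v = v * (u * z * u) := by
        have huv : u * v = -(v * u) := by rw [hvu, neg_neg]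
        rw [mul_assoc, huv, mul_neg, ← mul_assoc, mul_assoc u z v, hzv, ← mul_assoc, huv, neg_mul,
          neg_mul, neg_neg]
        simp only [mul_assoc]
      simp only [smul_mul_assoc, mul_smul_comm, sub_mul, mul_sub, add_mul, mul_add, e, hzv]
      exact ⟨trivial, trivial⟩
  have cent : ∀ z : A, z * i = i * z → ∃ p q : ℚ, z = p • (1 : A) + q • i := by
    intro z hz
    obtain ⟨z₁, z₂, rfl, h1, h2, h3⟩ := key j i b hb hj z
    obtain ⟨h4, h5⟩ := h3 hij hz
    obtain ⟨p, rfl⟩ := exists_eq_smul_one_of_commute hq ha hb hi hj hij h4 h1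
    obtain ⟨q, h6⟩ := exists_eq_smul_one_of_commute hq (z := z₂ * i) ha hb hi hj hij
      (by rw [← mul_assoc, ← h5]) (by
        rw [mul_assoc, hij, mul_neg, ← mul_assoc, h2, neg_mul, neg_neg, mul_assoc])
    refine ⟨p, q / a, ?_⟩
    have : z₂ * i * i = a • z₂ := by rw [mul_assoc, hi, mul_smul_comm, mul_one]
    rw [h6, smul_mul_assoc, one_mul] at this
    rw [div_eq_inv_mul, mul_smul, this, smul_smul, inv_mul_cancel₀ ha, one_smul]
  have hsurj : Function.Surjective (B.liftHom) := by
    intro z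
    obtain ⟨z₁, z₂, rfl, h1, h2, -⟩ := key i i a ha hi z
    obtain ⟨p, q, rfl⟩ := cent z₁ h1
    obtain ⟨r, s, h6⟩ := cent (z₂ * j) (by
      rw [mul_assoc, hji, mul_neg, ← mul_assoc, h2, neg_mul, neg_neg, mul_assoc])
    refine ⟨⟨p, q, r / b, s / b⟩, ?_⟩
    have : z₂ * j * j = b • z₂ := by rw [mul_assoc, hj, mul_smul_comm, mul_one]
    have hz : z₂ = (r / b) • j + (s / b) • (i * j) := by
      rw [h6, add_mul, smul_mul_assoc, smul_mul_assoc, one_mul] at this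
      rw [div_eq_inv_mul, div_eq_inv_mul, mul_smul, mul_smul, ← smul_add, this, smul_smul,
        inv_mul_cancel₀ hb, one_smul]
    rw [hz]
    simp [QuaternionAlgebra.Basis.liftHom, QuaternionAlgebra.Basis.lift, B,
        Algebra.algebraMap_eq_smul_one]
    abel
  exact ⟨a, b, ha, hb, ⟨(AlgEquiv.ofBijective B.liftHom ⟨hinj, hsurj⟩).symm⟩⟩

end QuadraticAlgebra

lemma IsQuaternionAlgebra.finrank {A : Type*} [Ring A] [Algebra ℚ A] (h : IsQuaternionAlgebra A) :
    Module.finrank ℚ A = 4 := by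
  obtain ⟨a, b, -, -, ⟨e⟩⟩ := h
  rw [e.toLinearEquiv.finrank_eq, QuaternionAlgebra.finrank_eq_four]

lemma IsQuaternionAlgebra.exists_not_commute {A : Type*} [Ring A] [Algebra ℚ A]
    (h : IsQuaternionAlgebra A) : ∃ x y : A, x * y ≠ y * x := by
  obtain ⟨a, b, ha, hb, ⟨e⟩⟩ := h
  refine ⟨e.symm ⟨0, 1, 0, 0⟩, e.symm ⟨0, 0, 1, 0⟩, fun h => ?_⟩
  rw [← map_mul, ← map_mul] at h
  have := congrArg (fun q => QuaternionAlgebra.imK q) (e.symm.injective h)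
  norm_num at this

lemma IsQuaternionAlgebra.exists_involution {A : Type*} [Ring A] [Algebra ℚ A]
    (h : IsQuaternionAlgebra A) : ∃ σ : A → A, IsInvolutionOfFirstKind σ ∧ σ ≠ id := by
  obtain ⟨a, b, ha, hb, ⟨e⟩⟩ := h
  refine ⟨fun x => e.symm (star (e x)), ⟨fun x y => by simp, fun x y => by simp, fun x => by simp,
    fun x hx => ?_⟩, fun h => ?_⟩
  · rw [AlgEquiv.symm_apply_eq]
    rw [Subring.mem_center_iff] at hx
    have hc (q : ℍ[ℚ, a, b]) : q * e x = e x * q := by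
      have := congrArg e (hx (e.symm q))
      simpa using this
    generalize e x = z at hc
    have h1 := hc ⟨0, 1, 0, 0⟩
    have h2 := hc ⟨0, 0, 1, 0⟩
    rw [QuaternionAlgebra.ext_iff] at h1 h2
    simp at h1 h2
    obtain ⟨h11, h12⟩ := h1
    obtain ⟨h21, h22⟩ := h2
    ext
    · simp
    · simp; linarith
    · simp; linarith
    · simp
      grind
  · have := congrArg e (congrFun h (e.symm ⟨0, 1, 0, 0⟩))
    simp [QuaternionAlgebra.ext_iff] at this
    norm_num at this

end EllipticEnd

namespace EllipticEnd
open scoped Quaternion TensorProduct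

/-! ### Rings with an anisotropic multiplicative quadratic form -/

/-- An anisotropic multiplicative quadratic form with values in `ℤ`. -/
structure IsCompositionNorm {R : Type*} [Ring R] (N : R → ℤ) : Prop where
  eq_zero : ∀ x, N x = 0 → x = 0
  map_one : N 1 = 1
  map_mul : ∀ x y, N (x * y) = N x * N y
  parallelogram : ∀ x y, N (x + y) + N (x - y) = 2 * N x + 2 * N y

namespace IsCompositionNorm
variable {R : Type*} [Ring R] {N : R → ℤ}

lemma comp (hN : IsCompositionNorm N) {S : Type*} [Ring S] {f : S →+* R} (hf : Function.Injective f) :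
    IsCompositionNorm (N ∘ f) where
  eq_zero x hx := (map_eq_zero_iff f hf).1 (hN.eq_zero _ hx)
  map_one := by simp [hN.map_one]
  map_mul x y := by simp [hN.map_mul]
  parallelogram x y := by simp [hN.parallelogram]

lemma map_zero (hN : IsCompositionNorm N) : N 0 = 0 := by
  have := hN.parallelogram 0 0
  simp only [add_zero, sub_zero] at this
  omega

lemma map_natCast (hN : IsCompositionNorm N) (n : ℕ) : N n = n ^ 2 := by
  induction n using Nat.twoStepInduction with
  | zero => simp [hN.map_zero]
  | one => simp [hN.map_one]
  | more n h1 h2 =>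
    have := hN.parallelogram ((n + 1 : ℕ) : R) 1
    rw [hN.map_one, h2, Nat.cast_add_one, add_sub_cancel_right, h1] at this
    have e : ((n + 2 : ℕ) : R) = (n : R) + 1 + 1 := by push_cast; rw [add_assoc, one_add_one_eq_two]
    rw [e]
    push_cast at this ⊢
    linarith

lemma map_add₃ (hN : IsCompositionNorm N) (x y z : R) :
    N (x + y + z) = N (x + y) + N (x + z) + N (y + z) - N x - N y - N z := by
  have h1 := hN.parallelogram (x + z) y
  have h2 := hN.parallelogram x (y - z)
  have h3 := hN.parallelogram (x + y) z
  have h4 := hN.parallelogram y z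
  rw [show x + z + y = x + y + z by abel, show x + z - y = x - (y - z) by abel] at h1
  rw [show x + (y - z) = x + y - z by abel] at h2
  linarith

/-- `z² - t z + n = 0` for `t = N(z + 1) - N(z) - 1` and `n = N(z)`. -/
theorem mul_self_eq (hN : IsCompositionNorm N) (x : R) : x * x = (N (x + 1) - N x - 1) • x - N x • (1 : R) := by
  let B : R → R → ℤ := fun x y => N (x + y) - N x - N y
  have hB_add (x y z : R) : B (x + y) z = B x z + B y z := by
    simp only [B, hN.map_add₃ x y z]; ring
  let Bz (z : R) : R →+ ℤ := AddMonoidHom.mk' (fun x => B x z) fun x y => hB_add x y z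
  have hB_neg (x z : R) : B (-x) z = -B x z := (Bz z).map_neg x
  have hB_zsmul (n : ℤ) (x z : R) : B (n • x) z = n * B x z := by
    have := map_zsmul (Bz z) n x
    rwa [smul_eq_mul] at this
  have hB_comm (x y : R) : B x y = B y x := by simp only [B, add_comm x y]; ring
  have hB_left (x y z : R) : B (x * y) (x * z) = N x * B y z := by
    simp only [B, ← mul_add, hN.map_mul]; ring
  -- polarization of `B (x * y) (x * z) = N x * B y z` in `x`
  have hB_mul (x w y z : R) : B (x * y) (w * z) + B (w * y) (x * z) = B x w * B y z := by
    have h := hB_left (x + w) y z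
    rw [add_mul, add_mul, hB_add, hB_comm (x * y), hB_comm (w * y), hB_add, hB_add,
      hB_comm (x * z) (x * y), hB_comm (w * z) (w * y), hB_left, hB_left,
      hB_comm (w * z) (x * y), hB_comm (x * z) (w * y)] at h
    linear_combination h
  set t := N (x + 1) - N x - 1 with ht
  have htB : B x 1 = t := by simp only [B, hN.map_one, ht]
  have key (y : R) : B (x * x - t • x + N x • (1 : R)) y = 0 := by
    rw [hB_add, sub_eq_add_neg, hB_add, hB_neg, hB_zsmul, hB_zsmul]
    have h1 := hB_mul x 1 x y
    have h2 := hB_left x 1 y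
    rw [one_mul, one_mul, htB] at h1
    rw [mul_one] at h2
    linear_combination h1 - h2
  have h0 := key (x * x - t • x + N x • (1 : R))
  have h4 (z : R) : N (z + z) = 4 * N z := by
    have := hN.parallelogram z z
    rw [sub_self, hN.map_zero] at this
    linarith
  simp only [B, h4] at h0
  have := hN.eq_zero _ (show N (x * x - t • x + N x • (1 : R)) = 0 by linarith)
  rw [← sub_eq_zero, ← this]
  abel

lemma natCast_ne_zero (hN : IsCompositionNorm N) {n : ℕ} (hn : n ≠ 0) : (n : R) ≠ 0 := by
  intro h
  have := hN.map_natCast n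
  rw [h, hN.map_zero, eq_comm, pow_eq_zero_iff two_ne_zero] at this
  exact hn (by exact_mod_cast this)

lemma noZeroDivisors (hN : IsCompositionNorm N) : NoZeroDivisors R where
  eq_zero_or_eq_zero_of_mul_eq_zero {x y} h := by
    have := hN.map_mul x y
    rw [h, hN.map_zero, eq_comm, mul_eq_zero] at this
    exact this.imp (hN.eq_zero _) (hN.eq_zero _)

lemma nontrivial (hN : IsCompositionNorm N) : Nontrivial R :=
  ⟨0, 1, fun h => by have := hN.map_one; rw [← h, hN.map_zero] at this; omega⟩

lemma flat (hN : IsCompositionNorm N) : Module.Flat ℤ R := by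
  have := hN.noZeroDivisors
  have : Module.IsTorsionFree ℤ R := by
    refine ⟨fun n hn x y hxy => ?_⟩
    simp only [zsmul_eq_mul] at hxy
    refine mul_left_cancel₀ (fun h => ?_) hxy
    rcases Int.natAbs_eq n with e | e
    · rw [e, Int.cast_natCast] at h
      exact hN.natCast_ne_zero (Int.natAbs_ne_zero.2 hn.ne_zero) h
    · rw [e, Int.cast_neg, Int.cast_natCast, neg_eq_zero] at h
      exact hN.natCast_ne_zero (Int.natAbs_ne_zero.2 hn.ne_zero) h
  infer_instance

lemma includeRight_injective (hN : IsCompositionNorm N) :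
    Function.Injective (Algebra.TensorProduct.includeRight : R →ₐ[ℤ] ℚ ⊗[ℤ] R) :=
  have := hN.flat
  Algebra.TensorProduct.includeRight_injective (algebraMap ℤ ℚ).injective_int

lemma exists_smul_eq_tmul (x : ℚ ⊗[ℤ] R) :
    ∃ (n : ℤ) (r : R), n ≠ 0 ∧ (n : ℚ) • x = 1 ⊗ₜ r := by
  induction x with
  | zero => exact ⟨1, 0, one_ne_zero, by simp⟩
  | tmul q r =>
    refine ⟨q.den, q.num • r, by simp, ?_⟩
    rw [TensorProduct.smul_tmul', ← TensorProduct.smul_tmul, smul_eq_mul, Int.cast_natCast,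
      Rat.den_mul_eq_num]
    simp
  | add x y hx hy =>
    obtain ⟨n, r, hn, hr⟩ := hx
    obtain ⟨m, s, hm, hs⟩ := hy
    refine ⟨m * n, m • r + n • s, mul_ne_zero hm hn, ?_⟩
    have e (k : ℤ) (r : R) : (1 : ℚ) ⊗ₜ[ℤ] (k • r) = (k : ℚ) • ((1 : ℚ) ⊗ₜ[ℤ] r) := by
      rw [TensorProduct.tmul_smul, Int.cast_smul_eq_zsmul]
    rw [TensorProduct.tmul_add, e, e, ← hr, ← hs]
    push_cast
    module

lemma includeRight_eq (r : R) :
    (Algebra.TensorProduct.includeRight : R →ₐ[ℤ] ℚ ⊗[ℤ] R) r = 1 ⊗ₜ r := rfl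

lemma nontrivial_tensor (hN : IsCompositionNorm N) : Nontrivial (ℚ ⊗[ℤ] R) :=
  have := hN.nontrivial
  hN.includeRight_injective.nontrivial

lemma noZeroDivisors_tensor (hN : IsCompositionNorm N) : NoZeroDivisors (ℚ ⊗[ℤ] R) where
  eq_zero_or_eq_zero_of_mul_eq_zero {x y} h := by
    have := hN.noZeroDivisors
    obtain ⟨n, r, hn, hr⟩ := exists_smul_eq_tmul x
    obtain ⟨m, s, hm, hs⟩ := exists_smul_eq_tmul y
    have e : (1 : ℚ) ⊗ₜ[ℤ] (r * s) = 0 := by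
      have : ((1 : ℚ) ⊗ₜ[ℤ] r) * ((1 : ℚ) ⊗ₜ[ℤ] s) = 0 := by
        rw [← hr, ← hs, smul_mul_smul_comm, h, smul_zero]
      simpa using this
    rw [← includeRight_eq, map_eq_zero_iff _ hN.includeRight_injective, mul_eq_zero] at e
    refine e.imp ?_ ?_
    · rintro rfl
      simpa [hn] using hr
    · rintro rfl
      simpa [hm] using hs

lemma quadratic_tensor (hN : IsCompositionNorm N) (x : ℚ ⊗[ℤ] R) :
    ∃ s t : ℚ, x * x = s • x + t • (1 : ℚ ⊗[ℤ] R) := by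
  obtain ⟨n, r, hn, hr⟩ := exists_smul_eq_tmul x
  have hn' : (n : ℚ) ≠ 0 := by exact_mod_cast hn
  have h := congrArg (fun z => (1 : ℚ) ⊗ₜ[ℤ] z) (hN.mul_self_eq r)
  have e (k : ℤ) (r : R) : (1 : ℚ) ⊗ₜ[ℤ] (k • r) = (k : ℚ) • ((1 : ℚ) ⊗ₜ[ℤ] r) := by
    rw [TensorProduct.tmul_smul, Int.cast_smul_eq_zsmul]
  have em : (1 : ℚ) ⊗ₜ[ℤ] (r * r) = ((1 : ℚ) ⊗ₜ[ℤ] r) * ((1 : ℚ) ⊗ₜ[ℤ] r) := by simp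
  simp only [TensorProduct.tmul_sub, e, em, ← hr, smul_mul_smul_comm,
    ← Algebra.TensorProduct.one_def] at h
  set t := N (r + 1) - N r - 1
  refine ⟨t / n, -(N r / n ^ 2), ?_⟩
  have h2 : ((n : ℚ) * n) • (x * x) =
      ((n : ℚ) * n) • ((t / n : ℚ) • x + (-(N r / n ^ 2) : ℚ) • (1 : ℚ ⊗[ℤ] R)) := by
    rw [h, smul_add, smul_smul, smul_smul, smul_smul, sub_eq_add_neg, ← neg_smul]
    congr 2 <;> field_simp
  exact smul_right_injective _ (mul_ne_zero hn' hn') h2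

/-- The rational span of a noncommutative ring with a composition norm is a quaternion algebra. -/
theorem isQuaternionAlgebra_tensor (hN : IsCompositionNorm N)
    (hc : ∃ x y : ℚ ⊗[ℤ] R, x * y ≠ y * x) : IsQuaternionAlgebra (ℚ ⊗[ℤ] R) :=
  have := hN.noZeroDivisors_tensor
  have := hN.nontrivial_tensor
  isQuaternionAlgebra_of_quadratic hN.quadratic_tensor hc

end IsCompositionNorm

/-- If `R` is commutative, so is `ℚ ⊗ R`. -/
lemma tensor_mul_comm {R : Type*} [Ring R] (h : ∀ x y : R, x * y = y * x) (x y : ℚ ⊗[ℤ] R) :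
    x * y = y * x := by
  induction x with
  | zero => simp
  | add x x' hx hx' => rw [add_mul, mul_add, hx, hx']
  | tmul q r =>
    induction y with
    | zero => simp
    | add y y' hy hy' => rw [add_mul, mul_add, hy, hy']
    | tmul q' r' => rw [Algebra.TensorProduct.tmul_mul_tmul, Algebra.TensorProduct.tmul_mul_tmul,
        h, mul_comm]

end EllipticEnd

namespace EllipticEnd
open Polynomial

/-! ### Morphisms from the projective line to projective space -/

section ProjectiveLine
variable {F : Type*} [Field F]

lemma coeff_prod_of_natDegree_le' {ι : Type*} (s : Finset ι) (f : ι → F[X]) (b : ι → ℕ)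
    (h : ∀ i ∈ s, (f i).natDegree ≤ b i) :
    (∏ i ∈ s, f i).coeff (∑ i ∈ s, b i) = ∏ i ∈ s, (f i).coeff (b i) := by
  classical
  induction s using Finset.induction_on with
  | empty => simp
  | insert a s ha ih =>
    have hs : ∀ i ∈ s, (f i).natDegree ≤ b i := fun i hi => h i (Finset.mem_insert_of_mem hi)
    rw [Finset.prod_insert ha, Finset.sum_insert ha, Finset.prod_insert ha,
      coeff_mul_add_eq_of_natDegree_le (h a (Finset.mem_insert_self _ _))
        ((natDegree_prod_le s f).trans (Finset.sum_le_sum hs)), ih hs]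

/-- The polynomials `u i` are homogeneous coordinates of degree `e` of a morphism from the
projective line to projective space: they have no common zero, at infinity either. -/
structure IsMorphism {ι : Type*} (u : ι → F[X]) (e : ℕ) : Prop where
  natDegree_le : ∀ i, (u i).natDegree ≤ e
  coeff_ne : (fun i => (u i).coeff e) ≠ 0
  eval_ne : ∀ r, (fun i => (u i).eval r) ≠ 0

namespace IsMorphism

lemma comp {ι κ : Type*} [Finite ι] {m : ι → F[X]} {e n : ℕ} (hm : IsMorphism m e)
    {G : κ → MvPolynomial ι F} (hG : ∀ j, (G j).IsHomogeneous n)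
    (hz : ∀ x : ι → F, x ≠ 0 → (fun j => MvPolynomial.eval x (G j)) ≠ 0) :
    IsMorphism (fun j => MvPolynomial.aeval m (G j)) (n * e) := by
  have := Fintype.ofFinite ι
  have hd {j : κ} {d : ι →₀ ℕ} (h : d ∈ (G j).support) : ∑ i, d i * e = n * e := by
    rw [← Finset.sum_mul, ← Finsupp.degree_eq_sum]
    congr 1
    by_contra h'
    exact (MvPolynomial.mem_support_iff.1 h) ((hG j).coeff_eq_zero h')
  have hmon (d : ι →₀ ℕ) (i : ι) : (m i ^ d i).natDegree ≤ d i * e :=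
    natDegree_pow_le.trans (Nat.mul_le_mul_left _ (hm.natDegree_le i))
  have ha (j : κ) : MvPolynomial.aeval m (G j) =
      ∑ d ∈ (G j).support, C ((G j).coeff d) * ∏ i, m i ^ d i := by
    rw [MvPolynomial.aeval_def, MvPolynomial.eval₂_eq']
    rfl
  refine ⟨fun j => ?_, ?_, fun r => ?_⟩
  · rw [ha]
    refine natDegree_sum_le_of_forall_le _ _ fun d hd' => ?_
    refine (natDegree_C_mul_le _ _).trans ((natDegree_prod_le _ _).trans ?_)
    rw [← hd hd']
    exact Finset.sum_le_sum fun i _ => hmon d i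
  · convert hz _ hm.coeff_ne using 2 with j
    rw [ha, finsetSum_coeff, MvPolynomial.eval_eq']
    refine Finset.sum_congr rfl fun d hd' => ?_
    rw [coeff_C_mul, ← hd hd', coeff_prod_of_natDegree_le' _ _ _ fun i _ => hmon d i]
    congr 1
    exact Finset.prod_congr rfl fun i _ => coeff_pow_of_natDegree_le (hm.natDegree_le i)
  · convert hz _ (hm.eval_ne r) using 2 with j
    rw [ha, eval_finsetSum, MvPolynomial.eval_eq']
    refine Finset.sum_congr rfl fun d hd' => ?_
    simp [eval_prod]

/-- The symmetric square of two morphisms to the projective line. -/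
lemma sym2 {u v : Fin 2 → F[X]} {d e : ℕ} (hu : IsMorphism u d) (hv : IsMorphism v e) :
    IsMorphism ![u 0 * v 0, u 0 * v 1 + u 1 * v 0, u 1 * v 1] (d + e) := by
  have key {x y : Fin 2 → F} (hx : x ≠ 0) (hy : y ≠ 0) :
      ![x 0 * y 0, x 0 * y 1 + x 1 * y 0, x 1 * y 1] ≠ 0 := by
    intro h
    have h0 := congrFun h 0
    have h1 := congrFun h 1
    have h2 := congrFun h 2
    simp at h0 h1 h2
    have hx' : x 0 ≠ 0 ∨ x 1 ≠ 0 := by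
      by_contra! h'
      exact hx (by ext i; fin_cases i <;> simp [h'])
    have hy' : y 0 ≠ 0 ∨ y 1 ≠ 0 := by
      by_contra! h'
      exact hy (by ext i; fin_cases i <;> simp [h'])
    grind
  have hm (i j) : (u i * v j).natDegree ≤ d + e :=
    natDegree_mul_le_of_le (hu.natDegree_le i) (hv.natDegree_le j)
  refine ⟨fun i => ?_, ?_, fun r => ?_⟩
  · fin_cases i
    · exact hm 0 0
    · exact natDegree_add_le_of_degree_le (hm 0 1) (hm 1 0)
    · exact hm 1 1
  · convert key hu.coeff_ne hv.coeff_ne using 2 with i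
    fin_cases i <;> simp [coeff_mul_add_eq_of_natDegree_le (hu.natDegree_le _) (hv.natDegree_le _)]
  · convert key (hu.eval_ne r) (hv.eval_ne r) using 2 with i
    fin_cases i <;> simp

variable [IsAlgClosed F]

lemma span_eq_top {ι : Type*} {u : ι → F[X]} {e : ℕ} (hu : IsMorphism u e) :
    Ideal.span (Set.range u) = ⊤ := by
  obtain ⟨g, hg⟩ := (IsPrincipalIdealRing.principal (Ideal.span (Set.range u))).principal
  have hdvd (i : ι) : g ∣ u i := by
    rw [← Ideal.mem_span_singleton]
    change u i ∈ Submodule.span F[X] {g}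
    rw [← hg]
    exact Ideal.subset_span ⟨i, rfl⟩
  rw [hg]
  change Ideal.span {g} = ⊤
  rw [Ideal.span_singleton_eq_top]
  by_contra h
  obtain ⟨r, hr⟩ : ∃ r, g.IsRoot r := by
    apply IsAlgClosed.exists_root
    intro h0
    exact h (isUnit_iff_degree_eq_zero.2 h0)
  exact hu.eval_ne r (_root_.funext fun i => eval_eq_zero_of_dvd_of_eval_eq_zero (hdvd i) hr)

lemma degree_le {ι : Type*} [Fintype ι] {u v : ι → F[X]} {d e : ℕ} (hu : IsMorphism u d)
    (hv : IsMorphism v e) (h : ∀ i j, u i * v j = u j * v i) : d ≤ e := by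
  have h1 : (1 : F[X]) ∈ Ideal.span (Set.range v) := by rw [hv.span_eq_top]; trivial
  obtain ⟨a, ha⟩ := (Ideal.mem_span_range_iff_exists_fun).1 h1
  have huv (j : ι) : u j = (∑ i, a i * u i) * v j := by
    rw [Finset.sum_mul]
    calc u j = (∑ i, a i * v i) * u j := by rw [ha, one_mul]
      _ = _ := by
        rw [Finset.sum_mul]
        exact Finset.sum_congr rfl fun i _ => by linear_combination (a i) * h j i
  set c := ∑ i, a i * u i
  have hc : IsUnit c := by
    by_contra hc
    have hc0 : c ≠ 0 := by
      intro h0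
      obtain ⟨i, hi⟩ := Function.ne_iff.1 (hu.eval_ne 0)
      exact hi (by simp [huv i, h0])
    obtain ⟨r, hr⟩ : ∃ r, c.IsRoot r := by
      apply IsAlgClosed.exists_root
      exact fun h0 => hc (isUnit_iff_degree_eq_zero.2 h0)
    exact hu.eval_ne r (_root_.funext fun i => by
      rw [huv i, eval_mul, hr.eq_zero, zero_mul]; rfl)
  obtain ⟨i, hi⟩ := Function.ne_iff.1 hu.coeff_ne
  refine (le_natDegree_of_ne_zero hi).trans ((?_ : _ ≤ _).trans (hv.natDegree_le i))
  obtain ⟨k, -, hk⟩ := Polynomial.isUnit_iff.1 hc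
  rw [huv i, ← hk]
  exact natDegree_C_mul_le _ _

lemma degree_eq {ι : Type*} [Fintype ι] {u v : ι → F[X]} {d e : ℕ} (hu : IsMorphism u d)
    (hv : IsMorphism v e) (h : ∀ i j, u i * v j = u j * v i) : d = e :=
  le_antisymm (hu.degree_le hv h)
    (hv.degree_le hu fun i j => by linear_combination -h i j)

end IsMorphism

lemma isMorphism_of_isCoprime {A B : F[X]} (h : IsCoprime A B) :
    IsMorphism ![A, B] (max A.natDegree B.natDegree) := by
  have h0 : A ≠ 0 ∨ B ≠ 0 := h.ne_zero_or_ne_zero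
  refine ⟨fun i => ?_, fun hc => ?_, fun r hr => ?_⟩
  · fin_cases i <;> simp
  · have hA := congrFun hc 0
    have hB := congrFun hc 1
    simp at hA hB
    rcases le_total A.natDegree B.natDegree with hle | hle
    · rw [max_eq_right hle] at hA hB
      have hB0 : B = 0 := by simpa using hB
      subst hB0
      have : A.natDegree = 0 := by simpa using hle
      rw [natDegree_zero, ← this] at hA
      simp at hA
      simp [hA] at h0
    · rw [max_eq_left hle] at hA hB
      have hA0 : A = 0 := by simpa using hA
      subst hA0
      have : B.natDegree = 0 := by simpa using hle
      rw [natDegree_zero, ← this] at hB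
      simp at hB
      simp [hB] at h0
  · obtain ⟨a, b, hab⟩ := h
    have hA := congrFun hr 0
    have hB := congrFun hr 1
    simp at hA hB
    have := congrArg (eval r) hab
    simp [hA, hB] at this

/-- The homogenization of degree `n` of a polynomial of degree at most `n`. -/
noncomputable def homogenization (n : ℕ) (A : F[X]) : MvPolynomial (Fin 2) F :=
  ∑ i ∈ Finset.range (n + 1),
    MvPolynomial.C (A.coeff i) * (MvPolynomial.X 0 ^ i * MvPolynomial.X 1 ^ (n - i))

lemma isHomogeneous_homogenization (n : ℕ) (A : F[X]) : (homogenization n A).IsHomogeneous n := by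
  refine MvPolynomial.IsHomogeneous.sum _ _ _ fun i hi => ?_
  refine MvPolynomial.IsHomogeneous.C_mul ?_ _
  have := (MvPolynomial.isHomogeneous_X_pow (R := F) (0 : Fin 2) i).mul
    (MvPolynomial.isHomogeneous_X_pow (R := F) (1 : Fin 2) (n - i))
  rwa [Nat.add_sub_cancel' (Nat.lt_succ_iff.1 (Finset.mem_range.1 hi))] at this

lemma eval_homogenization {n : ℕ} {A : F[X]} (hA : A.natDegree ≤ n) {x : Fin 2 → F}
    (hx : x 1 ≠ 0) :
    MvPolynomial.eval x (homogenization n A) = x 1 ^ n * A.eval (x 0 / x 1) := by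
  rw [homogenization, map_sum, eval_eq_sum_range' (Nat.lt_succ_of_le hA), Finset.mul_sum]
  refine Finset.sum_congr rfl fun i hi => ?_
  have hi' := Nat.lt_succ_iff.1 (Finset.mem_range.1 hi)
  simp only [map_mul, map_pow, MvPolynomial.eval_C, MvPolynomial.eval_X]
  rw [div_pow, ← Nat.sub_add_cancel hi', Nat.add_sub_cancel, pow_add]
  field_simp

lemma eval_homogenization_of_eq_zero {n : ℕ} {A : F[X]} {x : Fin 2 → F} (hx : x 1 = 0) :
    MvPolynomial.eval x (homogenization n A) = A.coeff n * x 0 ^ n := by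
  rw [homogenization, map_sum, Finset.sum_eq_single n]
  · simp
  · intro i hi hne
    have : n - i ≠ 0 := by have := Finset.mem_range.1 hi; omega
    simp [hx, this]
  · simp

lemma IsMorphism.homogenization_ne {u : Fin 2 → F[X]} {n : ℕ} (hu : IsMorphism u n)
    {x : Fin 2 → F} (hx : x ≠ 0) :
    (fun j => MvPolynomial.eval x (homogenization n (u j))) ≠ 0 := by
  by_cases h1 : x 1 = 0
  · have h0 : x 0 ≠ 0 := fun h0 => hx (by ext i; fin_cases i <;> simp [h0, h1])
    obtain ⟨i, hi⟩ := Function.ne_iff.1 hu.coeff_ne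
    refine Function.ne_iff.2 ⟨i, ?_⟩
    rw [eval_homogenization_of_eq_zero h1]
    exact mul_ne_zero hi (pow_ne_zero _ h0)
  · obtain ⟨i, hi⟩ := Function.ne_iff.1 (hu.eval_ne (x 0 / x 1))
    refine Function.ne_iff.2 ⟨i, ?_⟩
    rw [eval_homogenization (hu.natDegree_le i) h1]
    exact mul_ne_zero (pow_ne_zero _ h1) hi

end ProjectiveLine
end EllipticEnd

namespace EllipticEnd
open WeierstrassCurve

/-! ### The abscissas of a sum and a difference -/

section AddSub
variable {F : Type*} [Field F] {W : WeierstrassCurve.Affine F}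

lemma eval_addSubMap (v : Fin 3 → F) (j : Fin 3) : MvPolynomial.eval v (addSubMap W j) =
    ![v 0 ^ 2 - W.b₄ * v 0 * v 2 - W.b₆ * v 1 * v 2 - W.b₈ * v 2 ^ 2,
      2 * v 1 * v 0 + W.b₂ * v 0 * v 2 + W.b₄ * v 1 * v 2 + W.b₆ * v 2 ^ 2,
      v 1 ^ 2 - 4 * v 0 * v 2] j := by
  fin_cases j <;> simp [addSubMap]

variable [DecidableEq F]

lemma exists_smul_sym2x_self (P : W.Point) :
    ∃ c : F, (fun j => MvPolynomial.eval (P.sym2x P) (addSubMap W j)) = c • (P + P).sym2x 0 := by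
  rcases P with _ | ⟨x, y, h⟩
  · rw [← Affine.Point.zero_def, add_zero]
    refine ⟨1, ?_⟩
    ext j
    simp only [eval_addSubMap]
    fin_cases j <;> simp
  · have he := (Affine.equation_iff ..).1 h.1
    by_cases hy : y = W.negY x y
    · rw [Affine.Point.add_self_of_Y_eq hy]
      refine ⟨x ^ 4 - W.b₄ * x ^ 2 - 2 * W.b₆ * x - W.b₈, ?_⟩
      rw [Affine.negY] at hy
      ext j
      simp only [eval_addSubMap]
      fin_cases j
      · simp; ring
      · simp [b₂, b₄, b₆]
        linear_combination (2 * y + W.a₁ * x + W.a₃) * hy - 4 * he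
      · simp; ring
    · rw [Affine.Point.add_self_of_Y_ne hy]
      refine ⟨(y - W.negY x y) ^ 2, ?_⟩
      have hy' : y - W.negY x y ≠ 0 := sub_ne_zero.2 hy
      have hs : W.slope x x y y * (y - W.negY x y) =
          3 * x ^ 2 + 2 * W.a₂ * x + W.a₄ - W.a₁ * y := by
        rw [Affine.slope_of_Y_ne rfl hy, div_mul_cancel₀ _ hy']
      rw [Affine.Point.sym2x_some_zero, Affine.Point.sym2x_some_some]
      generalize W.slope x x y y = ℓ at hs
      rw [Affine.negY] at hs
      ext j
      simp only [eval_addSubMap]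
      fin_cases j
      · simp [Affine.addX, Affine.negY, b₄, b₆, b₈]
        linear_combination (-(ℓ * (2 * y + W.a₁ * x + W.a₃)) - (3 * x ^ 2 + 2 * W.a₂ * x + W.a₄ - W.a₁ * y) - W.a₁ * (2 * y + W.a₁ * x + W.a₃)) * hs + (8 * x + W.a₁ ^ 2 + 4 * W.a₂) * he
      · simp [Affine.negY, b₂, b₄, b₆]
        linear_combination - 4 * he
      · simp; ring

lemma exists_smul_sym2x_add_sub (P Q : W.Point) :
    ∃ c : F, (fun j => MvPolynomial.eval (P.sym2x Q) (addSubMap W j)) =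
      c • (P + Q).sym2x (P - Q) := by
  by_cases hPQ : P = Q
  · subst hPQ
    rw [sub_self]
    exact exists_smul_sym2x_self P
  by_cases hPQ' : P = -Q
  · subst hPQ'
    rw [neg_add_cancel, ← neg_add', Affine.Point.sym2x_neg_left, Affine.Point.sym2x_neg_right,
      Affine.Point.sym2x_comm 0]
    exact exists_smul_sym2x_self Q
  rcases P with _ | ⟨x₁, y₁, h₁⟩
  · rw [← Affine.Point.zero_def, zero_add, zero_sub, Affine.Point.sym2x_neg_right]
    refine ⟨1, ?_⟩
    ext j
    rcases Q with _ | ⟨x₂, y₂, h₂⟩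
    · exact absurd rfl hPQ
    · simp only [eval_addSubMap]
      fin_cases j <;> simp <;> ring
  rcases Q with _ | ⟨x₂, y₂, h₂⟩
  · rw [← Affine.Point.zero_def, add_zero, sub_zero]
    refine ⟨1, ?_⟩
    ext j
    simp only [eval_addSubMap]
    fin_cases j <;> simp <;> ring
  have hx : x₁ ≠ x₂ := fun hx => (Affine.Point.X_eq_iff.1 hx).elim hPQ hPQ'
  rw [sub_eq_add_neg, Affine.Point.neg_some, Affine.Point.add_of_X_ne hx,
    Affine.Point.add_of_X_ne hx]
  refine ⟨(x₁ - x₂) ^ 2, ?_⟩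
  have hx' : x₁ - x₂ ≠ 0 := sub_ne_zero.2 hx
  have e₁ := (Affine.equation_iff ..).1 h₁.1
  have e₂ := (Affine.equation_iff ..).1 h₂.1
  have hs : W.slope x₁ x₂ y₁ y₂ * (x₁ - x₂) = y₁ - y₂ := by
    rw [Affine.slope_of_X_ne hx, div_mul_cancel₀ _ hx']
  have ht : W.slope x₁ x₂ y₁ (W.negY x₂ y₂) * (x₁ - x₂) = y₁ + y₂ + W.a₁ * x₂ + W.a₃ := by
    rw [Affine.slope_of_X_ne hx, div_mul_cancel₀ _ hx', Affine.negY]; ring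
  rw [Affine.Point.sym2x_some_some, Affine.Point.sym2x_some_some]
  generalize W.slope x₁ x₂ y₁ y₂ = ℓ at hs
  generalize W.slope x₁ x₂ y₁ (W.negY x₂ y₂) = m at ht
  have hX : (x₁ - x₂) ^ 2 * W.addX x₁ x₂ ℓ = (y₁ - y₂) ^ 2 + W.a₁ * (y₁ - y₂) * (x₁ - x₂)
      - (W.a₂ + x₁ + x₂) * (x₁ - x₂) ^ 2 := by
    rw [Affine.addX]
    linear_combination (ℓ * (x₁ - x₂) + (y₁ - y₂) + W.a₁ * (x₁ - x₂)) * hs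
  have hY : (x₁ - x₂) ^ 2 * W.addX x₁ x₂ m = (y₁ + y₂ + W.a₁ * x₂ + W.a₃) ^ 2
      + W.a₁ * (y₁ + y₂ + W.a₁ * x₂ + W.a₃) * (x₁ - x₂)
      - (W.a₂ + x₁ + x₂) * (x₁ - x₂) ^ 2 := by
    rw [Affine.addX]
    linear_combination (m * (x₁ - x₂) + (y₁ + y₂ + W.a₁ * x₂ + W.a₃) + W.a₁ * (x₁ - x₂)) * ht
  ext j
  simp only [eval_addSubMap]
  fin_cases j
  · have hn : (x₁ - x₂) ^ 2 ≠ 0 := pow_ne_zero 2 hx'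
    apply mul_left_cancel₀ hn
    simp only [Fin.zero_eta, Matrix.cons_val_zero, Matrix.cons_val,
      Pi.smul_apply, smul_eq_mul, Matrix.cons_val_one]
    rw [show (x₁ - x₂) ^ 2 * ((x₁ - x₂) ^ 2 * (W.addX x₁ x₂ ℓ * W.addX x₁ x₂ m)) =
      ((x₁ - x₂) ^ 2 * W.addX x₁ x₂ ℓ) * ((x₁ - x₂) ^ 2 * W.addX x₁ x₂ m) by ring, hX, hY]
    simp only [b₄, b₆, b₈]
    linear_combination (1 * x₁ ^ 3 + (-2) * x₁ ^ 2 * x₂ + 1 * x₁ ^ 2 * W.a₂ + (-2) * x₁ * x₂ ^ 2 + (-1) * x₁ *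
        x₂ * W.a₁ ^ 2 + (-4) * x₁ * x₂ * W.a₂ + (-1) * x₁ * y₁ * W.a₁ + (-1) * x₁ * W.a₁ * W.a₃
        + (-1) * x₁ * W.a₄ + 2 * x₂ ^ 3 + 1 * x₂ ^ 2 * W.a₁ ^ 2 + 2 * x₂ ^ 2 * W.a₂ + 2 * x₂ *
        y₂ * W.a₁ + 1 * x₂ * W.a₁ * W.a₃ + (-1) * y₁ ^ 2 + (-1) * y₁ * W.a₃ + 2 * y₂ ^ 2 + 2 *
        y₂ * W.a₃ + (-1) * W.a₆) * e₁
      + (4 * x₁ ^ 3 + (-2) * x₁ ^ 2 * x₂ + 1 * x₁ ^ 2 * W.a₁ ^ 2 + 4 * x₁ ^ 2 * W.a₂ + (-2) * x₁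
        * x₂ ^ 2 + (-1) * x₁ * x₂ * W.a₁ ^ 2 + (-4) * x₁ * x₂ * W.a₂ + 1 * x₁ * W.a₁ * W.a₃ + 2
        * x₁ * W.a₄ + 1 * x₂ ^ 3 + 1 * x₂ ^ 2 * W.a₂ + (-1) * x₂ * y₂ * W.a₁ + (-1) * x₂ * W.a₁
        * W.a₃ + (-1) * x₂ * W.a₄ + (-1) * y₂ ^ 2 + (-1) * y₂ * W.a₃ + 1 * W.a₆) * e₂
  · simp only [Fin.mk_one, Matrix.cons_val_zero, Matrix.cons_val,
      Pi.smul_apply, smul_eq_mul, Matrix.cons_val_one, b₂, b₄, b₆, mul_add, hX, hY]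
    linear_combination -2 * e₁ - 2 * e₂
  · simp; ring

end AddSub
end EllipticEnd

namespace EllipticEnd
open WeierstrassCurve Filter Polynomial

/-! ### The degree of an endomorphism -/

section Group
variable {G : Type*} [AddCommGroup G] [Infinite G]

/-- A homomorphism from an infinite group which maps almost all elements to two values `±R` is
zero. -/
lemma eq_zero_of_eventually_eq_or_neg {φ : G →+ G} {R : G}
    (h : ∀ᶠ Q in cofinite, φ Q = R ∨ φ Q = -R) : φ = 0 := by
  have hinf : (φ.ker : Set G).Infinite := by
    intro hfin
    have hfib (S : G) : {Q | φ Q = S}.Finite := by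
      by_cases hS : ∃ Q, φ Q = S
      · obtain ⟨Q₀, rfl⟩ := hS
        refine (hfin.image (fun x => Q₀ + x)).subset ?_
        intro Q hQ
        exact ⟨Q - Q₀, by simpa [sub_eq_zero] using hQ, add_sub_cancel Q₀ Q⟩
      · exact Set.finite_empty.subset fun Q hQ => hS ⟨Q, hQ⟩
    have h1 : ∀ᶠ Q in cofinite, φ Q ≠ R := by
      rw [eventually_cofinite]; simpa using hfib R
    have h2 : ∀ᶠ Q in cofinite, φ Q ≠ -R := by
      rw [eventually_cofinite]; simpa using hfib (-R)
    obtain ⟨Q, h, h1, h2⟩ := (h.and (h1.and h2)).exists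
    exact h.elim h1 h2
  have hit (Q₀ : G) : φ Q₀ = R ∨ φ Q₀ = -R := by
    have hinf' := hinf.image (f := fun x => Q₀ + x) (add_right_injective Q₀).injOn
    obtain ⟨_, ⟨x, hx, rfl⟩, hx'⟩ := hinf'.exists_notMem_finite (eventually_cofinite.1 h)
    simpa [AddMonoidHom.mem_ker.1 hx, or_iff_not_imp_left] using hx'
  have hR : R = 0 := by
    rcases hit 0 with h | h <;> rw [map_zero] at h
    · exact h.symm
    · exact (neg_eq_zero.1 h.symm)
  ext Q
  simpa [hR] using hit Q

lemma eq_top_of_eventually_mem {H : AddSubgroup G} (h : ∀ᶠ Q in cofinite, Q ∈ H) : H = ⊤ := by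
  rw [eq_top_iff]
  intro Q _
  have h' := (add_right_injective Q).tendsto_cofinite.eventually h
  obtain ⟨R, h1, h2⟩ := (h.and h').exists
  exact (H.add_mem_cancel_right h1).1 h2

end Group

section Degree
variable {F : Type*} [Field F] {W : WeierstrassCurve.Affine F}

/-- Proportionality of vectors with two coordinates is transitive. -/
lemma proportional_trans {x y z : Fin 2 → F} (hy : y ≠ 0) (h : y 0 * x 1 = y 1 * x 0)
    (h' : y 0 * z 1 = y 1 * z 0) (i j : Fin 2) : x i * z j = x j * z i := by
  have hy' : y 0 ≠ 0 ∨ y 1 ≠ 0 := by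
    by_contra! h'
    exact hy (by ext i; fin_cases i <;> simp [h'])
  have key : x 0 * z 1 = x 1 * z 0 := by
    rcases hy' with h0 | h0
    · apply mul_left_cancel₀ h0
      linear_combination (-z 0) * h + x 0 * h'
    · apply mul_left_cancel₀ h0
      linear_combination (-z 1) * h + x 1 * h'
  fin_cases i <;> fin_cases j <;> first | rfl | exact key | exact key.symm

lemma exists_eq_smul_of_proportional {x y : Fin 2 → F} (hy : y ≠ 0) (h : y 0 * x 1 = y 1 * x 0) :
    ∃ c : F, x = c • y := by
  by_cases h0 : y 0 = 0
  · have h1 : y 1 ≠ 0 := fun h1 => hy (by ext i; fin_cases i <;> simp [h0, h1])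
    refine ⟨x 1 / y 1, ?_⟩
    ext i
    fin_cases i
    · simp_all
    · simp [h1]
  · refine ⟨x 0 / y 0, ?_⟩
    ext i
    fin_cases i
    · simp [h0]
    · simp; field_simp; linear_combination h

lemma eq_or_eq_neg_of_proportional {P Q : W.Point}
    (h : P.xRep 0 * Q.xRep 1 = P.xRep 1 * Q.xRep 0) : P = Q ∨ P = -Q := by
  apply Affine.Point.eq_or_eq_neg_of_xRep_eq_xRep
  rcases P with _ | ⟨x, y, hP⟩ <;> rcases Q with _ | ⟨x', y', hQ⟩ <;>
    simp_all [← Affine.Point.zero_def]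

/-- The abscissa of a point, with value `1` at infinity. -/
noncomputable def xc (P : W.Point) : F := P.xRep 0

lemma xc_some {x y : F} (h : W.Nonsingular x y) : xc (.some x y h) = x := rfl

lemma finite_xc_eq (r : F) : {P : W.Point | xc P = r}.Finite := by
  by_cases h : ∃ x y, ∃ h : W.Nonsingular x y, x = r
  · obtain ⟨x, y, h, rfl⟩ := h
    refine Set.Finite.subset (s := {0, .some x y h, -.some x y h}) (by simp) ?_
    rintro (_ | ⟨x', y', h'⟩) hP
    · exact Or.inl rfl
    · rw [Set.mem_ofPred_eq, xc_some] at hP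
      exact Or.inr (Affine.Point.X_eq_iff.1 hP)
  · refine Set.Finite.subset (s := {0}) (by simp) ?_
    rintro (_ | ⟨x', y', h'⟩) hP
    · rfl
    · exact (h ⟨x', y', h', hP⟩).elim

lemma eventually_eval_xc_ne {p : F[X]} (hp : p ≠ 0) :
    ∀ᶠ P : W.Point in cofinite, p.eval (xc P) ≠ 0 := by
  rw [eventually_cofinite]
  classical
  refine ((p.roots.toFinset.finite_toSet).biUnion fun r _ => finite_xc_eq (W := W) r).subset ?_
  intro P hP
  simp only [ne_eq, not_not, Set.mem_ofPred_eq] at hP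
  simp only [Set.mem_iUnion, Set.mem_ofPred_eq]
  exact ⟨xc P, by simpa [hp] using hP, rfl⟩

lemma eventually_ne_zero : ∀ᶠ P : W.Point in cofinite, P ≠ 0 := by
  rw [eventually_cofinite]
  simp

/-- For almost all points `Q`, the abscissa of `φ Q` is the value of the morphism `u` of degree `d`
from the projective line to itself at the abscissa of `Q`. -/
structure IsXRep [DecidableEq F] (φ : AddMonoid.End W.Point) (u : Fin 2 → F[X]) (d : ℕ) : Prop where
  isMorphism : IsMorphism u d
  eventually : ∀ᶠ Q : W.Point in cofinite,
    (φ Q).xRep 0 * (u 1).eval (xc Q) = (φ Q).xRep 1 * (u 0).eval (xc Q)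

lemma isXRep_zero [DecidableEq F] : IsXRep (0 : AddMonoid.End W.Point) ![1, 0] 0 where
  isMorphism := by simpa using isMorphism_of_isCoprime (F := F) (isCoprime_one_left (x := 0))
  eventually := Eventually.of_forall fun Q => by simp

lemma isXRep_one [DecidableEq F] : IsXRep (1 : AddMonoid.End W.Point) ![X, 1] 1 where
  isMorphism := by simpa using isMorphism_of_isCoprime (F := F) (isCoprime_one_right (x := X))
  eventually := by
    filter_upwards [eventually_ne_zero] with Q hQ
    rcases Q with _ | ⟨x, y, h⟩
    · exact absurd rfl hQ
    · simp [xc]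

variable [IsAlgClosed F] [W.IsElliptic]

lemma exists_xc_eq (r : F) : ∃ P : W.Point, P ≠ 0 ∧ xc P = r := by
  obtain ⟨y, hy⟩ := IsAlgClosed.exists_root
    (X ^ 2 + C (W.a₁ * r + W.a₃) * X - C (r ^ 3 + W.a₂ * r ^ 2 + W.a₄ * r + W.a₆) : F[X])
    (by
      have : (X ^ 2 + C (W.a₁ * r + W.a₃) * X - C (r ^ 3 + W.a₂ * r ^ 2 + W.a₄ * r + W.a₆)
        : F[X]).degree = 2 := by compute_degree!
      rw [this]; decide)
  have he : W.Equation r y := by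
    rw [Affine.equation_iff]
    simp only [IsRoot.def, eval_sub, eval_add, eval_mul, eval_pow, eval_X, eval_C] at hy
    linear_combination hy
  exact ⟨.mk he, Affine.Point.some_ne_zero _, rfl⟩

instance infinite_point : Infinite W.Point := by
  have : Function.Surjective (xc : W.Point → F) := fun r =>
    let ⟨P, _, h⟩ := exists_xc_eq (W := W) r
    ⟨P, h⟩
  exact Infinite.of_surjective _ this

lemma eq_zero_of_eventually_eval_xc {p : F[X]}
    (h : ∀ᶠ P : W.Point in cofinite, p.eval (xc P) = 0) : p = 0 := by
  by_contra hp
  obtain ⟨P, h1, h2⟩ := (h.and (eventually_eval_xc_ne (W := W) hp)).exists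
  exact h2 h1

variable [DecidableEq F]

lemma IsXRep.unique {φ : AddMonoid.End W.Point} {u v : Fin 2 → F[X]} {d e : ℕ} (hu : IsXRep φ u d)
    (hv : IsXRep φ v e) : d = e := by
  refine hu.isMorphism.degree_eq hv.isMorphism fun i j => ?_
  rw [← sub_eq_zero]
  apply eq_zero_of_eventually_eval_xc (W := W)
  filter_upwards [hu.eventually, hv.eventually] with Q h1 h2
  rw [eval_sub, eval_mul, eval_mul, sub_eq_zero]
  exact proportional_trans (x := fun i => (u i).eval (xc Q)) (z := fun i => (v i).eval (xc Q))
    (φ Q).xRep_ne_zero h1 h2 i j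

lemma IsXRep.eq_zero {φ : AddMonoid.End W.Point} {u : Fin 2 → F[X]} (hu : IsXRep φ u 0) :
    φ = 0 := by
  obtain ⟨Q₀, hQ₀⟩ := hu.eventually.exists
  apply eq_zero_of_eventually_eq_or_neg (R := φ Q₀)
  have hc (i : Fin 2) (r s : F) : (u i).eval r = (u i).eval s := by
    rw [eq_C_of_natDegree_le_zero (hu.isMorphism.natDegree_le i)]; simp
  filter_upwards [hu.eventually] with Q hQ
  apply eq_or_eq_neg_of_proportional
  have h := proportional_trans (x := (φ Q).xRep) (y := fun i => (u i).eval (xc Q))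
    (z := (φ Q₀).xRep) (hu.isMorphism.eval_ne _) (by linear_combination -hQ)
    (by simp only [hc _ (xc Q) (xc Q₀)]; linear_combination -hQ₀) 0 1
  exact h

/-- The polynomial whose roots are the abscissas of the fibre of `φ` at `±R`. -/
lemma IsXRep.fibre_ne_zero {φ : AddMonoid.End W.Point} {u : Fin 2 → F[X]} {d : ℕ}
    (hu : IsXRep φ u d) (hφ : φ ≠ 0) (R : W.Point) :
    C (R.xRep 0) * u 1 - C (R.xRep 1) * u 0 ≠ 0 := by
  intro h
  have hR : IsMorphism (fun i => C (R.xRep i)) 0 :=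
    ⟨fun i => by simp, by simpa using! R.xRep_ne_zero, fun r => by simpa using! R.xRep_ne_zero⟩
  have hd : d = 0 := by
    refine hu.isMorphism.degree_eq hR fun i j => ?_
    fin_cases i <;> fin_cases j <;>
      first | rfl | (simp; linear_combination h) | (simp; linear_combination -h)
  subst hd
  exact hφ hu.eq_zero

lemma IsXRep.tendsto {φ : AddMonoid.End W.Point} {u : Fin 2 → F[X]} {d : ℕ}
    (hu : IsXRep φ u d) (hφ : φ ≠ 0) : Tendsto φ cofinite cofinite := by
  refine Tendsto.cofinite_of_finite_preimage_singleton fun R => ?_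
  have h := hu.eventually.and (eventually_eval_xc_ne (W := W) (hu.fibre_ne_zero hφ R))
  rw [eventually_cofinite] at h
  refine h.subset fun Q hQ hc => hc.2 ?_
  have := hc.1
  rw [Set.mem_preimage, Set.mem_singleton_iff] at hQ
  rw [hQ] at this
  simp only [eval_sub, eval_mul, eval_C]
  linear_combination this

lemma IsXRep.mul {φ ψ : AddMonoid.End W.Point} {u v : Fin 2 → F[X]} {d e : ℕ}
    (hu : IsXRep φ u d) (hv : IsXRep ψ v e) (hψ : ψ ≠ 0) :
    IsXRep (φ * ψ) (fun i => MvPolynomial.aeval v (homogenization d (u i))) (d * e) where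
  isMorphism := hv.isMorphism.comp (fun j => isHomogeneous_homogenization d (u j))
    fun x hx => hu.isMorphism.homogenization_ne hx
  eventually := by
    filter_upwards [(hv.tendsto hψ).eventually hu.eventually, hv.eventually,
      (hv.tendsto hψ).eventually eventually_ne_zero] with Q h1 h2 h3
    have e1 (i : Fin 2) : (MvPolynomial.aeval v (homogenization d (u i))).eval (xc Q) =
        MvPolynomial.eval (fun j => (v j).eval (xc Q)) (homogenization d (u i)) := by
      rw [← coe_evalRingHom, ← coe_aeval_eq_evalRingHom, RingHom.coe_coe, ← AlgHom.comp_apply,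
        MvPolynomial.comp_aeval]
      rfl
    rw [e1, e1]
    change (φ (ψ Q)).xRep 0 * _ = (φ (ψ Q)).xRep 1 * _
    rcases hQ : ψ Q with _ | ⟨x, y, h⟩
    · exact absurd hQ h3
    rw [hQ] at h1 h2
    simp only [Affine.Point.xRep_some, Matrix.cons_val_zero, Matrix.cons_val_one, one_mul,
      xc_some] at h1 h2
    have hv1 : (v 1).eval (xc Q) ≠ 0 := by
      intro h0
      refine hv.isMorphism.eval_ne (xc Q) (_root_.funext fun i => ?_)
      fin_cases i
      · simpa [h0] using h2.symm
      · exact h0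
    rw [eval_homogenization (hu.isMorphism.natDegree_le _) hv1,
      eval_homogenization (hu.isMorphism.natDegree_le _) hv1, ← h2, mul_div_cancel_right₀ _ hv1]
    linear_combination ((v 1).eval (xc Q) ^ d) * h1

lemma IsXRep.parallelogram {φ ψ : AddMonoid.End W.Point} {u v u' v' : Fin 2 → F[X]}
    {d e d' e' : ℕ} (hu : IsXRep φ u d) (hv : IsXRep ψ v e) (hu' : IsXRep (φ + ψ) u' d')
    (hv' : IsXRep (φ - ψ) v' e') : d' + e' = 2 * (d + e) := by
  refine (hu'.isMorphism.sym2 hv'.isMorphism).degree_eq ((hu.isMorphism.sym2 hv.isMorphism).comp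
    (isHomogeneous_addSubMap W) fun x hx => addSubMap_ne_zero W hx) fun i j => ?_
  rw [← sub_eq_zero]
  apply eq_zero_of_eventually_eval_xc (W := W)
  filter_upwards [hu.eventually, hv.eventually, hu'.eventually, hv'.eventually] with Q h1 h2 h3 h4
  obtain ⟨a, ha⟩ := exists_eq_smul_of_proportional (x := fun i => (u i).eval (xc Q))
    (φ Q).xRep_ne_zero h1
  obtain ⟨b, hb⟩ := exists_eq_smul_of_proportional (x := fun i => (v i).eval (xc Q))
    (ψ Q).xRep_ne_zero h2
  obtain ⟨a', ha'⟩ := exists_eq_smul_of_proportional (x := fun i => (u' i).eval (xc Q))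
    ((φ + ψ) Q).xRep_ne_zero h3
  obtain ⟨b', hb'⟩ := exists_eq_smul_of_proportional (x := fun i => (v' i).eval (xc Q))
    ((φ - ψ) Q).xRep_ne_zero h4
  change _ = a' • (φ Q + ψ Q).xRep at ha'
  change _ = b' • (φ Q - ψ Q).xRep at hb'
  obtain ⟨c, hc⟩ := exists_smul_sym2x_add_sub (φ Q) (ψ Q)
  have e1 : (fun i => (![u' 0 * v' 0, u' 0 * v' 1 + u' 1 * v' 0, u' 1 * v' 1] i).eval (xc Q)) =
      (a' * b') • (φ Q + ψ Q).sym2x (φ Q - ψ Q) := by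
    have h (i) := congrFun ha' i
    have h' (i) := congrFun hb' i
    ext i
    fin_cases i <;> simp [h, h', Affine.Point.sym2x] <;> ring
  have e2 : (fun i => (![u 0 * v 0, u 0 * v 1 + u 1 * v 0, u 1 * v 1] i).eval (xc Q)) =
      (a * b) • (φ Q).sym2x (ψ Q) := by
    have h (i) := congrFun ha i
    have h' (i) := congrFun hb i
    ext i
    fin_cases i <;> simp [h, h', Affine.Point.sym2x] <;> ring
  have e3 (j : Fin 3) : (MvPolynomial.aeval ![u 0 * v 0, u 0 * v 1 + u 1 * v 0, u 1 * v 1]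
      (addSubMap W j)).eval (xc Q) = (a * b) ^ 2 * c * (φ Q + ψ Q).sym2x (φ Q - ψ Q) j := by
    rw [← coe_evalRingHom, ← coe_aeval_eq_evalRingHom, RingHom.coe_coe, ← AlgHom.comp_apply,
      MvPolynomial.comp_aeval]
    change MvPolynomial.aeval (fun i => (![u 0 * v 0, u 0 * v 1 + u 1 * v 0, u 1 * v 1] i).eval
      (xc Q)) _ = _
    rw [e2, aeval_smul_of_isHomogeneous (isHomogeneous_addSubMap W j), mul_assoc]
    congr 1
    exact congrFun hc j
  have e1' (i) := congrFun e1 i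
  rw [eval_sub, eval_mul, eval_mul, e3, e3, e1', e1']
  simp only [Pi.smul_apply, smul_eq_mul]
  ring

lemma IsXRep.surjective {φ : AddMonoid.End W.Point} {u : Fin 2 → F[X]} {d : ℕ}
    (hu : IsXRep φ u d) (hφ : φ ≠ 0) : Function.Surjective φ := by
  have hd : d ≠ 0 := by rintro rfl; exact hφ hu.eq_zero
  have hfin (Z : Set F) (hZ : Z.Finite) : ∀ᶠ S : W.Point in cofinite, xc S ∉ Z := by
    rw [eventually_cofinite]
    refine (hZ.biUnion fun r _ => finite_xc_eq (W := W) r).subset fun S hS => ?_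
    simp only [Set.mem_ofPred_eq, not_not] at hS
    simp only [Set.mem_iUnion, Set.mem_ofPred_eq]
    exact ⟨_, hS, rfl⟩
  have hbad := eventually_cofinite.1 (hu.eventually.and (eventually_ne_zero (W := W)))
  have key : ∀ᶠ S : W.Point in cofinite, S ∈ φ.range := by
    filter_upwards [eventually_ne_zero, hfin _ (hbad.image fun Q => (u 0).eval (xc Q) /
      (u 1).eval (xc Q)), hfin _ (Set.finite_singleton ((u 0).coeff d / (u 1).coeff d))]
      with S hS hS1 hS2
    rcases S with _ | ⟨s, t, hs⟩
    · exact absurd rfl hS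
    rw [xc_some] at hS1 hS2
    have hc : (C s * u 1 - u 0).coeff d ≠ 0 := by
      intro h0
      rw [coeff_sub, coeff_C_mul, sub_eq_zero] at h0
      by_cases h1 : (u 1).coeff d = 0
      · rw [h1, mul_zero] at h0
        refine hu.isMorphism.coeff_ne (_root_.funext fun i => ?_)
        fin_cases i
        · exact h0.symm
        · exact h1
      · exact hS2 (by rw [← h0, mul_div_cancel_right₀ _ h1]; rfl)
    obtain ⟨r, hr⟩ := IsAlgClosed.exists_root (C s * u 1 - u 0) (by
      intro h0
      rw [eq_C_of_degree_eq_zero h0, coeff_C_of_ne_zero hd] at hc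
      exact hc rfl)
    simp only [IsRoot.def, eval_sub, eval_mul, eval_C, sub_eq_zero] at hr
    obtain ⟨Q, hQ, rfl⟩ := exists_xc_eq (W := W) r
    have h1 : (u 1).eval (xc Q) ≠ 0 := by
      intro h0
      refine hu.isMorphism.eval_ne (xc Q) (_root_.funext fun i => ?_)
      fin_cases i
      · simpa [h0] using hr.symm
      · exact h0
    have hgood : (φ Q).xRep 0 * (u 1).eval (xc Q) = (φ Q).xRep 1 * (u 0).eval (xc Q) := by
      by_contra hne
      exact hS1 ⟨Q, fun h => hne h.1, by simp only; rw [← hr, mul_div_cancel_right₀ _ h1]⟩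
    have hpm : φ Q = .some s t hs ∨ φ Q = -.some s t hs := by
      apply eq_or_eq_neg_of_proportional
      apply mul_right_cancel₀ h1
      rw [← hr] at hgood
      simp only [Affine.Point.xRep_some, Matrix.cons_val_zero, Matrix.cons_val_one]
      linear_combination hgood
    rcases hpm with h | h
    · exact ⟨Q, h⟩
    · exact ⟨-Q, (map_neg φ Q).trans (by rw [h, neg_neg])⟩
  exact AddMonoidHom.range_eq_top.1 (eq_top_of_eventually_mem key)

end Degree
end EllipticEnd

namespace EllipticEnd
open WeierstrassCurve Filter Polynomial

/-! ### Specialization of points over a field of functions -/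

lemma exists_germ_rep {F T : Type*} {l : Filter T} (x : l.Germ F) : ∃ a : T → F, x = (a : l.Germ F) :=
  let ⟨a, ha⟩ := Quotient.exists_rep x
  ⟨a, ha.symm⟩

section Specialization
variable {F K T : Type*} [Field F] [Field K] {l : Filter T}

lemma eventually_ne_of_germ [l.NeBot] (ev : K →+* l.Germ F) {f : K} {a : T → F}
    (ha : ev f = (a : l.Germ F)) (hf : f ≠ 0) : ∀ᶠ t in l, a t ≠ 0 := by
  obtain ⟨b, hb⟩ := exists_germ_rep (ev f⁻¹)
  have h : ((a * b : T → F) : l.Germ F) = ((1 : T → F) : l.Germ F) := by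
    change (a : l.Germ F) * (b : l.Germ F) = 1
    rw [← hb, ← ha, ← map_mul, mul_inv_cancel₀ hf, map_one]
  filter_upwards [Germ.coe_eq.1 h] with t ht h0
  simp [h0] at ht

lemma germ_inv [l.NeBot] (ev : K →+* l.Germ F) {f : K} {a : T → F}
    (ha : ev f = (a : l.Germ F)) : ev f⁻¹ = ((a⁻¹ : T → F) : l.Germ F) := by
  by_cases hf : f = 0
  · subst hf
    rw [map_zero] at ha
    rw [inv_zero, map_zero]
    apply Germ.coe_eq.2
    filter_upwards [Germ.coe_eq.1 (show ((0 : T → F) : l.Germ F) = a from ha)] with t ht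
    simp [← ht]
  · obtain ⟨b, hb⟩ := exists_germ_rep (ev f⁻¹)
    have h : ((a * b : T → F) : l.Germ F) = ((1 : T → F) : l.Germ F) := by
      change (a : l.Germ F) * (b : l.Germ F) = 1
      rw [← hb, ← ha, ← map_mul, mul_inv_cancel₀ hf, map_one]
    rw [hb]
    apply Germ.coe_eq.2
    filter_upwards [Germ.coe_eq.1 h] with t ht
    exact eq_inv_of_mul_eq_one_right ht

lemma germ_div [l.NeBot] (ev : K →+* l.Germ F) {f g : K} {a b : T → F}
    (ha : ev f = (a : l.Germ F)) (hb : ev g = (b : l.Germ F)) :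
    ev (f / g) = ((a / b : T → F) : l.Germ F) := by
  rw [div_eq_mul_inv, map_mul, ha, germ_inv ev hb, div_eq_mul_inv]
  rfl

lemma eventually_eq_of_germ [l.NeBot] (ev : K →+* l.Germ F) {f g : K} {a b : T → F}
    (ha : ev f = (a : l.Germ F)) (hb : ev g = (b : l.Germ F)) (h : f = g) :
    ∀ᶠ t in l, a t = b t :=
  Germ.coe_eq.1 (ha.symm.trans ((congrArg ev h).trans hb))

lemma eventually_ne_of_germ_of_ne [l.NeBot] (ev : K →+* l.Germ F) {f g : K} {a b : T → F}
    (ha : ev f = (a : l.Germ F)) (hb : ev g = (b : l.Germ F)) (h : f ≠ g) :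
    ∀ᶠ t in l, a t ≠ b t := by
  have : ev (f - g) = ((a - b : T → F) : l.Germ F) := by rw [map_sub, ha, hb]; rfl
  filter_upwards [eventually_ne_of_germ ev this (sub_ne_zero.2 h)] with t ht
  exact sub_ne_zero.1 ht

variable [Algebra F K] {W : WeierstrassCurve.Affine F}

/-- The curve over an extension of the ground field. -/
abbrev extend (W : WeierstrassCurve.Affine F) (K : Type*) [Field K] [Algebra F K] :
    WeierstrassCurve.Affine K :=
  WeierstrassCurve.map W (algebraMap F K)

/-- The elements of `K` are germs of functions with values in `F`. The point `P` over `K` is the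
germ of the function `φ` with values in the points over `F`. -/
def Specializes (ev : K →+* l.Germ F) (φ : T → W.Point) : (extend W K).Point → Prop
  | 0 => ∀ᶠ t in l, φ t = 0
  | .some f g _ => ∃ a b : T → F, ev f = (a : l.Germ F) ∧ ev g = (b : l.Germ F) ∧
      ∀ᶠ t in l, ∃ h, φ t = .some (a t) (b t) h

variable {ev : K →+* l.Germ F} {φ ψ : T → W.Point} {P Q : (extend W K).Point}

lemma specializes_zero : Specializes ev φ (0 : (extend W K).Point) ↔ ∀ᶠ t in l, φ t = 0 := Iff.rfl

lemma Specializes.congr (h : Specializes ev φ P) (h' : ∀ᶠ t in l, φ t = ψ t) :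
    Specializes ev ψ P := by
  rcases P with _ | ⟨f, g, hP⟩
  · filter_upwards [specializes_zero.1 h, h'] with t h1 h2
    rw [← h2, h1]
  · obtain ⟨a, b, ha, hb, h⟩ := h
    refine ⟨a, b, ha, hb, ?_⟩
    filter_upwards [h, h'] with t h1 h2
    rwa [← h2]

section Formulas
variable {f g f₁ f₂ g₁ g₂ ℓ : K} {a b a₁ a₂ b₁ b₂ m : T → F}

lemma germ_negY
    (hev : ∀ c : F, ev (algebraMap F K c) = ((fun _ => c : T → F) : l.Germ F))
    (ha : ev f = (a : l.Germ F)) (hb : ev g = (b : l.Germ F)) :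
    ev ((extend W K).negY f g) = ((fun t => W.negY (a t) (b t) : T → F) : l.Germ F) := by
  simp only [Affine.negY, map_sub, map_neg, map_mul, map_a₁, map_a₃, hev, ha, hb]
  rfl

lemma germ_addX
    (hev : ∀ c : F, ev (algebraMap F K c) = ((fun _ => c : T → F) : l.Germ F))
    (h₁ : ev f₁ = (a₁ : l.Germ F)) (h₂ : ev f₂ = (a₂ : l.Germ F))
    (hm : ev ℓ = (m : l.Germ F)) : ev ((extend W K).addX f₁ f₂ ℓ) =
      ((fun t => W.addX (a₁ t) (a₂ t) (m t) : T → F) : l.Germ F) := by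
  simp only [Affine.addX, map_sub, map_pow, map_add, map_mul, map_a₁, map_a₂, hev, h₁, h₂, hm]
  rfl

lemma germ_addY
    (hev : ∀ c : F, ev (algebraMap F K c) = ((fun _ => c : T → F) : l.Germ F))
    (h₁ : ev f₁ = (a₁ : l.Germ F)) (h₂ : ev f₂ = (a₂ : l.Germ F))
    (h₃ : ev g₁ = (b₁ : l.Germ F))
    (hm : ev ℓ = (m : l.Germ F)) : ev ((extend W K).addY f₁ f₂ g₁ ℓ) =
      ((fun t => W.addY (a₁ t) (a₂ t) (b₁ t) (m t) : T → F) : l.Germ F) := by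
  rw [Affine.addY]
  have hX := germ_addX (W := W) hev h₁ h₂ hm
  refine germ_negY hev hX ?_
  rw [Affine.negAddY, map_add, map_mul, map_sub, hX, h₁, h₃, hm]
  rfl

variable [l.NeBot] [DecidableEq F] [DecidableEq K]

lemma germ_slope
    (hev : ∀ c : F, ev (algebraMap F K c) = ((fun _ => c : T → F) : l.Germ F))
    (h₁ : ev f₁ = (a₁ : l.Germ F)) (h₂ : ev f₂ = (a₂ : l.Germ F))
    (h₃ : ev g₁ = (b₁ : l.Germ F)) (h₄ : ev g₂ = (b₂ : l.Germ F)) :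
    ev ((extend W K).slope f₁ f₂ g₁ g₂) =
      ((fun t => W.slope (a₁ t) (a₂ t) (b₁ t) (b₂ t) : T → F) : l.Germ F) := by
  have hn := germ_negY (W := W) hev h₂ h₄
  by_cases hx : f₁ = f₂
  · by_cases hy : g₁ = (extend W K).negY f₂ g₂
    · rw [Affine.slope_of_Y_eq hx hy, map_zero]
      apply Germ.coe_eq.2
      filter_upwards [eventually_eq_of_germ ev h₁ h₂ hx, eventually_eq_of_germ ev h₃ hn hy]
        with t h1 h2
      rw [Affine.slope_of_Y_eq h1 h2]
    · rw [Affine.slope_of_Y_ne hx hy]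
      have hnum : ev (3 * f₁ ^ 2 + 2 * (extend W K).a₂ * f₁ + (extend W K).a₄
          - (extend W K).a₁ * g₁) = ((fun t => 3 * a₁ t ^ 2 + 2 * W.a₂ * a₁ t + W.a₄ -
          W.a₁ * b₁ t : T → F) : l.Germ F) := by
        simp only [map_sub, map_add, map_mul, map_pow, map_ofNat, map_a₁, map_a₂, map_a₄, hev,
          h₁, h₃]
        rfl
      have hden : ev (g₁ - (extend W K).negY f₁ g₁) =
          ((fun t => b₁ t - W.negY (a₁ t) (b₁ t) : T → F) : l.Germ F) := by
        rw [map_sub, h₃, germ_negY hev h₁ h₃]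
        rfl
      rw [germ_div ev hnum hden]
      apply Germ.coe_eq.2
      filter_upwards [eventually_eq_of_germ ev h₁ h₂ hx, eventually_ne_of_germ_of_ne ev h₃ hn hy]
        with t h1 h2
      rw [Affine.slope_of_Y_ne h1 h2]
      rfl
  · rw [Affine.slope_of_X_ne hx]
    have hnum : ev (g₁ - g₂) = ((b₁ - b₂ : T → F) : l.Germ F) := by rw [map_sub, h₃, h₄]; rfl
    have hden : ev (f₁ - f₂) = ((a₁ - a₂ : T → F) : l.Germ F) := by rw [map_sub, h₁, h₂]; rfl
    rw [germ_div ev hnum hden]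
    apply Germ.coe_eq.2
    filter_upwards [eventually_ne_of_germ_of_ne ev h₁ h₂ hx] with t h1
    rw [Affine.slope_of_X_ne h1]
    rfl

end Formulas

lemma Specializes.neg (hev : ∀ c : F, ev (algebraMap F K c) = ((fun _ => c : T → F) : l.Germ F))
    (h : Specializes ev φ P) : Specializes ev (fun t => -φ t) (-P) := by
  rcases P with _ | ⟨f, g, hP⟩
  · rw [← Affine.Point.zero_def, Affine.Point.neg_zero]
    filter_upwards [specializes_zero.1 h] with t h1
    rw [h1, Affine.Point.neg_zero]
  · obtain ⟨a, b, ha, hb, h⟩ := h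
    refine ⟨a, _, ha, germ_negY hev ha hb, ?_⟩
    filter_upwards [h] with t ⟨h1, h2⟩
    exact ⟨(Affine.nonsingular_neg ..).2 h1, by rw [h2]; rfl⟩

theorem Specializes.add [l.NeBot] [DecidableEq F] [DecidableEq K]
    (hev : ∀ c : F, ev (algebraMap F K c) = ((fun _ => c : T → F) : l.Germ F))
    (hφ : Specializes ev φ P) (hψ : Specializes ev ψ Q) :
    Specializes ev (fun t => φ t + ψ t) (P + Q) := by
  rcases P with _ | ⟨f₁, g₁, hP⟩
  · rw [← Affine.Point.zero_def, zero_add]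
    refine hψ.congr ?_
    filter_upwards [specializes_zero.1 hφ] with t h1
    rw [h1, zero_add]
  rcases Q with _ | ⟨f₂, g₂, hQ⟩
  · rw [← Affine.Point.zero_def, add_zero]
    refine hφ.congr ?_
    filter_upwards [specializes_zero.1 hψ] with t h1
    rw [h1, add_zero]
  obtain ⟨a₁, b₁, h₁, h₃, hφ⟩ := hφ
  obtain ⟨a₂, b₂, h₂, h₄, hψ⟩ := hψ
  have hn := germ_negY (W := W) hev h₂ h₄
  by_cases hxy : f₁ = f₂ ∧ g₁ = (extend W K).negY f₂ g₂
  · rw [Affine.Point.add_of_Y_eq hxy.1 hxy.2]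
    filter_upwards [hφ, hψ, eventually_eq_of_germ ev h₁ h₂ hxy.1,
      eventually_eq_of_germ ev h₃ hn hxy.2] with t ⟨_, h1⟩ ⟨_, h2⟩ h3 h4
    rw [h1, h2, Affine.Point.add_of_Y_eq h3 h4]
  · rw [Affine.Point.add_some hxy]
    have hs := germ_slope (W := W) hev h₁ h₂ h₃ h₄
    refine ⟨_, _, germ_addX hev h₁ h₂ hs, germ_addY hev h₁ h₂ h₃ hs, ?_⟩
    have hxy' : ∀ᶠ t in l, ¬(a₁ t = a₂ t ∧ b₁ t = W.negY (a₂ t) (b₂ t)) := by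
      rcases not_and_or.1 hxy with h | h
      · filter_upwards [eventually_ne_of_germ_of_ne ev h₁ h₂ h] with t ht using fun h => ht h.1
      · filter_upwards [eventually_ne_of_germ_of_ne ev h₃ hn h] with t ht using fun h => ht h.2
    filter_upwards [hφ, hψ, hxy'] with t ⟨k1, h1⟩ ⟨k2, h2⟩ h3
    exact ⟨Affine.nonsingular_add k1 k2 h3, by rw [h1, h2, Affine.Point.add_some h3]⟩

lemma Specializes.unique [l.NeBot] (hP : Specializes ev φ P) (hQ : Specializes ev φ Q) : P = Q := by
  rcases P with _ | ⟨f₁, g₁, k₁⟩ <;> rcases Q with _ | ⟨f₂, g₂, k₂⟩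
  · rfl
  · obtain ⟨a, b, -, -, h⟩ := hQ
    obtain ⟨t, h1, ⟨_, h2⟩⟩ := ((specializes_zero.1 hP).and h).exists
    rw [h1] at h2
    exact absurd h2.symm (Affine.Point.some_ne_zero _)
  · obtain ⟨a, b, -, -, h⟩ := hP
    obtain ⟨t, h1, ⟨_, h2⟩⟩ := ((specializes_zero.1 hQ).and h).exists
    rw [h1] at h2
    exact absurd h2.symm (Affine.Point.some_ne_zero _)
  · obtain ⟨a₁, b₁, h₁, h₃, hφ⟩ := hP
    obtain ⟨a₂, b₂, h₂, h₄, hψ⟩ := hQ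
    have h : ∀ᶠ t in l, a₁ t = a₂ t ∧ b₁ t = b₂ t := by
      filter_upwards [hφ, hψ] with t ⟨_, h1⟩ ⟨_, h2⟩
      rw [h1, Affine.Point.some.injEq] at h2
      exact h2
    have hf : f₁ = f₂ := ev.injective (by rw [h₁, h₂]; exact Germ.coe_eq.2 (h.mono fun _ h => h.1))
    have hg : g₁ = g₂ := ev.injective (by rw [h₃, h₄]; exact Germ.coe_eq.2 (h.mono fun _ h => h.2))
    subst hf hg
    rfl

end Specialization
end EllipticEnd

namespace EllipticEnd
open WeierstrassCurve Filter Polynomial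
open scoped Polynomial.Bivariate

/-! ### Rational functions as germs -/

section FunctionField
variable {F : Type*} [Field F] {W : WeierstrassCurve.Affine F}

/-- The value of a regular function at an affine point. -/
noncomputable def evalHom {x y : F} (h : W.Equation x y) : W.CoordinateRing →+* F :=
  AdjoinRoot.lift (evalRingHom x) y (by rw [eval₂_evalRingHom]; exact h)

lemma evalHom_mk {x y : F} (h : W.Equation x y) (p : F[X][Y]) :
    evalHom h (Affine.CoordinateRing.mk W p) = p.evalEval x y := by
  rw [evalHom, AdjoinRoot.lift_mk, eval₂_evalRingHom]

/-- The ordinate of a point, with value `0` at infinity. -/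
def yc : W.Point → F
  | 0 => 0
  | .some _ y _ => y

lemma yc_some {x y : F} (h : W.Nonsingular x y) : yc (.some x y h) = y := rfl

lemma two_Y_ne_zero [W.IsElliptic] {q : F[X]}
    (h : q • (Affine.CoordinateRing.mk W (2 * Y + C (C W.a₁ * X + C W.a₃))) = 0) : q = 0 := by
  by_contra hq
  have e : q • (Affine.CoordinateRing.mk W (2 * Y + C (C W.a₁ * X + C W.a₃))) =
      (q * (C W.a₁ * X + C W.a₃)) • (1 : W.CoordinateRing) +
        (q * C 2) • Affine.CoordinateRing.mk W Y := by
    simp only [Affine.CoordinateRing.smul, ← map_mul, ← map_one (Affine.CoordinateRing.mk W),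
      ← map_add]
    congr 1
    have : (2 : F[X][Y]) = C (C 2) := by rw [map_ofNat C, map_ofNat C]
    rw [this, C_mul, C_mul]
    ring
  rw [e] at h
  obtain ⟨h1, h2⟩ := Affine.CoordinateRing.smul_basis_eq_zero h
  have h1' := (mul_eq_zero.1 h1).resolve_left hq
  have h2' : (2 : F) = 0 := C_eq_zero.1 ((mul_eq_zero.1 h2).resolve_left hq)
  have h3 : W.a₃ = 0 := by simpa using congrArg (fun p => coeff p 0) h1'
  have h4 : W.a₁ = 0 := by simpa [coeff_C] using congrArg (fun p => coeff p 1) h1'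
  have hb2 : W.b₂ = 0 := by rw [b₂, h4]; linear_combination (2 * W.a₂) * h2'
  have hb4 : W.b₄ = 0 := by rw [b₄, h4]; linear_combination W.a₄ * h2'
  have hb6 : W.b₆ = 0 := by rw [b₆, h3]; linear_combination (2 * W.a₆) * h2'
  have hΔ : W.Δ = 0 := by rw [Δ, hb2, hb4, hb6]; ring
  exact W.isUnit_Δ.ne_zero hΔ

lemma exists_mul_eq_norm {u : W.CoordinateRing} (hu : u ≠ 0) : ∃ (v : W.CoordinateRing) (n : F[X]),
    n ≠ 0 ∧ u * v = Affine.CoordinateRing.mk W (C n) := by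
  obtain ⟨p, q, rfl⟩ := Affine.CoordinateRing.exists_smul_basis_eq u
  have := Module.Finite.of_basis (Affine.CoordinateRing.basis W)
  refine ⟨Affine.CoordinateRing.mk W (C p + C q * (-(Y : F[X][Y]) - C (C W.a₁ * X + C W.a₃))),
    Algebra.norm F[X] (p • (1 : W.CoordinateRing) + q • Affine.CoordinateRing.mk W Y),
    Algebra.norm_ne_zero_iff.2 hu, ?_⟩
  refine Eq.trans ?_ (Affine.CoordinateRing.coe_norm_smul_basis (W' := W) p q).symm
  rw [Affine.CoordinateRing.smul, Affine.CoordinateRing.smul, mul_one, map_mul]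
  simp only [map_add, map_mul]

section Generic
variable (W) (K : Type*) [Field K] [Algebra W.CoordinateRing K]

/-- The abscissa of the generic point. -/
noncomputable def genX : K := algebraMap W.CoordinateRing K (Affine.CoordinateRing.mk W (C X))

/-- The ordinate of the generic point. -/
noncomputable def genY : K := algebraMap W.CoordinateRing K (Affine.CoordinateRing.mk W Y)

variable [Algebra F K] [IsScalarTower F W.CoordinateRing K]

lemma algebraMap_mk_C (p : F[X]) :
    algebraMap W.CoordinateRing K (Affine.CoordinateRing.mk W (C p)) = aeval (genX W K) p := by
  have h := aeval_algHom_apply (IsScalarTower.toAlgHom F F[X] W.CoordinateRing) X p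
  rw [aeval_X_left_apply] at h
  rw [genX, aeval_algebraMap_apply]
  exact congrArg _ h.symm

lemma equation_gen : (extend W K).Equation (genX W K) (genY W K) := by
  have h0 : Affine.CoordinateRing.mk W (Y ^ 2 + C (C W.a₁ * X + C W.a₃) * Y -
      C (X ^ 3 + C W.a₂ * X ^ 2 + C W.a₄ * X + C W.a₆)) = 0 := AdjoinRoot.mk_self
  have h := congrArg (algebraMap W.CoordinateRing K) h0
  rw [map_zero] at h
  simp only [map_sub, map_add, map_mul, map_pow, algebraMap_mk_C] at h
  rw [Affine.equation_iff]
  simp only [map_a₁, map_a₂, map_a₃, map_a₄, map_a₆, genY]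
  simp only [aeval_X, aeval_C] at h
  linear_combination h

end Generic

variable [IsAlgClosed F] [W.IsElliptic]

lemma exists_equation (W : WeierstrassCurve.Affine F) [W.IsElliptic] :
    ∃ p : F × F, W.Equation p.1 p.2 := by
  obtain ⟨P, hP, -⟩ := exists_xc_eq (W := W) 0
  rcases P with _ | ⟨x, y, h⟩
  · exact absurd rfl hP
  · exact ⟨(x, y), h.1⟩

/-- The value of a regular function at a point, with a junk value at infinity. -/
noncomputable def evalAt : W.Point → W.CoordinateRing →+* F
  | 0 => evalHom (exists_equation W).choose_spec
  | .some _ _ h => evalHom h.1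

lemma evalAt_some {x y : F} (h : W.Nonsingular x y) (p : F[X][Y]) :
    evalAt (.some x y h) (Affine.CoordinateRing.mk W p) = p.evalEval x y :=
  evalHom_mk h.1 p

lemma evalAt_mk {Q : W.Point} (hQ : Q ≠ 0) (p : F[X][Y]) :
    evalAt Q (Affine.CoordinateRing.mk W p) = p.evalEval (xc Q) (yc Q) := by
  rcases Q with _ | ⟨x, y, h⟩
  · exact absurd rfl hQ
  · exact evalAt_some h p

lemma eventually_evalAt_ne {u : W.CoordinateRing} (hu : u ≠ 0) :
    ∀ᶠ Q : W.Point in cofinite, evalAt Q u ≠ 0 := by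
  obtain ⟨v, n, hn, hv⟩ := exists_mul_eq_norm hu
  filter_upwards [eventually_eval_xc_ne (W := W) hn, eventually_ne_zero] with Q h1 h2 h0
  have := congrArg (evalAt Q) hv
  rw [map_mul, h0, zero_mul, evalAt_mk h2, evalEval_C] at this
  exact h1 this.symm

/-- Regular functions as germs of functions on the set of points. -/
noncomputable def germC : W.CoordinateRing →+* (cofinite : Filter W.Point).Germ F :=
  (Germ.coeRingHom cofinite).comp (RingHom.pi evalAt)

lemma isUnit_germC {u : W.CoordinateRing} (hu : u ≠ 0) : IsUnit (germC u) := by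
  refine IsUnit.of_mul_eq_one
    ((fun Q => (evalAt Q u)⁻¹ : W.Point → F) : (cofinite : Filter W.Point).Germ F) ?_
  apply Germ.coe_eq.2
  filter_upwards [eventually_evalAt_ne hu] with Q hQ
  exact mul_inv_cancel₀ hQ

variable (W) (K : Type*) [Field K] [Algebra W.CoordinateRing K] [IsFractionRing W.CoordinateRing K]

/-- Rational functions as germs of functions on the set of points. -/
noncomputable def germ : K →+* (cofinite : Filter W.Point).Germ F :=
  IsLocalization.lift (M := nonZeroDivisors W.CoordinateRing) (g := germC)
    fun u => isUnit_germC (nonZeroDivisors.ne_zero u.2)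

lemma germ_algebraMap (u : W.CoordinateRing) : germ W K (algebraMap _ K u) =
    ((fun Q => evalAt Q u : W.Point → F) : (cofinite : Filter W.Point).Germ F) :=
  IsLocalization.lift_eq _ u

lemma germ_genX : germ W K (genX W K) = ((xc : W.Point → F) : (cofinite : Filter W.Point).Germ F) := by
  rw [genX, germ_algebraMap]
  apply Germ.coe_eq.2
  filter_upwards [eventually_ne_zero] with Q hQ
  rw [evalAt_mk hQ, evalEval_C, eval_X]

lemma germ_genY : germ W K (genY W K) = ((yc : W.Point → F) : (cofinite : Filter W.Point).Germ F) := by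
  rw [genY, germ_algebraMap]
  apply Germ.coe_eq.2
  filter_upwards [eventually_ne_zero] with Q hQ
  rw [evalAt_mk hQ, evalEval_X]

variable [Algebra F K] [IsScalarTower F W.CoordinateRing K]

lemma germ_const (c : F) : germ W K (algebraMap F K c) =
    ((fun _ => c : W.Point → F) : (cofinite : Filter W.Point).Germ F) := by
  rw [IsScalarTower.algebraMap_apply F W.CoordinateRing K, germ_algebraMap]
  apply Germ.coe_eq.2
  filter_upwards [eventually_ne_zero] with Q hQ
  change evalAt Q (Affine.CoordinateRing.mk W (C (C c))) = c
  rw [evalAt_mk hQ, evalEval_C, eval_C]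

lemma germ_aeval (p : F[X]) : germ W K (aeval (genX W K) p) =
    ((fun Q => p.eval (xc Q) : W.Point → F) : (cofinite : Filter W.Point).Germ F) := by
  rw [← algebraMap_mk_C, germ_algebraMap]
  apply Germ.coe_eq.2
  filter_upwards [eventually_ne_zero] with Q hQ
  rw [evalAt_mk hQ, evalEval_C]

lemma aeval_genX_injective : Function.Injective (aeval (R := F) (genX W K)) := by
  rw [injective_iff_map_eq_zero]
  intro p hp
  apply eq_zero_of_eventually_eval_xc (W := W)
  have := germ_aeval W K p
  rw [hp, map_zero] at this
  filter_upwards [Germ.coe_eq.1 (show ((0 : W.Point → F) : (cofinite : Filter W.Point).Germ F) = _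
    from this)] with Q hQ
  exact hQ.symm

/-- The generic point. -/
noncomputable def genPoint : (extend W K).Point := .mk (equation_gen W K)

lemma specializes_genPoint : Specializes (germ W K) (fun Q : W.Point => Q) (genPoint W K) := by
  refine ⟨xc, yc, germ_genX W K, germ_genY W K, ?_⟩
  filter_upwards [eventually_ne_zero] with Q hQ
  rcases Q with _ | ⟨x, y, h⟩
  · exact absurd rfl hQ
  · exact ⟨h, rfl⟩

end FunctionField
end EllipticEnd

namespace EllipticEnd
open WeierstrassCurve Filter Polynomial
open scoped Polynomial.Bivariate

/-! ### The ring of rational endomorphisms -/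

section RationalEndomorphisms
variable {F : Type*} [Field F] {W : WeierstrassCurve.Affine F}

lemma eventually_neg {p : W.Point → Prop} (h : ∀ᶠ Q in cofinite, p Q) :
    ∀ᶠ Q in cofinite, p (-Q) :=
  (neg_injective.tendsto_cofinite).eventually h

variable [IsAlgClosed F] [W.IsElliptic] {K : Type*} [Field K] [Algebra W.CoordinateRing K]
  [IsFractionRing W.CoordinateRing K] [Algebra F K]

lemma eq_zero_of_specializes_zero [DecidableEq F] {φ : AddMonoid.End W.Point}
    (hφ : Specializes (germ W K) φ 0) : φ = 0 :=
  eq_zero_of_eventually_eq_or_neg (R := 0) ((specializes_zero.1 hφ).mono fun _ h => Or.inl h)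

lemma Specializes.comp {φ ψ : W.Point → W.Point} {f' g' : K}
    {h' : (extend W K).Nonsingular f' g'} (hφ : Specializes (germ W K) φ (.some f' g' h')) (ht : Tendsto ψ cofinite cofinite)
    {s : K →ₐ[F] K} (hs : ∀ (c : K) (a : W.Point → F),
      germ W K c = (a : (cofinite : Filter W.Point).Germ F) →
        germ W K (s c) = ((a ∘ ψ : W.Point → F) : (cofinite : Filter W.Point).Germ F)) :
    ∃ h'', Specializes (germ W K) (fun Q => φ (ψ Q)) (.some (s f') (s g') h'') := by
  obtain ⟨a, b, ha, hb, hab⟩ := hφ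
  have he := congrArg s ((Affine.equation_iff ..).1 h'.1)
  simp only [map_a₁, map_a₂, map_a₃, map_a₄, map_a₆, map_add, map_mul, map_pow,
    AlgHom.commutes] at he
  refine ⟨Affine.equation_iff_nonsingular.1 ((Affine.equation_iff ..).2 he), a ∘ ψ, b ∘ ψ,
    hs _ _ ha, hs _ _ hb, ht.eventually hab⟩

variable [IsScalarTower F W.CoordinateRing K]

/-- An even rational function is a rational function of the abscissa. -/
lemma exists_eq_aeval_of_even {f : K} {a : W.Point → F}
    (hf : germ W K f = (a : (cofinite : Filter W.Point).Germ F))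
    (ha : ∀ᶠ Q in cofinite, a (-Q) = a Q) :
    ∃ A B : F[X], IsCoprime A B ∧ B ≠ 0 ∧ f * aeval (genX W K) B = aeval (genX W K) A := by
  obtain ⟨u, v, hv, rfl⟩ := IsFractionRing.div_surjective (A := W.CoordinateRing) f
  have hv0 := nonZeroDivisors.ne_zero hv
  obtain ⟨v', n, hn, hv'⟩ := exists_mul_eq_norm hv0
  obtain ⟨p, q, hpq⟩ := Affine.CoordinateRing.exists_smul_basis_eq (u * v')
  set f := algebraMap W.CoordinateRing K u / algebraMap W.CoordinateRing K v with hf_def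
  have hv1 : algebraMap W.CoordinateRing K v ≠ 0 := by
    rwa [ne_eq, IsFractionRing.to_map_eq_zero_iff]
  have hmk : p • (1 : W.CoordinateRing) + q • Affine.CoordinateRing.mk W Y =
      Affine.CoordinateRing.mk W (C p + C q * Y) := by
    rw [Affine.CoordinateRing.smul, Affine.CoordinateRing.smul, mul_one, map_add, map_mul]
  have hmain : f * aeval (genX W K) n =
      algebraMap W.CoordinateRing K (Affine.CoordinateRing.mk W (C p + C q * Y)) := by
    rw [← algebraMap_mk_C, ← hv', ← hmk, hpq, map_mul, map_mul, hf_def]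
    field_simp
  have hgerm : ∀ᶠ Q : W.Point in cofinite,
      a Q * n.eval (xc Q) = p.eval (xc Q) + q.eval (xc Q) * yc Q := by
    have h1 : germ W K (f * aeval (genX W K) n) = ((fun Q => a Q * n.eval (xc Q) : W.Point → F) :
        (cofinite : Filter W.Point).Germ F) := by
      rw [map_mul, hf, germ_aeval]
      rfl
    filter_upwards [eventually_eq_of_germ (germ W K) h1 (germ_algebraMap W K _) hmain,
      eventually_ne_zero] with Q hQ hQ0
    rw [evalAt_mk hQ0] at hQ
    simpa [evalEval_C] using hQ
  have hq : q = 0 := by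
    apply two_Y_ne_zero (W := W)
    by_contra hne
    obtain ⟨Q, h0, h1, h2, h3, h4⟩ := (eventually_ne_zero.and ((eventually_evalAt_ne hne).and
      (hgerm.and ((eventually_neg hgerm).and ha)))).exists
    rw [Affine.CoordinateRing.smul, ← map_mul, evalAt_mk h0] at h1
    apply h1
    rcases Q with _ | ⟨x, y, h⟩
    · exact absurd rfl h0
    rw [h4] at h3
    rw [Affine.Point.neg_some, xc_some, yc_some] at h3
    rw [xc_some, yc_some] at h2 ⊢
    rw [Affine.negY] at h3
    simp only [evalEval_mul, evalEval_C, evalEval_add, evalEval_X, eval_add, eval_mul, eval_C,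
      eval_X]
    have : (2 : F[X][Y]).evalEval x y = 2 := by simp [evalEval]
    rw [this]
    linear_combination h3 - h2
  classical
  let := EuclideanDomain.gcdMonoid F[X]
  have hg0 : GCDMonoid.gcd p n ≠ 0 := gcd_ne_zero_of_right hn
  have hp := EuclideanDomain.mul_div_cancel' hg0 (gcd_dvd_left p n)
  have hn' := EuclideanDomain.mul_div_cancel' hg0 (gcd_dvd_right p n)
  refine ⟨p / GCDMonoid.gcd p n, n / GCDMonoid.gcd p n, isCoprime_div_gcd_div_gcd hn, ?_, ?_⟩
  · intro h
    rw [h, mul_zero] at hn'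
    exact hn hn'.symm
  · have hg : aeval (genX W K) (GCDMonoid.gcd p n) ≠ 0 := by
      rwa [ne_eq, map_eq_zero_iff _ (aeval_genX_injective W K)]
    apply mul_left_cancel₀ hg
    rw [mul_left_comm, ← map_mul, ← map_mul, hp, hn', hmain, hq, map_zero, zero_mul, add_zero,
      algebraMap_mk_C]

lemma exists_isXRep_of_specializes [DecidableEq F] {φ : AddMonoid.End W.Point} {f g : K}
    {h : (extend W K).Nonsingular f g} (hφ : Specializes (germ W K) φ (.some f g h)) :
    ∃ A B : F[X], IsCoprime A B ∧ B ≠ 0 ∧ f * aeval (genX W K) B = aeval (genX W K) A ∧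
      IsXRep φ ![A, B] (max A.natDegree B.natDegree) := by
  obtain ⟨a, b, ha, hb, hab⟩ := hφ
  have heven : ∀ᶠ Q in cofinite, a (-Q) = a Q := by
    filter_upwards [hab, eventually_neg hab] with Q ⟨_, h1⟩ ⟨_, h2⟩
    have h3 := (map_neg φ Q).symm.trans h2
    rw [h1, Affine.Point.neg_some, Affine.Point.some.injEq] at h3
    exact h3.1.symm
  obtain ⟨A, B, hAB, hB, hf⟩ := exists_eq_aeval_of_even ha heven
  refine ⟨A, B, hAB, hB, hf, isMorphism_of_isCoprime hAB, ?_⟩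
  have h1 : germ W K (f * aeval (genX W K) B) = ((fun Q => a Q * B.eval (xc Q) : W.Point → F) :
      (cofinite : Filter W.Point).Germ F) := by
    rw [map_mul, ha, germ_aeval]
    rfl
  filter_upwards [eventually_eq_of_germ (germ W K) h1 (germ_aeval W K A) hf, hab] with Q h2 ⟨_, h3⟩
  rw [h3]
  simpa using h2

section Pullback
variable {ψ : W.Point → W.Point} {f g : K} {h : (extend W K).Nonsingular f g}

/-- The pullback of rational functions under a rational map. -/
lemma exists_pullback (hψ : Specializes (germ W K) ψ (.some f g h))
    (ht : Tendsto ψ cofinite cofinite) :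
    ∃ s : K →ₐ[F] K, s (genX W K) = f ∧ s (genY W K) = g ∧
      ∀ (c : K) (a : W.Point → F), germ W K c = (a : (cofinite : Filter W.Point).Germ F) →
        germ W K (s c) = ((a ∘ ψ : W.Point → F) : (cofinite : Filter W.Point).Germ F) := by
  obtain ⟨a, b, ha, hb, hab⟩ := hψ
  have he := (Affine.equation_iff ..).1 h.1
  simp only [map_a₁, map_a₂, map_a₃, map_a₄, map_a₆] at he
  let r : W.CoordinateRing →+* K := AdjoinRoot.lift (aeval (R := F) f).toRingHom g (by
    simp only [Affine.polynomial, eval₂_sub, eval₂_add, eval₂_mul, eval₂_pow, eval₂_X, eval₂_C]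
    simp
    linear_combination he)
  have hrC (p : F[X]) : r (Affine.CoordinateRing.mk W (C p)) = aeval f p := AdjoinRoot.lift_of _
  have hrY : r (Affine.CoordinateRing.mk W Y) = g := AdjoinRoot.lift_root _
  have hr : (germ W K).comp r =
      (Germ.coeRingHom cofinite).comp (RingHom.pi fun Q => evalAt (ψ Q)) := by
    refine AdjoinRoot.ringHom_ext (Polynomial.ringHom_ext (fun c => ?_) ?_) ?_
    · change germ W K (r (Affine.CoordinateRing.mk W (C (C c)))) =
        ((fun Q => evalAt (ψ Q) (Affine.CoordinateRing.mk W (C (C c))) : W.Point → F) :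
          (cofinite : Filter W.Point).Germ F)
      rw [hrC, aeval_C, germ_const]
      apply Germ.coe_eq.2
      filter_upwards [hab] with Q ⟨_, hQ⟩
      rw [hQ, evalAt_some, evalEval_C, eval_C]
    · change germ W K (r (Affine.CoordinateRing.mk W (C X))) =
        ((fun Q => evalAt (ψ Q) (Affine.CoordinateRing.mk W (C X)) : W.Point → F) :
          (cofinite : Filter W.Point).Germ F)
      rw [hrC, aeval_X, ha]
      apply Germ.coe_eq.2
      filter_upwards [hab] with Q ⟨_, hQ⟩
      rw [hQ, evalAt_some, evalEval_C, eval_X]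
    · change germ W K (r (Affine.CoordinateRing.mk W Y)) =
        ((fun Q => evalAt (ψ Q) (Affine.CoordinateRing.mk W Y) : W.Point → F) :
          (cofinite : Filter W.Point).Germ F)
      rw [hrY, hb]
      apply Germ.coe_eq.2
      filter_upwards [hab] with Q ⟨_, hQ⟩
      rw [hQ, evalAt_some, evalEval_X]
  have hr' (u : W.CoordinateRing) : germ W K (r u) = ((fun Q => evalAt (ψ Q) u : W.Point → F) :
      (cofinite : Filter W.Point).Germ F) := congrArg (fun t => t u) hr
  have hinj (u : W.CoordinateRing) (hu : u ≠ 0) : IsUnit (r u) := by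
    rw [isUnit_iff_ne_zero]
    intro h0
    have h1 := hr' u
    rw [h0, map_zero] at h1
    obtain ⟨Q, h2, h3⟩ := ((Germ.coe_eq.1 (show ((0 : W.Point → F) :
      (cofinite : Filter W.Point).Germ F) = _ from h1)).and
      (ht.eventually (eventually_evalAt_ne hu))).exists
    exact h3 h2.symm
  let s : K →+* K := IsLocalization.lift (M := nonZeroDivisors W.CoordinateRing) (g := r)
    fun u => hinj u (nonZeroDivisors.ne_zero u.2)
  have hs (u : W.CoordinateRing) : s (algebraMap _ K u) = r u := IsLocalization.lift_eq _ u
  refine ⟨⟨s, fun c => ?_⟩, ?_, ?_, ?_⟩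
  · refine (congrArg s (IsScalarTower.algebraMap_apply F W.CoordinateRing K c)).trans
      ((hs _).trans ?_)
    exact (hrC (C c)).trans (aeval_C ..)
  · change s _ = _
    rw [genX, hs, hrC, aeval_X]
  · change s _ = _
    rw [genY, hs, hrY]
  · intro c d hc
    change germ W K (s c) = _
    obtain ⟨u, v, hv, rfl⟩ := IsFractionRing.div_surjective (A := W.CoordinateRing) c
    have h1 := germ_div (germ W K) (germ_algebraMap W K u) (germ_algebraMap W K v)
    rw [map_div₀, hs, hs, germ_div (germ W K) (hr' u) (hr' v)]
    exact Germ.coe_eq.2 (ht.eventually (Germ.coe_eq.1 (h1.symm.trans hc)))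

end Pullback

variable [DecidableEq F]
variable (W K)

/-- The ring of those endomorphisms of the group of points which are given by rational functions. -/
def ratEnd : Subring (AddMonoid.End W.Point) where
  carrier := {φ | ∃ P, Specializes (germ W K) φ P}
  zero_mem' := ⟨0, specializes_zero.2 (Eventually.of_forall fun _ => rfl)⟩
  one_mem' := ⟨_, specializes_genPoint W K⟩
  neg_mem' := fun ⟨_, h⟩ => ⟨_, h.neg (germ_const W K)⟩
  add_mem' := fun ⟨_, h⟩ ⟨_, h'⟩ => by
    classical
    exact ⟨_, h.add (germ_const W K) h'⟩
  mul_mem' := by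
    rintro φ ψ ⟨P, hP⟩ ⟨Q, hQ⟩
    by_cases hψ : ψ = 0
    · subst hψ
      exact ⟨0, specializes_zero.2 (Eventually.of_forall fun _ => map_zero φ)⟩
    rcases P with _ | ⟨f, g, h⟩
    · rw [eq_zero_of_specializes_zero hP]
      exact ⟨0, specializes_zero.2 (Eventually.of_forall fun _ => rfl)⟩
    rcases Q with _ | ⟨f', g', h'⟩
    · exact absurd (eq_zero_of_specializes_zero hQ) hψ
    obtain ⟨A, B, -, -, -, hx⟩ := exists_isXRep_of_specializes hQ
    obtain ⟨s, -, -, hs⟩ := exists_pullback hQ (hx.tendsto hψ)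
    exact ⟨_, (hP.comp (hx.tendsto hψ) hs).choose_spec⟩

variable {W K}

lemma exists_isXRep (φ : ratEnd W K) : ∃ (d : ℕ) (u : Fin 2 → F[X]), IsXRep φ.1 u d := by
  obtain ⟨P, hP⟩ := φ.2
  rcases P with _ | ⟨f, g, h⟩
  · rw [eq_zero_of_specializes_zero hP]
    exact ⟨_, _, isXRep_zero⟩
  · obtain ⟨A, B, -, -, -, hx⟩ := exists_isXRep_of_specializes hP
    exact ⟨_, _, hx⟩

/-- The degree of an endomorphism. -/
noncomputable def degree (φ : ratEnd W K) : ℕ := (exists_isXRep φ).choose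

lemma degree_eq {φ : ratEnd W K} {u : Fin 2 → F[X]} {d : ℕ} (h : IsXRep φ.1 u d) : degree φ = d :=
  (exists_isXRep φ).choose_spec.choose_spec.unique h

lemma exists_isXRep_degree (φ : ratEnd W K) : ∃ u : Fin 2 → F[X], IsXRep φ.1 u (degree φ) :=
  (exists_isXRep φ).choose_spec

lemma degree_zero : degree (0 : ratEnd W K) = 0 := degree_eq isXRep_zero

theorem isCompositionNorm_degree : IsCompositionNorm (fun φ : ratEnd W K => (degree φ : ℤ)) where
  eq_zero φ h := by
    obtain ⟨u, hu⟩ := exists_isXRep_degree φ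
    rw [Nat.cast_eq_zero.1 h] at hu
    exact Subtype.ext hu.eq_zero
  map_one := by rw [degree_eq (φ := (1 : ratEnd W K)) isXRep_one, Nat.cast_one]
  map_mul φ ψ := by
    by_cases hψ : ψ = 0
    · rw [hψ, mul_zero, degree_zero, Nat.cast_zero, mul_zero]
    obtain ⟨u, hu⟩ := exists_isXRep_degree φ
    obtain ⟨v, hv⟩ := exists_isXRep_degree ψ
    rw [degree_eq (φ := φ * ψ) (hu.mul hv fun h => hψ (Subtype.ext h)), Nat.cast_mul]
  parallelogram φ ψ := by
    obtain ⟨u, hu⟩ := exists_isXRep_degree φ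
    obtain ⟨v, hv⟩ := exists_isXRep_degree ψ
    obtain ⟨u', hu'⟩ := exists_isXRep_degree (φ + ψ)
    obtain ⟨v', hv'⟩ := exists_isXRep_degree (φ - ψ)
    have := hu.parallelogram hv hu' hv'
    push_cast [← mul_add]
    exact_mod_cast this

end RationalEndomorphisms
end EllipticEnd

namespace EllipticEnd
open WeierstrassCurve Filter Polynomial
open scoped Polynomial.Bivariate

/-! ### Logarithmic derivatives -/

section Logarithm
variable {F K : Type*} [Field F] [Field K] [Algebra F K] {W : WeierstrassCurve.Affine F}
  (D : Derivation F K K)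

/-- The pullback of the invariant differential `dx / (2y + a₁x + a₃)` under the map given by the
point, evaluated on the vector field `D`, is `l`. -/
def IsLog : (extend W K).Point → K → Prop
  | 0, l => l = 0
  | .some f g _, l => D f = l * (2 * g + algebraMap F K W.a₁ * f + algebraMap F K W.a₃) ∧
      D g = l * (3 * f ^ 2 + 2 * algebraMap F K W.a₂ * f + algebraMap F K W.a₄ -
        algebraMap F K W.a₁ * g)

variable {D} {P Q : (extend W K).Point} {l m : K}

lemma isLog_zero : IsLog D (0 : (extend W K).Point) l ↔ l = 0 := Iff.rfl

lemma isLog_some {f g : K} {h : (extend W K).Nonsingular f g} : IsLog D (.some f g h) l ↔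
    D f = l * (2 * g + algebraMap F K W.a₁ * f + algebraMap F K W.a₃) ∧
      D g = l * (3 * f ^ 2 + 2 * algebraMap F K W.a₂ * f + algebraMap F K W.a₄ -
        algebraMap F K W.a₁ * g) := Iff.rfl

lemma partial_ne_zero {f g : K} (h : (extend W K).Nonsingular f g) :
    2 * g + algebraMap F K W.a₁ * f + algebraMap F K W.a₃ ≠ 0 ∨
      3 * f ^ 2 + 2 * algebraMap F K W.a₂ * f + algebraMap F K W.a₄ -
        algebraMap F K W.a₁ * g ≠ 0 := by
  have := ((Affine.nonsingular_iff ..).1 h).2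
  simp only [map_a₁, map_a₂, map_a₃, map_a₄] at this
  rcases this with h | h
  · exact Or.inr fun h0 => h (by linear_combination -h0)
  · exact Or.inl fun h0 => h (by linear_combination h0)

lemma IsLog.unique (hl : IsLog D P l) (hm : IsLog D P m) : l = m := by
  rcases P with _ | ⟨f, g, h⟩
  · exact (isLog_zero.1 hl).trans (isLog_zero.1 hm).symm
  · rcases partial_ne_zero h with h0 | h0
    · exact mul_right_cancel₀ h0 (hl.1.symm.trans hm.1)
    · exact mul_right_cancel₀ h0 (hl.2.symm.trans hm.2)

lemma derivation_equation {f g : K} (h : (extend W K).Equation f g) :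
    D g * (2 * g + algebraMap F K W.a₁ * f + algebraMap F K W.a₃) =
      D f * (3 * f ^ 2 + 2 * algebraMap F K W.a₂ * f + algebraMap F K W.a₄ -
        algebraMap F K W.a₁ * g) := by
  have h := congrArg D ((Affine.equation_iff ..).1 h)
  simp only [map_a₁, map_a₂, map_a₃, map_a₄, map_a₆, map_add, Derivation.leibniz,
    Derivation.leibniz_pow, Derivation.map_algebraMap, smul_eq_mul] at h
  simp only [nsmul_eq_mul] at h
  push_cast at h
  linear_combination h

lemma exists_isLog (D : Derivation F K K) (P : (extend W K).Point) : ∃ l, IsLog D P l := by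
  rcases P with _ | ⟨f, g, h⟩
  · exact ⟨0, rfl⟩
  · have he := derivation_equation (D := D) h.1
    rcases partial_ne_zero h with h0 | h0
    · refine ⟨_, (div_mul_cancel₀ (D f) h0).symm, ?_⟩
      rw [div_mul_eq_mul_div, ← he, mul_div_cancel_right₀ _ h0]
    · refine ⟨_, ?_, (div_mul_cancel₀ (D g) h0).symm⟩
      rw [div_mul_eq_mul_div, he, mul_div_cancel_right₀ _ h0]

lemma IsLog.neg (hl : IsLog D P l) : IsLog D (-P) (-l) := by
  rcases P with _ | ⟨f, g, h⟩
  · exact isLog_zero.2 (by rw [isLog_zero.1 hl, neg_zero])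
  · obtain ⟨h1, h2⟩ := hl
    refine isLog_some.2 ⟨?_, ?_⟩
    · rw [h1, Affine.negY]
      simp only [map_a₁, map_a₃]
      ring
    · rw [Affine.negY]
      simp only [map_a₁, map_a₃, map_sub, map_neg, Derivation.leibniz, Derivation.map_algebraMap,
        smul_eq_mul, h1, h2]
      ring

/-- The logarithm of the third point on a line. -/
lemma log_third {a₁ a₂ a₃ a₄ x₁ x₂ y₁ y₂ ℓ l m x₃ n : K} (h₁ : D a₁ = 0) (h₂ : D a₂ = 0)
    (hy : y₂ = y₁ + ℓ * (x₂ - x₁)) (hx₃ : x₃ = ℓ ^ 2 + a₁ * ℓ - a₂ - x₁ - x₂)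
    (hn : n = ℓ * (x₃ - x₁) + y₁)
    (hE : x₁ * x₂ + x₁ * x₃ + x₂ * x₃ =
      a₄ - 2 * ℓ * (y₁ - ℓ * x₁) - a₁ * (y₁ - ℓ * x₁) - a₃ * ℓ)
    (hx₁ : D x₁ = l * (2 * y₁ + a₁ * x₁ + a₃))
    (hy₁ : D y₁ = l * (3 * x₁ ^ 2 + 2 * a₂ * x₁ + a₄ - a₁ * y₁))
    (hx₂ : D x₂ = m * (2 * y₂ + a₁ * x₂ + a₃))
    (hℓ : D ℓ = l * (x₁ - x₃) + m * (x₂ - x₃)) :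
    D x₃ = -(l + m) * (2 * n + a₁ * x₃ + a₃) ∧
      D n = -(l + m) * (3 * x₃ ^ 2 + 2 * a₂ * x₃ + a₄ - a₁ * n) := by
  have hDx : D x₃ = (2 * ℓ + a₁) * D ℓ - D x₁ - D x₂ := by
    rw [hx₃]
    simp only [map_sub, map_add, Derivation.leibniz, Derivation.leibniz_pow, smul_eq_mul, h₁, h₂,
      nsmul_eq_mul]
    push_cast
    ring
  have hDx' : D x₃ = -(l + m) * (2 * n + a₁ * x₃ + a₃) := by
    rw [hDx, hℓ, hx₁, hx₂, hy, hn]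
    ring
  refine ⟨hDx', ?_⟩
  have hDn : D n = D ℓ * (x₃ - x₁) + ℓ * (D x₃ - D x₁) + D y₁ := by
    rw [hn]
    simp only [map_sub, map_add, Derivation.leibniz, smul_eq_mul]
    ring
  have k1 : 3 * x₁ ^ 2 + 2 * a₂ * x₁ + a₄ - a₁ * y₁ - ℓ * (2 * y₁ + a₁ * x₁ + a₃) =
      (x₁ - x₂) * (x₁ - x₃) := by
    linear_combination -hE + (2 * x₁) * hx₃
  have k3 : 3 * x₃ ^ 2 + 2 * a₂ * x₃ + a₄ - a₁ * n - ℓ * (2 * n + a₁ * x₃ + a₃) =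
      (x₃ - x₁) * (x₃ - x₂) := by
    rw [hn]
    linear_combination -hE + (2 * x₃) * hx₃
  rw [hDn, hDx', hℓ, hx₁, hy₁]
  linear_combination l * k1 + (l + m) * k3

lemma IsLog.add [DecidableEq K] (hl : IsLog D P l) (hm : IsLog D Q m) :
    IsLog D (P + Q) (l + m) := by
  rcases P with _ | ⟨x₁, y₁, hP⟩
  · rw [← Affine.Point.zero_def] at hl ⊢
    rwa [isLog_zero.1 hl, zero_add, zero_add]
  rcases Q with _ | ⟨x₂, y₂, hQ⟩
  · rw [← Affine.Point.zero_def] at hm ⊢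
    rwa [isLog_zero.1 hm, add_zero, add_zero]
  by_cases hxy : x₁ = x₂ ∧ y₁ = (extend W K).negY x₂ y₂
  · have e : Affine.Point.some x₁ y₁ hP = -Affine.Point.some x₂ y₂ hQ := by
      rw [Affine.Point.neg_some, Affine.Point.some.injEq]
      exact hxy
    rw [e] at hl ⊢
    rw [hl.unique hm.neg, neg_add_cancel, neg_add_cancel]
    rfl
  rw [Affine.Point.add_some hxy]
  obtain ⟨hx₁, hy₁⟩ := isLog_some.1 hl
  obtain ⟨hx₂, hy₂⟩ := isLog_some.1 hm
  have e₁ := (Affine.equation_iff ..).1 hP.1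
  have e₂ := (Affine.equation_iff ..).1 hQ.1
  simp only [map_a₁, map_a₂, map_a₃, map_a₄, map_a₆] at e₁ e₂
  have hc (c : F) : D (algebraMap F K c) = 0 := D.map_algebraMap c
  set ℓ := (extend W K).slope x₁ x₂ y₁ y₂ with hℓ_def
  have key : IsLog D (.some _ _ (Affine.nonsingular_negAdd hP hQ hxy)) (-(l + m)) := by
    have hx₃ : (extend W K).addX x₁ x₂ ℓ =
        ℓ ^ 2 + algebraMap F K W.a₁ * ℓ - algebraMap F K W.a₂ - x₁ - x₂ := rfl
    by_cases hx : x₁ = x₂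
    · have hy : y₁ = y₂ := Affine.Y_eq_of_Y_ne hP.1 hQ.1 hx fun h => hxy ⟨hx, h⟩
      subst hx hy
      obtain rfl := hl.unique hm
      have hψ : 2 * y₁ + algebraMap F K W.a₁ * x₁ + algebraMap F K W.a₃ ≠ 0 := by
        intro h0
        refine hxy ⟨rfl, ?_⟩
        rw [Affine.negY]
        simp only [map_a₁, map_a₃]
        linear_combination h0
      have hs : ℓ * (2 * y₁ + algebraMap F K W.a₁ * x₁ + algebraMap F K W.a₃) =
          3 * x₁ ^ 2 + 2 * algebraMap F K W.a₂ * x₁ + algebraMap F K W.a₄ -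
            algebraMap F K W.a₁ * y₁ := by
        rw [hℓ_def, Affine.slope_of_Y_ne rfl fun h => hxy ⟨rfl, h⟩, Affine.negY]
        simp only [map_a₁, map_a₂, map_a₃, map_a₄]
        rw [show y₁ - (-y₁ - algebraMap F K W.a₁ * x₁ - algebraMap F K W.a₃) =
          2 * y₁ + algebraMap F K W.a₁ * x₁ + algebraMap F K W.a₃ by ring, div_mul_cancel₀ _ hψ]
      refine log_third (hc _) (hc _) (y₂ := y₁) (by ring) hx₃ rfl ?_ hx₁ hy₁ hx₂ ?_
      · rw [hx₃]
        linear_combination hs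
      · have hD := congrArg D hs
        simp only [map_sub, map_add, Derivation.leibniz, Derivation.leibniz_pow, smul_eq_mul, hc,
          nsmul_eq_mul, hx₁, hy₁] at hD
        simp only [← Nat.cast_ofNat (R := K), Derivation.map_natCast] at hD
        push_cast at hD
        apply mul_right_cancel₀ hψ
        rw [hx₃]
        linear_combination hD + l * (2 * ℓ + algebraMap F K W.a₁) * hs
    · have hs : ℓ * (x₁ - x₂) = y₁ - y₂ := by
        rw [hℓ_def, Affine.slope_of_X_ne hx, div_mul_cancel₀ _ (sub_ne_zero.2 hx)]
      have hy₂' : y₂ = y₁ + ℓ * (x₂ - x₁) := by linear_combination hs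
      have hE : x₁ * x₂ + x₁ * (extend W K).addX x₁ x₂ ℓ + x₂ * (extend W K).addX x₁ x₂ ℓ =
          algebraMap F K W.a₄ - 2 * ℓ * (y₁ - ℓ * x₁) - algebraMap F K W.a₁ * (y₁ - ℓ * x₁) -
            algebraMap F K W.a₃ * ℓ := by
        rw [hx₃]
        rw [hy₂'] at e₂
        apply mul_right_cancel₀ (sub_ne_zero.2 hx)
        linear_combination e₁ - e₂
      refine log_third (hc _) (hc _) (y₂ := y₂) hy₂' hx₃ rfl hE hx₁ hy₁ hx₂ ?_
      have hD := congrArg D hs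
      simp only [map_sub, Derivation.leibniz, smul_eq_mul, hx₁, hx₂, hy₁, hy₂] at hD
      apply mul_right_cancel₀ (sub_ne_zero.2 hx)
      have k1 : 3 * x₁ ^ 2 + 2 * algebraMap F K W.a₂ * x₁ + algebraMap F K W.a₄ -
          algebraMap F K W.a₁ * y₁ - ℓ * (2 * y₁ + algebraMap F K W.a₁ * x₁ + algebraMap F K W.a₃) =
            (x₁ - x₂) * (x₁ - (extend W K).addX x₁ x₂ ℓ) := by
        linear_combination -hE + (2 * x₁) * hx₃
      have k2 : 3 * x₂ ^ 2 + 2 * algebraMap F K W.a₂ * x₂ + algebraMap F K W.a₄ -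
          algebraMap F K W.a₁ * y₂ - ℓ * (2 * y₂ + algebraMap F K W.a₁ * x₂ + algebraMap F K W.a₃) =
            (x₂ - x₁) * (x₂ - (extend W K).addX x₁ x₂ ℓ) := by
        rw [hy₂']
        linear_combination -hE + (2 * x₂) * hx₃
      linear_combination hD + l * k1 - m * k2
  have := key.neg
  rw [neg_neg] at this
  exact this

end Logarithm
end EllipticEnd

namespace EllipticEnd
open WeierstrassCurve Filter Polynomial
open scoped Polynomial.Bivariate

/-! ### The invariant vector field -/

section VectorField
variable {F : Type*} [Field F] {W : WeierstrassCurve.Affine F} {K : Type*} [Field K]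
  [Algebra W.CoordinateRing K] [Algebra F K] [IsScalarTower F W.CoordinateRing K]
  [IsFractionRing W.CoordinateRing K]

/-- The function field is generated by the coordinates of the generic point. -/
lemma mem_of_gen_mem {S : IntermediateField F K} (hx : genX W K ∈ S) (hy : genY W K ∈ S) (u : K) :
    u ∈ S := by
  have haeval (p : F[X]) : aeval (genX W K) p ∈ S := by
    rw [aeval_eq_sum_range]
    exact sum_mem fun i _ => S.smul_mem (pow_mem hx i)
  have hreg (a : W.CoordinateRing) : algebraMap W.CoordinateRing K a ∈ S := by
    obtain ⟨p, q, rfl⟩ := Affine.CoordinateRing.exists_smul_basis_eq a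
    rw [Affine.CoordinateRing.smul, Affine.CoordinateRing.smul, mul_one, map_add, map_mul,
      algebraMap_mk_C, algebraMap_mk_C]
    exact S.add_mem (haeval p) (S.mul_mem (haeval q) hy)
  obtain ⟨a, b, -, rfl⟩ := IsFractionRing.div_surjective (A := W.CoordinateRing) u
  exact S.div_mem (hreg a) (hreg b)

lemma exists_derivation_of_section {F K : Type*} [Field F] [Field K] [Algebra F K]
    {δ : K →+* TrivSqZeroExt K K} (hδ : ∀ u, (δ u).fst = u)
    (hδF : ∀ c : F, δ (algebraMap F K c) = algebraMap F _ c) :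
    ∃ D : Derivation F K K, ∀ u, D u = (δ u).snd := by
  refine ⟨Derivation.mk'
    { toFun := fun u => (δ u).snd
      map_add' := fun u v => by rw [map_add, TrivSqZeroExt.snd_add]
      map_smul' := fun c u => by
        rw [Algebra.smul_def, map_mul, hδF, TrivSqZeroExt.snd_mul, hδ, RingHom.id_apply]
        simp [TrivSqZeroExt.algebraMap_eq_inl', Algebra.smul_def] }
    fun u v => ?_, fun u => rfl⟩
  change (δ (u * v)).snd = u • (δ v).snd + v • (δ u).snd
  rw [map_mul, TrivSqZeroExt.snd_mul, hδ, hδ, op_smul_eq_smul]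

variable (W K) in
lemma exists_derivation : ∃ D : Derivation F K K,
    D (genX W K) = 2 * genY W K + algebraMap F K W.a₁ * genX W K + algebraMap F K W.a₃ ∧
    D (genY W K) = 3 * genX W K ^ 2 + 2 * algebraMap F K W.a₂ * genX W K + algebraMap F K W.a₄ -
      algebraMap F K W.a₁ * genY W K := by
  set x := genX W K
  set y := genY W K
  set ψ := 2 * y + algebraMap F K W.a₁ * x + algebraMap F K W.a₃
  set χ := 3 * x ^ 2 + 2 * algebraMap F K W.a₂ * x + algebraMap F K W.a₄ - algebraMap F K W.a₁ * y
  have he := (Affine.equation_iff ..).1 (equation_gen W K)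
  simp only [map_a₁, map_a₂, map_a₃, map_a₄, map_a₆] at he
  let x' : TrivSqZeroExt K K := TrivSqZeroExt.inl x + TrivSqZeroExt.inr ψ
  let y' : TrivSqZeroExt K K := TrivSqZeroExt.inl y + TrivSqZeroExt.inr χ
  let r : W.CoordinateRing →+* TrivSqZeroExt K K :=
    AdjoinRoot.lift (aeval (R := F) x').toRingHom y' (by
      simp only [Affine.polynomial, eval₂_sub, eval₂_add, eval₂_mul, eval₂_pow, eval₂_X, eval₂_C]
      simp
      ext
      · simp [x', y', TrivSqZeroExt.algebraMap_eq_inl']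
        linear_combination he
      · simp [x', y', TrivSqZeroExt.algebraMap_eq_inl']
        ring)
  have hrC (p : F[X]) : r (Affine.CoordinateRing.mk W (C p)) = aeval x' p := AdjoinRoot.lift_of _
  have hrY : r (Affine.CoordinateRing.mk W Y) = y' := AdjoinRoot.lift_root _
  have hfst : (TrivSqZeroExt.fstHom F K K).toRingHom.comp r = algebraMap W.CoordinateRing K := by
    refine AdjoinRoot.ringHom_ext (Polynomial.ringHom_ext (fun c => ?_) ?_) ?_
    · change (r (Affine.CoordinateRing.mk W (C (C c)))).fst =
        algebraMap W.CoordinateRing K (Affine.CoordinateRing.mk W (C (C c)))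
      rw [hrC, algebraMap_mk_C, aeval_C, aeval_C]
      rfl
    · change (r (Affine.CoordinateRing.mk W (C X))).fst =
        algebraMap W.CoordinateRing K (Affine.CoordinateRing.mk W (C X))
      rw [hrC, algebraMap_mk_C, aeval_X, aeval_X]
      simp [x', x]
    · change (r (Affine.CoordinateRing.mk W Y)).fst =
        algebraMap W.CoordinateRing K (Affine.CoordinateRing.mk W Y)
      rw [hrY]
      simp [y', y, genY]
  let δ : K →+* TrivSqZeroExt K K :=
    IsLocalization.lift (M := nonZeroDivisors W.CoordinateRing) (g := r) fun u => by
      rw [TrivSqZeroExt.isUnit_iff_isUnit_fst, isUnit_iff_ne_zero,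
        show (r u).fst = algebraMap W.CoordinateRing K u from congrArg (fun t => t u.1) hfst,
        ne_eq, IsFractionRing.to_map_eq_zero_iff]
      exact nonZeroDivisors.ne_zero u.2
  have hδ (u : W.CoordinateRing) : δ (algebraMap _ K u) = r u := IsLocalization.lift_eq _ u
  have hδF (c : F) : δ (algebraMap F K c) = algebraMap F _ c := by
    refine (congrArg δ (IsScalarTower.algebraMap_apply F W.CoordinateRing K c)).trans
      ((hδ _).trans ?_)
    exact (hrC (C c)).trans (aeval_C ..)
  have hδ1 : (TrivSqZeroExt.fstHom F K K).toRingHom.comp δ = RingHom.id K := by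
    apply IsLocalization.ringHom_ext (nonZeroDivisors W.CoordinateRing)
    refine RingHom.ext fun u => ?_
    change (δ (algebraMap _ K u)).fst = algebraMap _ K u
    rw [hδ]
    exact congrArg (fun t => t u) hfst
  have hδ1' (u : K) : (δ u).fst = u := congrArg (fun t => t u) hδ1
  obtain ⟨D, hD⟩ := exists_derivation_of_section hδ1' hδF
  refine ⟨D, ?_, ?_⟩
  · rw [hD]
    have : δ x = x' := (hδ _).trans ((hrC X).trans (aeval_X _))
    rw [this]
    simp [x', ψ]
  · rw [hD]
    have : δ y = y' := (hδ _).trans hrY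
    rw [this]
    simp [y', χ]

variable (W K) in
/-- The invariant vector field on the curve. -/
noncomputable def invDer : Derivation F K K := (exists_derivation W K).choose

lemma isLog_genPoint [W.IsElliptic] : IsLog (invDer W K) (genPoint W K) 1 := by
  obtain ⟨h1, h2⟩ := (exists_derivation W K).choose_spec
  exact isLog_some.2 ⟨by rw [one_mul]; exact h1, by rw [one_mul]; exact h2⟩

lemma invDer_genX : invDer W K (genX W K) =
    2 * genY W K + algebraMap F K W.a₁ * genX W K + algebraMap F K W.a₃ :=
  (exists_derivation W K).choose_spec.1

lemma invDer_genX_ne_zero [W.IsElliptic] : invDer W K (genX W K) ≠ 0 := by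
  rw [invDer_genX]
  intro h
  have e : algebraMap W.CoordinateRing K
      (Affine.CoordinateRing.mk W (2 * Y + C (C W.a₁ * X + C W.a₃))) =
        2 * genY W K + algebraMap F K W.a₁ * genX W K + algebraMap F K W.a₃ := by
    rw [map_add, map_add, algebraMap_mk_C, map_mul, map_mul, map_ofNat, map_ofNat]
    simp [genY, add_assoc]
  rw [← e, IsFractionRing.to_map_eq_zero_iff] at h
  exact one_ne_zero (two_Y_ne_zero (W := W) (q := 1) (by rw [one_smul, h]))

/-- The chain rule. -/
lemma invDer_map (s : K →ₐ[F] K) {l : K}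
    {h : (extend W K).Nonsingular (s (genX W K)) (s (genY W K))}
    (hl : IsLog (invDer W K) (.some _ _ h) l) (u : K) :
    invDer W K (s u) = l * s (invDer W K u) := by
  let S : IntermediateField F K :=
    { carrier := {u | invDer W K (s u) = l * s (invDer W K u)}
      mul_mem' := fun {u v} hu hv => by
        simp only [Set.mem_ofPred_eq] at *
        simp only [map_mul, map_add, Derivation.leibniz, smul_eq_mul, hu, hv]
        ring
      add_mem' := fun {u v} hu hv => by
        simp only [Set.mem_ofPred_eq] at *
        simp only [map_add, hu, hv]
        ring
      algebraMap_mem' := fun c => by simp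
      inv_mem' := fun u hu => by
        simp only [Set.mem_ofPred_eq] at *
        simp only [map_inv₀, Derivation.leibniz_inv, hu, smul_eq_mul, map_mul, map_neg, map_pow]
        ring }
  obtain ⟨h1, h2⟩ := isLog_some.1 hl
  obtain ⟨k1, k2⟩ := (exists_derivation W K).choose_spec
  refine mem_of_gen_mem (W := W) (S := S) ?_ ?_ u
  · change invDer W K (s _) = l * s (invDer W K _)
    rw [h1, show invDer W K (genX W K) = _ from k1]
    simp only [map_add, map_mul, map_ofNat, AlgHom.commutes]
  · change invDer W K (s _) = l * s (invDer W K _)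
    rw [h2, show invDer W K (genY W K) = _ from k2]
    simp only [map_add, map_sub, map_mul, map_ofNat, map_pow, AlgHom.commutes]

lemma IsLog.map {s : K →ₐ[F] K} {l m : K}
    {h : (extend W K).Nonsingular (s (genX W K)) (s (genY W K))}
    (hl : IsLog (invDer W K) (.some _ _ h) l) {f g : K} {h' : (extend W K).Nonsingular f g}
    (hm : IsLog (invDer W K) (.some f g h') m) {h'' : (extend W K).Nonsingular (s f) (s g)} :
    IsLog (invDer W K) (.some (s f) (s g) h'') (s m * l) := by
  obtain ⟨h1, h2⟩ := isLog_some.1 hm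
  refine isLog_some.2 ⟨?_, ?_⟩
  · rw [invDer_map s hl, h1]
    simp only [map_add, map_mul, map_ofNat, AlgHom.commutes]
    ring
  · rw [invDer_map s hl, h2]
    simp only [map_add, map_sub, map_mul, map_ofNat, map_pow, AlgHom.commutes]
    ring

lemma derivative_eq_zero_of_dvd {A : F[X]} (h : A ∣ derivative A) : derivative A = 0 := by
  by_contra h0
  have hA : A.natDegree ≠ 0 := fun hd => h0 (derivative_of_natDegree_zero hd)
  exact absurd (natDegree_le_of_dvd h h0) (not_le.2 (natDegree_derivative_lt hA))

/-- A rational function of the abscissa with derivative zero. -/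
lemma derivative_eq_zero_of_invDer [IsAlgClosed F] [W.IsElliptic] {f : K} {A B : F[X]}
    (hAB : IsCoprime A B) (hf : f * aeval (genX W K) B = aeval (genX W K) A)
    (h0 : invDer W K f = 0) : derivative A = 0 ∧ derivative B = 0 := by
  have h1 := congrArg (invDer W K) hf
  rw [Derivation.leibniz, h0, smul_zero, add_zero, Derivation.map_aeval, Derivation.map_aeval,
    smul_eq_mul, smul_eq_mul, smul_eq_mul, ← mul_assoc] at h1
  have h2 := mul_right_cancel₀ invDer_genX_ne_zero h1
  have h3 : A * derivative B = derivative A * B := by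
    apply aeval_genX_injective W K
    rw [map_mul, map_mul, ← h2, ← hf]
    ring
  exact ⟨derivative_eq_zero_of_dvd (hAB.dvd_of_dvd_mul_right ⟨_, h3.symm⟩),
    derivative_eq_zero_of_dvd (hAB.symm.dvd_of_dvd_mul_left ⟨_, h3.trans (mul_comm _ _)⟩)⟩

end VectorField
end EllipticEnd

namespace EllipticEnd
open WeierstrassCurve Filter Polynomial
open scoped Polynomial.Bivariate

/-! ### Logarithmic derivatives of endomorphisms -/

/-- A tower of division points. -/
lemma exists_division_tower {G : Type*} [AddCommGroup G] {n : ℕ}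
    (hn : Function.Surjective fun P : G => n • P) {P : G} (hP : P ≠ 0) (hP' : n • P = 0) :
    ∃ T : ℕ → G, Function.Injective T ∧ T 0 = P ∧ ∀ k, n • T (k + 1) = T k := by
  choose g hg' using hn
  have hg (Q : G) : n • g Q = Q := hg' Q
  refine ⟨fun k => g^[k] P, ?_, rfl, fun k => ?_⟩
  · have h1 (k : ℕ) : n ^ k • g^[k] P = P := by
      induction k with
      | zero => simp
      | succ k ih => rw [pow_succ, mul_smul, Function.iterate_succ_apply', hg, ih]
    have h2 {i j : ℕ} (hij : i < j) : n ^ j • g^[i] P = 0 := by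
      obtain ⟨m, rfl⟩ := Nat.exists_eq_add_of_lt hij
      rw [show i + m + 1 = m + 1 + i by ring, pow_add, mul_smul, h1, pow_succ, mul_smul, hP',
        smul_zero]
    intro i j hij
    simp only at hij
    rcases lt_trichotomy i j with h | h | h
    · exact absurd ((h1 j).symm.trans (hij ▸ h2 h)) hP
    · exact h
    · exact absurd ((h1 i).symm.trans (hij ▸ h2 h)) hP
  · simp only
    rw [Function.iterate_succ_apply', hg]

lemma eq_or_eq_neg_of_xc_eq {F : Type*} [Field F] {W : WeierstrassCurve.Affine F} {P Q : W.Point} (hP : P ≠ 0)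
    (hQ : Q ≠ 0) (h : xc P = xc Q) :
    P = Q ∨ P = -Q := by
  rcases P with _ | ⟨x, y, h₁⟩
  · exact absurd rfl hP
  rcases Q with _ | ⟨x', y', h₂⟩
  · exact absurd rfl hQ
  exact Affine.Point.X_eq_iff.1 h

/-- A polynomial with derivative zero of degree at most `p ^ 2` has at most `p` roots. -/
lemma card_le_of_derivative_eq_zero {F : Type*} [Field F] {p : ℕ} [hp : Fact p.Prime] [CharP F p]
    {G : F[X]} (hG : G ≠ 0) (hG' : derivative G = 0) (hd : G.natDegree ≤ p ^ 2) {s : Finset F}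
    (hs : ∀ x ∈ s, G.eval x = 0) : s.card ≤ p := by
  classical
  have he := expand_contract p hG' hp.out.ne_zero
  have h0 : contract p G ≠ 0 := fun h => hG (by rw [← he, h, map_zero])
  have hd' : (contract p G).natDegree ≤ p := by
    have := natDegree_expand p (contract p G)
    rw [he] at this
    rw [this, sq] at hd
    exact Nat.le_of_mul_le_mul_right hd hp.out.pos
  rw [← Finset.card_image_of_injective s (frobenius_inj F p)]
  refine (Finset.card_le_card (t := (contract p G).roots.toFinset) ?_).trans
    ((Multiset.toFinset_card_le _).trans ((card_roots' _).trans hd'))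
  intro y hy
  obtain ⟨x, hx, rfl⟩ := Finset.mem_image.1 hy
  have := hs x hx
  rw [← he, expand_eval] at this
  simpa [h0, frobenius_def] using this

section EndomorphismLog
variable {F : Type*} [Field F] [DecidableEq F] [IsAlgClosed F] {W : WeierstrassCurve.Affine F}
  [W.IsElliptic] {K : Type*} [Field K] [Algebra W.CoordinateRing K] [Algebra F K]
  [IsScalarTower F W.CoordinateRing K] [IsFractionRing W.CoordinateRing K]

variable (K) in
/-- The endomorphism `φ` multiplies the invariant differential by `l`. -/
def HasLog (φ : AddMonoid.End W.Point) (l : K) : Prop :=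
  ∃ P, Specializes (germ W K) φ P ∧ IsLog (invDer W K) P l

variable {φ ψ : AddMonoid.End W.Point} {l m : K}

lemma HasLog.unique (hl : HasLog K φ l) (hm : HasLog K φ m) : l = m := by
  obtain ⟨P, h1, h2⟩ := hl
  obtain ⟨Q, h3, h4⟩ := hm
  obtain rfl := h1.unique h3
  exact h2.unique h4

lemma exists_hasLog (hφ : φ ∈ ratEnd W K) : ∃ l, HasLog K φ l := by
  obtain ⟨P, hP⟩ := hφ
  obtain ⟨l, hl⟩ := exists_isLog (invDer W K) P
  exact ⟨l, P, hP, hl⟩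

lemma hasLog_zero : HasLog K (0 : AddMonoid.End W.Point) 0 :=
  ⟨0, specializes_zero.2 (Eventually.of_forall fun _ => rfl), rfl⟩

lemma hasLog_one : HasLog K (1 : AddMonoid.End W.Point) 1 :=
  ⟨_, specializes_genPoint W K, isLog_genPoint⟩

lemma HasLog.add (hl : HasLog K φ l) (hm : HasLog K ψ m) : HasLog K (φ + ψ) (l + m) := by
  classical
  obtain ⟨P, h1, h2⟩ := hl
  obtain ⟨Q, h3, h4⟩ := hm
  exact ⟨P + Q, h1.add (germ_const W K) h3, h2.add h4⟩

lemma HasLog.neg (hl : HasLog K φ l) : HasLog K (-φ) (-l) := by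
  obtain ⟨P, h1, h2⟩ := hl
  exact ⟨-P, h1.neg (germ_const W K), h2.neg⟩

lemma HasLog.sub (hl : HasLog K φ l) (hm : HasLog K ψ m) : HasLog K (φ - ψ) (l - m) := by
  rw [sub_eq_add_neg, sub_eq_add_neg]
  exact hl.add hm.neg

lemma hasLog_natCast (n : ℕ) : HasLog K (n : AddMonoid.End W.Point) (n : K) := by
  induction n with
  | zero => rw [Nat.cast_zero, Nat.cast_zero]; exact hasLog_zero
  | succ n ih => rw [Nat.cast_succ, Nat.cast_succ]; exact ih.add hasLog_one

lemma tendsto_of_mem_ratEnd (hφ : φ ∈ ratEnd W K) (h0 : φ ≠ 0) : Tendsto φ cofinite cofinite := by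
  obtain ⟨u, d, h⟩ := exists_isXRep (⟨φ, hφ⟩ : ratEnd W K)
  exact h.tendsto h0

lemma HasLog.mem (hl : HasLog K φ l) : φ ∈ ratEnd W K := ⟨_, hl.choose_spec.1⟩

lemma HasLog.mul (hl : HasLog K φ l) (hm : HasLog K ψ m) (hψ : ψ ≠ 0) :
    ∃ s : K →ₐ[F] K, (∀ (c : K) (a : W.Point → F),
      germ W K c = (a : (cofinite : Filter W.Point).Germ F) →
        germ W K (s c) = ((a ∘ ψ : W.Point → F) : (cofinite : Filter W.Point).Germ F)) ∧
      HasLog K (φ * ψ) (s l * m) := by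
  have ht := tendsto_of_mem_ratEnd hm.mem hψ
  obtain ⟨Q, h3, h4⟩ := hm
  rcases Q with _ | ⟨f', g', h'⟩
  · exact absurd (eq_zero_of_specializes_zero h3) hψ
  obtain ⟨s, rfl, rfl, hs⟩ := exists_pullback h3 ht
  refine ⟨s, hs, ?_⟩
  obtain ⟨P, h1, h2⟩ := hl
  rcases P with _ | ⟨f, g, h⟩
  · rw [eq_zero_of_specializes_zero h1, isLog_zero.1 h2, map_zero, zero_mul, zero_mul]
    exact hasLog_zero
  · obtain ⟨h'', h5⟩ := h1.comp ht hs
    exact ⟨_, h5, h4.map h2⟩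

lemma HasLog.algebraMap_mul {c : F} (hl : HasLog K φ (algebraMap F K c)) (hm : HasLog K ψ m) :
    HasLog K (φ * ψ) (algebraMap F K c * m) := by
  by_cases hψ : ψ = 0
  · subst hψ
    rw [hm.unique hasLog_zero, mul_zero, mul_zero]
    exact hasLog_zero
  · obtain ⟨s, -, h⟩ := hl.mul hm hψ
    rwa [AlgHom.commutes] at h

lemma HasLog.exists_isXRep (hφ : HasLog K φ 0) (h0 : φ ≠ 0) :
    ∃ (u : Fin 2 → F[X]) (d : ℕ), IsXRep φ u d ∧ ∀ i, derivative (u i) = 0 := by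
  obtain ⟨P, h1, h2⟩ := hφ
  rcases P with _ | ⟨f, g, h⟩
  · exact absurd (eq_zero_of_specializes_zero h1) h0
  obtain ⟨A, B, hAB, -, hf, hx⟩ := exists_isXRep_of_specializes h1
  refine ⟨_, _, hx, ?_⟩
  have := derivative_eq_zero_of_invDer hAB hf ((isLog_some.1 h2).1.trans (zero_mul _))
  intro i
  fin_cases i
  · exact this.1
  · exact this.2

variable (W) in
lemma natCast_ne_zero {n : ℕ} (hn : n ≠ 0) : (n : AddMonoid.End W.Point) ≠ 0 := fun h =>
  (isCompositionNorm_degree (W := W) (K := W.FunctionField)).natCast_ne_zero hn (Subtype.ext h)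

variable (W) in
lemma surjective_nsmul {n : ℕ} (hn : n ≠ 0) : Function.Surjective fun P : W.Point => n • P := by
  obtain ⟨u, d, h⟩ := EllipticEnd.exists_isXRep (n : ratEnd W W.FunctionField)
  exact h.surjective (natCast_ne_zero W hn)

lemma eq_zero_of_infinite_kernel (hφ : φ ∈ ratEnd W K) {T : ℕ → W.Point} (hT : Function.Injective T)
    (h : ∀ n, φ (T n) = 0) : φ = 0 := by
  by_contra h0
  obtain ⟨n, hn⟩ := (hT.tendsto_cofinite.eventually
    ((tendsto_of_mem_ratEnd hφ h0).eventually eventually_ne_zero)).exists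
  exact hn (h n)

section CharZero
variable [CharZero F]

variable (W) in
lemma exists_two_torsion : ∃ P : W.Point, P ≠ 0 ∧ 2 • P = 0 := by
  obtain ⟨x, hx⟩ := IsAlgClosed.exists_root (C 4 * X ^ 3 + C W.b₂ * X ^ 2 + C (2 * W.b₄) * X + C W.b₆)
    (by
      have h4 : (4 : F) ≠ 0 := by norm_num
      have : (C 4 * X ^ 3 + C W.b₂ * X ^ 2 + C (2 * W.b₄) * X + C W.b₆ : F[X]).degree = 3 := by
        compute_degree!
      rw [this]; decide)
  simp only [IsRoot.def, eval_add, eval_mul, eval_pow, eval_X, eval_C, b₂, b₄, b₆] at hx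
  have h2 : (2 : F) ≠ 0 := two_ne_zero
  have he : W.Equation x (-(W.a₁ * x + W.a₃) / 2) := by
    rw [Affine.equation_iff]
    field_simp
    linear_combination -hx
  refine ⟨.mk he, Affine.Point.some_ne_zero _, ?_⟩
  rw [two_nsmul]
  refine Affine.Point.add_self_of_Y_eq ?_
  rw [Affine.negY]
  field_simp
  ring

lemma eq_algebraMap_of_invariant {u : K} {a : W.Point → F}
    (hu : germ W K u = (a : (cofinite : Filter W.Point).Germ F))
    (ha : ∀ᶠ Q in cofinite, a (2 • Q) = a Q) : ∃ c : F, u = algebraMap F K c := by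
  obtain ⟨P, hP, hP'⟩ := exists_two_torsion W
  obtain ⟨T, hT, -, hT'⟩ := exists_division_tower (surjective_nsmul W two_ne_zero) hP hP'
  have h1 := hT.tendsto_cofinite.eventually ha
  rw [Nat.cofinite_eq_atTop, eventually_atTop] at h1
  obtain ⟨N, hN⟩ := h1
  have h2 (n : ℕ) : a (T (N + n)) = a (T N) := by
    induction n with
    | zero => rfl
    | succ n ih => rw [← ih, ← hN (N + (n + 1)) (by omega), ← add_assoc, hT']
  refine ⟨a (T N), ?_⟩
  by_contra hne
  have h3 := hT.tendsto_cofinite.eventually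
    (eventually_ne_of_germ_of_ne (germ W K) hu (germ_const W K _) hne)
  rw [Nat.cofinite_eq_atTop, eventually_atTop] at h3
  obtain ⟨M, hM⟩ := h3
  exact hM (N + M) (by omega) (h2 M)

lemma HasLog.exists_eq_algebraMap (hl : HasLog K φ l) : ∃ c : F, l = algebraMap F K c := by
  have : CharZero K := charZero_of_injective_algebraMap (algebraMap F K).injective
  obtain ⟨a, ha⟩ := exists_germ_rep (germ W K l)
  obtain ⟨s, hs, h⟩ := hl.mul (hasLog_natCast 2) (natCast_ne_zero W two_ne_zero)
  have h2 : HasLog K (φ * ((2 : ℕ) : AddMonoid.End W.Point)) (l + l) := by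
    rw [← Nat.cast_comm, Nat.cast_two, two_mul]
    exact hl.add hl
  have h3 : s l = l := by
    have := h2.unique h
    push_cast at this
    apply mul_right_cancel₀ (two_ne_zero' K)
    rw [← this]; ring
  refine eq_algebraMap_of_invariant ha ?_
  have h4 := hs l a ha
  rw [h3, ha] at h4
  filter_upwards [Germ.coe_eq.1 h4] with Q hQ
  rw [hQ]
  rfl

theorem ratEnd_mul_comm_of_charZero (hφ : φ ∈ ratEnd W K) (hψ : ψ ∈ ratEnd W K) :
    φ * ψ = ψ * φ := by
  obtain ⟨l, hl⟩ := exists_hasLog hφ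
  obtain ⟨m, hm⟩ := exists_hasLog hψ
  obtain ⟨c, rfl⟩ := hl.exists_eq_algebraMap
  obtain ⟨d, rfl⟩ := hm.exists_eq_algebraMap
  have h := (hl.algebraMap_mul hm).sub (hm.algebraMap_mul hl)
  rw [mul_comm (algebraMap F K c), sub_self] at h
  by_contra hne
  obtain ⟨u, d, hu, hu'⟩ := h.exists_isXRep (sub_ne_zero.2 hne)
  have hd : d = 0 := by
    by_contra hd
    refine hu.isMorphism.coeff_ne (_root_.funext fun i => ?_)
    rw [eq_C_of_natDegree_eq_zero (derivative_eq_zero.1 (hu' i)),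
      coeff_C_of_ne_zero hd]
    rfl
  subst hd
  exact sub_ne_zero.2 hne hu.eq_zero

end CharZero

section CharP

variable {p : ℕ} [hp : Fact p.Prime] [CharP F p]

variable (W) in
lemma finite_torsion {n : ℕ} (hn : n ≠ 0) : {P : W.Point | n • P = 0}.Finite := by
  have := (tendsto_of_mem_ratEnd (W := W) (K := W.FunctionField) (natCast_mem _ n)
    (natCast_ne_zero W hn)).eventually eventually_ne_zero
  rw [eventually_cofinite] at this
  simpa using! this

variable (W p) in
lemma card_torsion_le (s : Finset W.Point) (hs : ∀ P ∈ s, p • P = 0) : s.card ≤ p := by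
  have h0 : HasLog W.FunctionField (p : AddMonoid.End W.Point) 0 := by
    have h := hasLog_natCast (W := W) (K := W.FunctionField) p
    have : CharP W.FunctionField p :=
      charP_of_injective_algebraMap (algebraMap F W.FunctionField).injective p
    rwa [CharP.cast_eq_zero W.FunctionField p] at h
  have hne := natCast_ne_zero W hp.out.ne_zero
  obtain ⟨u, d, hu, hu'⟩ := h0.exists_isXRep hne
  have hd : d = p ^ 2 := by
    have h1 := degree_eq (φ := (p : ratEnd W W.FunctionField)) hu
    have h2 := (isCompositionNorm_degree (W := W) (K := W.FunctionField)).map_natCast p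
    rw [h1] at h2
    exact_mod_cast h2
  have h2 : ∀ᶠ Q : W.Point in cofinite, (p * 2) • Q ≠ 0 := by
    rw [eventually_cofinite]
    simpa using finite_torsion W (mul_ne_zero hp.out.ne_zero two_ne_zero)
  have hgood : ∀ᶠ Q : W.Point in cofinite, ∀ T ∈ s, T + Q ≠ 0 ∧
      (p • (T + Q)).xRep 0 * (u 1).eval (xc (T + Q)) =
        (p • (T + Q)).xRep 1 * (u 0).eval (xc (T + Q)) := by
    rw [Finset.eventually_all]
    exact fun T _ => (add_right_injective T).tendsto_cofinite.eventually
      (eventually_ne_zero.and hu.eventually)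
  obtain ⟨Q, hQ2, hQ⟩ := (h2.and hgood).exists
  have hinj : Set.InjOn (fun T => xc (T + Q)) s := by
    intro T hT T' hT' h
    rcases eq_or_eq_neg_of_xc_eq (hQ T hT).1 (hQ T' hT').1 h with h | h
    · exact add_right_cancel h
    · have h3 := congrArg (fun P => p • P) h
      simp only [smul_neg, smul_add, hs T hT, hs T' hT', zero_add] at h3
      exact absurd (by rw [mul_smul, two_nsmul, smul_add]; exact eq_neg_iff_add_eq_zero.1 h3) hQ2
  rw [← Finset.card_image_of_injOn hinj]
  refine card_le_of_derivative_eq_zero (p := p) (hu.fibre_ne_zero hne (p • Q)) ?_ ?_ ?_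
  · simp [hu']
  · rw [← hd]
    exact (natDegree_sub_le _ _).trans (max_le ((natDegree_C_mul_le _ _).trans
      (hu.isMorphism.natDegree_le 1)) ((natDegree_C_mul_le _ _).trans
      (hu.isMorphism.natDegree_le 0)))
  · intro x hx
    obtain ⟨T, hT, rfl⟩ := Finset.mem_image.1 hx
    have := (hQ T hT).2
    rw [smul_add, hs T hT, zero_add] at this
    simp only [eval_sub, eval_mul, eval_C]
    linear_combination this

/-- In the presence of a point of order `p`, the `p`-primary torsion is locally cyclic. -/
lemma mem_zmultiples_of_torsion {T : ℕ → W.Point} (h0 : T 0 ≠ 0)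
    (h0' : p • T 0 = 0) (hT' : ∀ k, p • T (k + 1) = T k) (k : ℕ) {P : W.Point}
    (hP : p ^ (k + 1) • P = 0) : P ∈ AddSubgroup.zmultiples (T k) := by
  have hbase {P : W.Point} (hP : p • P = 0) : P ∈ AddSubgroup.zmultiples (T 0) := by
    by_contra hmem
    have ho : addOrderOf (T 0) = p := addOrderOf_eq_prime h0' h0
    classical
    have hcard := card_torsion_le W p (insert P ((Finset.range p).image fun n => n • T 0)) (by
      intro Q hQ
      rcases Finset.mem_insert.1 hQ with rfl | hQ
      · exact hP
      · obtain ⟨n, -, rfl⟩ := Finset.mem_image.1 hQ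
        rw [smul_comm, h0', smul_zero])
    rw [Finset.card_insert_of_notMem, Finset.card_image_of_injOn, Finset.card_range] at hcard
    · exact absurd hcard (by omega)
    · intro m hm n hn hmn
      refine nsmul_injOn_Iio_addOrderOf (x := T 0) ?_ ?_ hmn
      · simpa [ho] using hm
      · simpa [ho] using hn
    · intro h
      obtain ⟨n, -, rfl⟩ := Finset.mem_image.1 h
      exact hmem (AddSubgroup.nsmul_mem_zmultiples _ _)
  have hT0 (k : ℕ) : p ^ k • T k = T 0 := by
    induction k with
    | zero => simp
    | succ k ih => rw [pow_succ, mul_smul, hT', ih]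
  induction k generalizing P with
  | zero => exact hbase (by simpa using hP)
  | succ k ih =>
    rw [pow_succ, mul_smul] at hP
    obtain ⟨m, hm⟩ := AddSubgroup.mem_zmultiples_iff.1 (ih hP)
    have h1 : p • (P - m • T (k + 1)) = 0 := by
      rw [smul_sub, smul_comm, hT', hm, sub_self]
    have h2 := hbase h1
    have h3 : T 0 ∈ AddSubgroup.zmultiples (T (k + 1)) := by
      rw [← hT0 (k + 1)]
      exact AddSubgroup.nsmul_mem_zmultiples _ _
    have h4 := AddSubgroup.zmultiples_le_of_mem h3 h2
    have := add_mem h4 (AddSubgroup.zsmul_mem_zmultiples (T (k + 1)) m)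
    rwa [sub_add_cancel] at this

theorem ratEnd_mul_comm_of_torsion {P : W.Point} (hP : P ≠ 0) (hP' : p • P = 0)
    (hφ : φ ∈ ratEnd W K) (hψ : ψ ∈ ratEnd W K) : φ * ψ = ψ * φ := by
  obtain ⟨T, hT, h0, hT'⟩ := exists_division_tower (surjective_nsmul W hp.out.ne_zero) hP hP'
  have htors (k : ℕ) : p ^ (k + 1) • T k = 0 := by
    induction k with
    | zero => simpa [h0] using hP'
    | succ k ih => rw [pow_succ, mul_smul, hT', ih]
  have hmul (χ : AddMonoid.End W.Point) (k : ℕ) : ∃ m : ℤ, m • T k = χ (T k) := by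
    refine AddSubgroup.mem_zmultiples_iff.1
      (mem_zmultiples_of_torsion (p := p) (h0 ▸ hP) (h0 ▸ hP') hT' k ?_)
    exact (map_nsmul χ _ _).symm.trans ((congrArg χ (htors k)).trans (map_zero χ))
  rw [← sub_eq_zero]
  refine eq_zero_of_infinite_kernel (sub_mem (mul_mem hφ hψ) (mul_mem hψ hφ)) hT fun k => ?_
  obtain ⟨m, hm⟩ := hmul φ k
  obtain ⟨n, hn⟩ := hmul ψ k
  change φ (ψ (T k)) - ψ (φ (T k)) = 0
  rw [← hm, ← hn, sub_eq_zero]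
  refine (map_zsmul φ n (T k)).trans (Eq.trans ?_ (map_zsmul ψ m (T k)).symm)
  rw [← hm, ← hn, smul_comm]

end CharP

end EndomorphismLog
end EllipticEnd

namespace EllipticEnd
open WeierstrassCurve Filter Polynomial
open scoped Polynomial.Bivariate TensorProduct

/-! ### Regular endomorphisms are rational -/

lemma toAffineLift_of_point {F : Type*} [Field F] {V : WeierstrassCurve.Projective F} {P : V.Point}
    {p : Fin 3 → F} (h : P.point = ⟦p⟧) : P.toAffineLift = Projective.Point.toAffine V p := by
  rw [Projective.Point.toAffineLift, h]
  rfl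

section Regular
variable {F : Type*} [Field F] [IsAlgClosed F] {W : WeierstrassCurve.Affine F} [W.IsElliptic]

lemma evalAt_algebraMap {Q : W.Point} (hQ : Q ≠ 0) (c : F) :
    evalAt Q (algebraMap F W.CoordinateRing c) = c := by
  change evalAt Q (Affine.CoordinateRing.mk W (C (C c))) = c
  rw [evalAt_mk hQ, evalEval_C, eval_C]

/-- The values of a form at the points `[x : y : 1]` of the curve, as a regular function. -/
noncomputable def restrict (W : WeierstrassCurve.Affine F) (p : MvPolynomial (Fin 3) F) :
    W.CoordinateRing :=
  MvPolynomial.aeval ![Affine.CoordinateRing.mk W (C X), Affine.CoordinateRing.mk W Y, 1] p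

lemma evalAt_restrict {x y : F} (h : W.Nonsingular x y) (p : MvPolynomial (Fin 3) F) :
    evalAt (.some x y h) (restrict W p) = MvPolynomial.aeval ![x, y, 1] p := by
  rw [restrict, MvPolynomial.map_aeval, MvPolynomial.coe_eval₂Hom, MvPolynomial.aeval_def]
  congr 1
  · ext c
    exact evalAt_algebraMap (Affine.Point.some_ne_zero h) c
  · ext i
    fin_cases i
    · exact (evalAt_some h _).trans (by rw [evalEval_C, eval_X]; rfl)
    · exact (evalAt_some h _).trans (by rw [evalEval_X]; rfl)
    · simp

variable {K : Type*} [Field K] [Algebra W.CoordinateRing K] [Algebra F K]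
  [IsScalarTower F W.CoordinateRing K] [IsFractionRing W.CoordinateRing K]

lemma equation_of_eventually {f g : K} {a b : W.Point → F}
    (ha : germ W K f = (a : (cofinite : Filter W.Point).Germ F))
    (hb : germ W K g = (b : (cofinite : Filter W.Point).Germ F))
    (h : ∀ᶠ Q in cofinite, W.Equation (a Q) (b Q)) : (extend W K).Equation f g := by
  rw [Affine.equation_iff]
  apply (germ W K).injective
  simp only [map_a₁, map_a₂, map_a₃, map_a₄, map_a₆, map_add, map_mul, map_pow, germ_const, ha, hb]
  exact Germ.coe_eq.2 (h.mono fun Q hQ => (Affine.equation_iff ..).1 hQ)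

lemma exists_specializes_of_isRegularOver {φ : Projective.Point W.toProjective → W.toProjective.Point}
    (hφ : IsRegularOver F φ) : ∃ P, Specializes (germ W K)
      (fun Q : W.Point => (φ (Projective.Point.fromAffine Q)).toAffineLift) P := by
  obtain ⟨Q₀, hQ₀, -⟩ := exists_xc_eq (W := W) 0
  rcases Q₀ with _ | ⟨x₀, y₀, h₀⟩
  · exact absurd rfl hQ₀
  obtain ⟨n, G, -, hG, hφG⟩ := hφ (Projective.Point.fromAffine (.some x₀ y₀ h₀))
  set u : Fin 3 → W.CoordinateRing := fun i => restrict W (G i)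
  have hu {x y : F} (h : W.Nonsingular x y) (i : Fin 3) :
      evalAt (.some x y h) (u i) = evalVec G ![x, y, 1] i := evalAt_restrict h _
  obtain ⟨i, hi⟩ : ∃ i, u i ≠ 0 := by
    by_contra! h
    refine hG ![x₀, y₀, 1] rfl (_root_.funext fun i => ?_)
    rw [← hu h₀, h, map_zero]
    rfl
  have hpt {x y : F} (h : W.Nonsingular x y) (hi : evalAt (.some x y h) (u i) ≠ 0) :
      (φ (Projective.Point.fromAffine (.some x y h))).point = ⟦evalVec G ![x, y, 1]⟧ := by
    refine hφG _ _ rfl fun h0 => hi ?_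
    rw [hu, h0]
    rfl
  by_cases h2 : u 2 = 0
  · refine ⟨0, specializes_zero.2 ?_⟩
    filter_upwards [eventually_evalAt_ne hi, eventually_ne_zero] with Q hQ hQ0
    rcases Q with _ | ⟨x, y, h⟩
    · exact absurd rfl hQ0
    rw [toAffineLift_of_point (hpt h hQ)]
    refine Projective.Point.toAffine_of_Z_eq_zero ?_
    rw [← hu h, h2, map_zero]
  · have hgerm (i : Fin 3) : germ W K (algebraMap _ K (u i) / algebraMap _ K (u 2)) =
        ((fun Q => evalAt Q (u i) / evalAt Q (u 2) : W.Point → F) :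
          (cofinite : Filter W.Point).Germ F) :=
      germ_div (germ W K) (germ_algebraMap W K _) (germ_algebraMap W K _)
    have hev : ∀ᶠ Q : W.Point in cofinite, ∃ h, (φ (Projective.Point.fromAffine Q)).toAffineLift =
        .some (evalAt Q (u 0) / evalAt Q (u 2)) (evalAt Q (u 1) / evalAt Q (u 2)) h := by
      filter_upwards [eventually_evalAt_ne hi, eventually_ne_zero, eventually_evalAt_ne h2]
        with Q hQ hQ0 hQ2
      rcases Q with _ | ⟨x, y, h⟩
      · exact absurd rfl hQ0
      have e := hpt h hQ
      rw [hu] at hQ2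
      rw [toAffineLift_of_point e]
      simp only [hu]
      exact ⟨(Projective.nonsingular_of_Z_ne_zero hQ2).1 (nonsingular_of_point e),
        Projective.Point.toAffine_of_Z_ne_zero (nonsingular_of_point e) hQ2⟩
    have he := equation_of_eventually (hgerm 0) (hgerm 1) (hev.mono fun Q ⟨h, _⟩ => h.1)
    exact ⟨.some _ _ (Affine.equation_iff_nonsingular.1 he), _, _, hgerm 0, hgerm 1, hev⟩

end Regular

section Main
universe u
variable {k : Type u} [Field k] (W : WeierstrassCurve k)

lemma endAlgMap_injective : Function.Injective (endAlgMap W) := by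
  have : Module.Flat ℤ ℚ := inferInstance
  exact Module.Flat.lTensor_preserves_injective_linearMap (M := ℚ)
    (Subring.inclusion (endRing_le W)).toIntAlgHom.toLinearMap
    (Subring.inclusion_injective (endRing_le W))

variable [W.IsElliptic]

instance isElliptic_baseChange : (W.baseChange (AlgebraicClosure k)).toAffine.IsElliptic :=
  inferInstanceAs (W.map (algebraMap k (AlgebraicClosure k))).IsElliptic

/-- The endomorphism ring acts on the group of points in affine coordinates by rational maps. -/
lemma exists_embedding [DecidableEq (AlgebraicClosure k)] (L : Type u) [Field L] [Algebra k L]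
    [Algebra L (AlgebraicClosure k)] [IsScalarTower k L (AlgebraicClosure k)] :
    ∃ f : endRing W L →+* ratEnd (W.baseChange (AlgebraicClosure k)).toAffine
      (W.baseChange (AlgebraicClosure k)).toAffine.FunctionField, Function.Injective f := by
  let e := Projective.Point.toAffineAddEquiv (W.baseChange (AlgebraicClosure k)).toProjective
  let c : AddMonoid.End (GeomPoint W) →+*
      AddMonoid.End (W.baseChange (AlgebraicClosure k)).toAffine.Point :=
    { toFun := fun φ => (e.toAddMonoidHom.comp φ).comp e.symm.toAddMonoidHom
      map_one' := by ext P; exact e.apply_symm_apply P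
      map_mul' := fun φ ψ => by
        ext P
        change e (φ (ψ (e.symm P))) = e (φ (e.symm (e (ψ (e.symm P)))))
        rw [e.symm_apply_apply]
      map_zero' := by ext P; exact e.map_zero
      map_add' := fun φ ψ => by ext P; exact e.map_add _ _ }
  have hc (φ : endRing W L) : c φ.1 ∈ ratEnd (W.baseChange (AlgebraicClosure k)).toAffine
      (W.baseChange (AlgebraicClosure k)).toAffine.FunctionField :=
    exists_specializes_of_isRegularOver (W := (W.baseChange (AlgebraicClosure k)).toAffine)
      (φ := φ.1) (isRegularOver_extend φ.2)
  refine ⟨(c.comp (endRing W L).subtype).codRestrict _ hc, fun φ ψ h => ?_⟩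
  have h1 : c φ.1 = c ψ.1 := congrArg Subtype.val h
  apply Subtype.ext
  refine AddMonoidHom.ext fun P => ?_
  have h2 : e (φ.1 (e.symm (e P))) = e (ψ.1 (e.symm (e P))) := DFunLike.congr_fun h1 (e P)
  rw [e.symm_apply_apply] at h2
  exact e.injective h2

lemma exists_compositionNorm (L : Type u) [Field L] [Algebra k L]
    [Algebra L (AlgebraicClosure k)] [IsScalarTower k L (AlgebraicClosure k)] :
    ∃ N : endRing W L → ℤ, IsCompositionNorm N := by
  classical
  obtain ⟨f, hf⟩ := exists_embedding W L
  exact ⟨_, isCompositionNorm_degree.comp hf⟩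

lemma bijective_and_isQuaternionAlgebra (hc : ∃ x y : EndAlg W k, x * y ≠ y * x) :
    Function.Bijective (endAlgMap W) ∧ IsQuaternionAlgebra (EndAlg W k) := by
  obtain ⟨N, hN⟩ := exists_compositionNorm W k
  obtain ⟨N', hN'⟩ := exists_compositionNorm W (AlgebraicClosure k)
  have hq := hN.isQuaternionAlgebra_tensor hc
  have hinj := endAlgMap_injective W
  have hq' : IsQuaternionAlgebra (EndAlg W (AlgebraicClosure k)) := by
    obtain ⟨x, y, hxy⟩ := hc
    refine hN'.isQuaternionAlgebra_tensor ⟨endAlgMap W x, endAlgMap W y, fun h => hxy (hinj ?_)⟩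
    rw [map_mul, map_mul, h]
  have : FiniteDimensional ℚ (EndAlg W k) :=
    Module.finite_of_finrank_pos (by rw [hq.finrank]; norm_num)
  have : FiniteDimensional ℚ (EndAlg W (AlgebraicClosure k)) :=
    Module.finite_of_finrank_pos (by rw [hq'.finrank]; norm_num)
  exact ⟨⟨hinj, (LinearMap.injective_iff_surjective_of_finrank_eq_finrank
    (f := (endAlgMap W).toLinearMap) (hq.finrank.trans hq'.finrank.symm)).1 hinj⟩, hq⟩

lemma IsSpinorial.exists_not_commute {W : WeierstrassCurve k} (h : IsSpinorial W) :
    ∃ x y : EndAlg W k, x * y ≠ y * x := by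
  obtain ⟨σ, hσ, hne⟩ := h
  by_contra! hc
  exact hne (_root_.funext fun x => hσ.map_center x (Subring.mem_center_iff.2 fun y => hc y x))

lemma infinite_geomPoint : Infinite (GeomPoint W) := by
  classical
  exact (Projective.Point.toAffineAddEquiv
    (W.baseChange (AlgebraicClosure k)).toProjective).toEquiv.infinite_iff.2
      (infinite_point (W := (W.baseChange (AlgebraicClosure k)).toAffine))

lemma isSupersingular_of_not_commute (h : ∃ x y : EndAlg W k, x * y ≠ y * x) :
    IsSupersingular W := by
  classical
  intro P hP
  by_contra hP0
  obtain ⟨x, y, hxy⟩ := h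
  obtain ⟨f, hf⟩ := exists_embedding W k
  suffices hcomm : ∀ φ ∈ ratEnd (W.baseChange (AlgebraicClosure k)).toAffine
      (W.baseChange (AlgebraicClosure k)).toAffine.FunctionField,
      ∀ ψ ∈ ratEnd (W.baseChange (AlgebraicClosure k)).toAffine
      (W.baseChange (AlgebraicClosure k)).toAffine.FunctionField, φ * ψ = ψ * φ by
    refine hxy (tensor_mul_comm (fun a b => hf ?_) x y)
    rw [map_mul, map_mul]
    exact Subtype.ext (hcomm _ (f a).2 _ (f b).2)
  intro φ hφ ψ hψ
  rcases CharP.char_is_prime_or_zero k (ringChar k) with hp | h0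
  · have : Fact (ringChar k).Prime := ⟨hp⟩
    have : CharP (AlgebraicClosure k) (ringChar k) :=
      charP_of_injective_algebraMap (algebraMap k (AlgebraicClosure k)).injective _
    let e := Projective.Point.toAffineAddEquiv (W.baseChange (AlgebraicClosure k)).toProjective
    refine ratEnd_mul_comm_of_torsion (p := ringChar k) (P := e P) ?_ ?_ hφ hψ
    · exact (map_ne_zero_iff e e.injective).2 hP0
    · rw [← map_nsmul, hP, map_zero]
  · have : CharP k 0 := h0 ▸ ringChar.charP k
    have : CharZero k := CharP.charP_to_charZero k
    have : CharZero (AlgebraicClosure k) :=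
      charZero_of_injective_algebraMap (algebraMap k (AlgebraicClosure k)).injective
    exact ratEnd_mul_comm_of_charZero hφ hψ

lemma IsSupersingular.exists_prime {W : WeierstrassCurve k} [W.IsElliptic]
    (h : IsSupersingular W) : ∃ p : ℕ, p.Prime ∧ CharP k p := by
  rcases CharP.char_is_prime_or_zero k (ringChar k) with hp | h0
  · exact ⟨_, hp, inferInstance⟩
  · have := infinite_geomPoint W
    obtain ⟨P, hP⟩ := exists_ne (0 : GeomPoint W)
    exact absurd (h P (by rw [h0]; exact zero_nsmul P)) hP

end Main
end EllipticEnd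

theorem mainTheorem5 {k : Type*} [Field k] (W : WeierstrassCurve k) [W.IsElliptic] :
    (EllipticEnd.IsSpinorial W ↔
      Function.Bijective (EllipticEnd.endAlgMap W) ∧
        EllipticEnd.IsQuaternionAlgebra (EllipticEnd.EndAlg W k)) ∧
    ((Function.Bijective (EllipticEnd.endAlgMap W) ∧
        EllipticEnd.IsQuaternionAlgebra (EllipticEnd.EndAlg W k)) →
      EllipticEnd.IsSupersingular W) ∧
    (EllipticEnd.IsSupersingular W → ∃ p : ℕ, p.Prime ∧ CharP k p) :=
  ⟨⟨fun h => EllipticEnd.bijective_and_isQuaternionAlgebra W h.exists_not_commute,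
    fun h => h.2.exists_involution⟩,
    fun h => EllipticEnd.isSupersingular_of_not_commute W h.2.exists_not_commute,
    fun h => h.exists_prime⟩
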